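/- Let $\Sigma$ be a compact Riemann surface, possibly with boundary $\partial\Sigma$, let $D\subset\Sigma$ be a finite subset which does not meet $\partial\Sigma$, and let $\omega\in\mathcal A^2(\Sigma,\star D)$; that is, $\omega$ is a $2$-form which is smooth on $\Sigma\setminus D$ and which near each $p\in D$ is of the form $\alpha/z^n$, where $z$ is a local holomorphic coordinate with $z(p)=0$, $n\ge 0$ is an integer and $\alpha$ is a smooth $2$-form near $p$. Let $\mathcal A^{0,1}(\Sigma,\star D)$ be the space of $(0,1)$-forms with poles along $D$ defined in the same way, and let $\mathcal A^2(\Sigma,\log D)$ be the subspace of those $2$-forms which near each $p\in D$ are of the form $\beta\wedge\frac{dz}{z}$ with $\beta$ a smooth $(0,1)$-form. The regularized integral of $\omega$ is $$-\!\!\!\!\!\!\int_\Sigma\omega:=\int_\Sigma\alpha+\int_{\partial\Sigma}\beta,\qquad \omega=\alpha+\partial\beta,\quad \alpha\in\mathcal A^2(\Sigma,\log D),\ \beta\in\mathcal A^{0,1}(\Sigma,\star D).$$ Such $\alpha,\beta$ exist, $\int_\Sigma\alpha$ is absolutely convergent, and the value does not depend on the choice of $\alpha,\beta$. For each $p_i\in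 D$ let $z_i$ be a local holomorphic coordinate around $p_i$ with $z_i(p_i)=0$, and let $B^i_\epsilon=\{|z_i|\le\epsilon\}$. Then, for every $\epsilon>0$, $\int_{\Sigma\setminus\bigcup_iB^i_\epsilon}\omega$ is absolutely convergent, and $$-\!\!\!\!\!\!\int_\Sigma\omega=\lim_{\epsilon\to0^+}\int_{\Sigma\setminus\bigcup_iB^i_\epsilon}\omega .$$ In particular, this limit exists and does not depend on the choice of the local coordinates $z_i$. -/

import Mathlib

open Set Filter Topology MeasureTheory Manifold
open scoped ContDiff

namespace RiemannSurface

/-- The closed upper half-plane `{z ∈ ℂ | 0 ≤ Im z}`, the local model of a Riemann surface with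
boundary. -/
abbrev ClosedHalfPlane : Type := {z : ℂ // 0 ≤ z.im}

theorem range_closedHalfPlane :
    range (Subtype.val : ClosedHalfPlane → ℂ) = {z : ℂ | 0 ≤ z.im} := Subtype.range_val

/-- The closed half-plane as a model with corners over `ℂ`. Since differentiability is over `ℂ`,
a space `X` with `IsManifold halfPlaneModel ∞ X` has coordinate changes which are holomorphic in
the interior and smooth up to the boundary: `X` is a Riemann surface, possibly with boundary. -/
noncomputable def halfPlaneModel : ModelWithCorners ℂ ℂ ClosedHalfPlane where
  toFun := Subtype.val
  invFun z := ⟨⟨z.re, max z.im 0⟩, le_max_right _ _⟩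
  source := univ
  target := {z : ℂ | 0 ≤ z.im}
  map_source' z _ := z.2
  map_target' _ _ := mem_univ _
  left_inv' z _ := Subtype.ext (Complex.ext rfl (max_eq_left z.2))
  right_inv' z hz := Complex.ext rfl (max_eq_left hz)
  source_eq := rfl
  convex_range' := by
    simp only [instIsRCLikeNormedField, ↓reduceDIte]
    apply Convex.convex_isRCLikeNormedField
    change Convex ℝ (range (Subtype.val : ClosedHalfPlane → ℂ))
    rw [range_closedHalfPlane]
    exact convex_halfSpace_im_ge 0
  nonempty_interior' := by
    change (interior (range (Subtype.val : ClosedHalfPlane → ℂ))).Nonempty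
    rw [range_closedHalfPlane]
    refine ⟨Complex.I, mem_interior.2 ⟨{z : ℂ | 0 < z.im}, fun z (hz : 0 < z.im) => hz.le, ?_, ?_⟩⟩
    · exact isOpen_lt continuous_const Complex.continuous_im
    · simp
  continuous_toFun := continuous_subtype_val
  continuous_invFun := by
    refine Continuous.subtype_mk ?_ _
    have h : (fun z : ℂ => (⟨z.re, max z.im 0⟩ : ℂ)) =
        fun z : ℂ => (z.re : ℂ) + ((max z.im 0 : ℝ) : ℂ) * Complex.I := by
      funext z
      apply Complex.ext <;> simp
    rw [h]
    fun_prop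

variable {X : Type*} [TopologicalSpace X] [ChartedSpace ClosedHalfPlane X]

/-- The chart `e` of the atlas, regarded as a complex coordinate on `X`. -/
noncomputable abbrev coord (e : atlas ClosedHalfPlane X) : PartialEquiv X ℂ :=
  (e : OpenPartialHomeomorph X ClosedHalfPlane).extend halfPlaneModel

/-- The complex derivative at `x` of the coordinate change from `e` to `e'`, that is `dz'/dz`. -/
noncomputable def transDeriv (e e' : atlas ClosedHalfPlane X) (x : X) : ℂ :=
  derivWithin (coord e' ∘ (coord e).symm) (range halfPlaneModel) (coord e x)

/-- In the coordinate `e`, near the point `p`, the function `f` is of the form `h / (z - z(p))^n`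
with `h` smooth on a neighbourhood of `z(p)`. -/
def HasPoleOfOrderLE (f : ℂ → ℂ) (e : atlas ClosedHalfPlane X) (p : X) (n : ℕ) : Prop :=
  ∃ U ∈ 𝓝 (coord e p), ∃ h : ℂ → ℂ, ContDiffOn ℝ ∞ h U ∧
    ∀ z ∈ U, z ≠ coord e p → f z = h z / (z - coord e p) ^ n

variable (X) in
/-- The space `A^{a,b}(X, ⋆D)` of `(a,b)`-forms which are smooth on `X ∖ D` and have holomorphic
poles of arbitrary order along `D`. A form is given by its coefficient functions in the coordinates
of the atlas: in the coordinate `z` given by the chart `e` the form is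
`coeff e (z) (dz)^a ∧ (dz̄)^b`. Only the values at points of the chart domain which do not lie in `D`
are meaningful. -/
structure PolarForm (a b : ℕ) (D : Set X) where
  /-- The coefficient functions. -/
  coeff : atlas ClosedHalfPlane X → ℂ → ℂ
  compat : ∀ e e' : atlas ClosedHalfPlane X,
    ∀ x ∈ (coord e).source ∩ (coord e').source, x ∉ D →
      coeff e (coord e x) = coeff e' (coord e' x) *
        transDeriv e e' x ^ a * (starRingEnd ℂ) (transDeriv e e' x) ^ b
  smooth : ∀ e : atlas ClosedHalfPlane X,
    ContDiffOn ℝ ∞ (coeff e) {z ∈ (coord e).target | (coord e).symm z ∉ D}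
  pole : ∀ e : atlas ClosedHalfPlane X, ∀ p ∈ D, p ∈ (coord e).source →
    ∃ n : ℕ, HasPoleOfOrderLE (coeff e) e p n

variable {D : Set X}

/-- The form has at most logarithmic poles along `D`. For `(1,1)`-forms this describes
`A^{1,1}(X, log D) = A^2(X, log D)`: locally the form is `h dz/z ∧ dz̄` with `h` smooth. -/
def PolarForm.IsLog (α : PolarForm X 1 1 D) : Prop :=
  ∀ e : atlas ClosedHalfPlane X, ∀ p ∈ D, p ∈ (coord e).source →
    HasPoleOfOrderLE (α.coeff e) e p 1

/-- The Wirtinger derivative `∂g/∂z = (∂g/∂x - i ∂g/∂y) / 2` of a function on (an open subset of)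
the closed half-plane. -/
noncomputable def wirtinger (g : ℂ → ℂ) (z : ℂ) : ℂ :=
  (fderivWithin ℝ g (range halfPlaneModel) z 1 -
    Complex.I * fderivWithin ℝ g (range halfPlaneModel) z Complex.I) / 2

/-- `η = α + ∂β` on `X ∖ D`, where `∂(g dz̄) = (∂g/∂z) dz ∧ dz̄`. -/
def EqAddDel (η α : PolarForm X 1 1 D) (β : PolarForm X 0 1 D) : Prop :=
  ∀ e : atlas ClosedHalfPlane X, ∀ z ∈ (coord e).target, (coord e).symm z ∉ D →
    η.coeff e z = α.coeff e z + wirtinger (β.coeff e) z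

/-- A decomposition `η = α + ∂β` with `α ∈ A^2(X, log D)` and `β ∈ A^{0,1}(X, ⋆D)`. -/
def IsDecomposition (η α : PolarForm X 1 1 D) (β : PolarForm X 0 1 D) : Prop :=
  α.IsLog ∧ EqAddDel η α β

section Integration

variable [CompactSpace X] [T2Space X]

variable (X) in
theorem exists_partition : ∃ ρ : PartitionOfUnity (atlas ClosedHalfPlane X) X univ,
    ρ.IsSubordinate fun e => (e : OpenPartialHomeomorph X ClosedHalfPlane).source := by
  refine PartitionOfUnity.exists_isSubordinate isClosed_univ _ (fun e => e.1.open_source) ?_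
  intro x _
  exact mem_iUnion.2 ⟨⟨chartAt ClosedHalfPlane x, chart_mem_atlas _ x⟩, mem_chart_source _ x⟩

variable (X) in
/-- A partition of unity subordinate to the cover of `X` by the domains of the charts. (As usual,
the integrals below do not depend on which one is used.) -/
noncomputable def partition : PartitionOfUnity (atlas ClosedHalfPlane X) X univ :=
  (exists_partition X).choose

/-- The part of the integrand of `∫_A η` carried by the chart `e`, with respect to Lebesgue measure
`dx dy`; note that `dz ∧ dz̄ = -2i dx ∧ dy`. -/
noncomputable def PolarForm.integrand (η : PolarForm X 1 1 D) (e : atlas ClosedHalfPlane X)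
    (z : ℂ) : ℂ :=
  -2 * Complex.I * (partition X e ((coord e).symm z) : ℂ) * η.coeff e z

/-- `∫_A η` is absolutely convergent. -/
def PolarForm.AbsConvergentOn (η : PolarForm X 1 1 D) (A : Set X) : Prop :=
  ∀ e : atlas ClosedHalfPlane X,
    IntegrableOn (η.integrand e) {z ∈ (coord e).target | (coord e).symm z ∈ A}

/-- The integral `∫_A η` of a 2-form over a subset `A` of `X`. Only finitely many of the
charts contribute, since `X` is compact and the partition of unity is locally finite. -/
noncomputable def PolarForm.integralOn (η : PolarForm X 1 1 D) (A : Set X) : ℂ :=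
  ∑ᶠ e : atlas ClosedHalfPlane X,
    ∫ z in {z ∈ (coord e).target | (coord e).symm z ∈ A}, η.integrand e z

/-- The integral `∫_{∂X} β`. In a chart the boundary is the part of the chart domain which is mapped
to the real axis, it is oriented as the boundary of the upper half-plane (from left to right), and
`g dz̄` restricts to `g dt` on it. -/
noncomputable def PolarForm.boundaryIntegral (β : PolarForm X 0 1 D) : ℂ :=
  ∑ᶠ e : atlas ClosedHalfPlane X,
    ∫ t in {t : ℝ | (t : ℂ) ∈ (coord e).target},
      (partition X e ((coord e).symm (t : ℂ)) : ℂ) * β.coeff e (t : ℂ)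

open Classical in
/-- The regularized integral of `η ∈ A^2(X, ⋆D)`: it is `∫_X α + ∫_{∂X} β` for a decomposition
`η = α + ∂β` with `α ∈ A^2(X, log D)` and `β ∈ A^{0,1}(X, ⋆D)`. -/
noncomputable def PolarForm.regularizedIntegral (η : PolarForm X 1 1 D) : ℂ :=
  if h : ∃ αβ : PolarForm X 1 1 D × PolarForm X 0 1 D, IsDecomposition η αβ.1 αβ.2 then
    h.choose.1.integralOn univ + h.choose.2.boundaryIntegral
  else 0

end Integration

/-- `z` is a local holomorphic coordinate around `p` with `z(p) = 0`: a biholomorphic map from an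
open neighbourhood of `p` in `X` onto an open subset of `ℂ`. -/
def IsLocalCoordinateAt (z : OpenPartialHomeomorph X ℂ) (p : X) : Prop :=
  p ∈ z.source ∧ z p = 0 ∧ ContMDiffOn halfPlaneModel 𝓘(ℂ, ℂ) ∞ z z.source ∧
    ContMDiffOn 𝓘(ℂ, ℂ) halfPlaneModel ∞ z.symm z.target

/-- The ball `{|z| ≤ ε}` of a local coordinate `z`. -/
def coordBall (z : OpenPartialHomeomorph X ℂ) (ε : ℝ) : Set X :=
  {x ∈ z.source | ‖z x‖ ≤ ε}

end RiemannSurface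

/-! Write `η = α + ∂β`. The logarithmic part `α` is absolutely integrable, because `1/z` is locally
integrable in the plane, so its integrals over the complements of the discs converge to `∫_X α` by
dominated convergence. Everything therefore rests on a principal-value form of Stokes' theorem: the
integral of `∂β` over the complement of the discs tends to `∫_{∂X} β`.

By a smooth partition of unity this is local. Away from `D` it is Stokes' theorem on the closed
half-plane. Near `p ∈ D`, write `β = G dz̄ / z^m` in the given local coordinate, with `G` smooth of
bounded support. Stokes' theorem outside the disc of radius `t` leaves an integral over the circle,
namely `t^(1-m)` times the Fourier coefficient of `G(t e^{iθ})` of index `m + 1`, up to a unit. A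
Taylor monomial `z^a z̄^b` contributes to that coefficient only if `a - b = m + 1`, and then has
size at least `t^(m+1)`; so the circle term is `O(t^2)`. This cancellation needs poles which are
holomorphic, but nothing special about the coordinate. The estimate is `exists_norm_circleCoeff_le`,
the local limit `tendsto_integral_dzPart_pole`, the global one `stokesLimit`.

Decompositions exist because `∂` applied to a multiple of `h dz̄ / z^n` removes the leading term of
a pole of order `n + 1 ≥ 2` (`exists_sub_dzPart_poleAt_one`); these local primitives are cut off and
added up over the points of `D`.

The limit statement holds for every decomposition and every choice of coordinates
(`IsDecomposition.tendsto_integralOn`), and both independence claims follow by uniqueness of limits.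

The integrals are defined by a partition of unity that is only continuous, one chart at a time. The
bridge to calculus in a single chart is `PolarForm.integralOn_eq_setIntegral` and its boundary
analogue. -/

namespace RiemannSurface

/-! ### Type decomposition of real linear maps -/

/-- The coefficient `(L 1 - i L i) / 2` of `dz` in a real linear map `L`. -/
noncomputable def dzPart (L : ℂ →L[ℝ] ℂ) : ℂ := (L 1 - Complex.I * L Complex.I) / 2

/-- The coefficient `(L 1 + i L i) / 2` of `dz̄` in a real linear map `L`. -/
noncomputable def dzbarPart (L : ℂ →L[ℝ] ℂ) : ℂ := (L 1 + Complex.I * L Complex.I) / 2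

theorem apply_eq_dzPart_add (L : ℂ →L[ℝ] ℂ) (v : ℂ) :
    L v = dzPart L * v + dzbarPart L * (starRingEnd ℂ) v := by
  have hv : L v = v.re * L 1 + v.im * L Complex.I := by
    conv_lhs => rw [show v = v.re • (1 : ℂ) + v.im • Complex.I by simp]
    rw [map_add, map_smul, map_smul]
    simp
  rw [hv, dzPart, dzbarPart]
  apply Complex.ext <;> simp <;> ring

theorem continuous_dzPart : Continuous dzPart := by
  unfold dzPart
  fun_prop

theorem dzPart_add (L M : ℂ →L[ℝ] ℂ) : dzPart (L + M) = dzPart L + dzPart M := by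
  simp [dzPart]; ring

theorem dzPart_smul (c : ℂ) (L : ℂ →L[ℝ] ℂ) : dzPart (c • L) = c * dzPart L := by
  simp [dzPart]; ring

@[simp] theorem dzPart_zero : dzPart 0 = 0 := by simp [dzPart]

theorem range_halfPlaneModel : range halfPlaneModel = {z : ℂ | 0 ≤ z.im} :=
  range_closedHalfPlane

theorem wirtinger_eq (g : ℂ → ℂ) (z : ℂ) :
    wirtinger g z = dzPart (fderivWithin ℝ g (range halfPlaneModel) z) := rfl

/-- Complex multiplication as a real linear map. -/
noncomputable abbrev mulL (c : ℂ) : ℂ →L[ℝ] ℂ :=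
  (ContinuousLinearMap.toSpanSingleton ℂ c).restrictScalars ℝ

/-- This is the Jacobian of a holomorphic map, the factor by which a `(1,1)`-form transforms. -/
theorem det_mulL (c : ℂ) : (mulL c).det = ‖c‖ ^ 2 := by
  rw [ContinuousLinearMap.det]
  have := LinearMap.det_toMatrix Complex.basisOneI (mulL c : ℂ →ₗ[ℝ] ℂ)
  rw [← this, Matrix.det_fin_two]
  simp [LinearMap.toMatrix_apply, Complex.sq_norm, Complex.normSq_apply]

theorem dzPart_mulL (c : ℂ) : dzPart (mulL c) = c := by
  simp only [dzPart, ContinuousLinearMap.coe_restrictScalars', ContinuousLinearMap.toSpanSingleton_apply, smul_eq_mul]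
  linear_combination (-c / 2) * Complex.I_mul_I

/-- The Wirtinger derivative of the pull-back of `g dz̄` by a holomorphic map. -/
theorem exists_hasFDerivWithinAt_pullback {g φ φ' : ℂ → ℂ} {s t : Set ℂ} {z c : ℂ} {L : ℂ →L[ℝ] ℂ}
    (hg : HasFDerivWithinAt g L t (φ z)) (hφ : HasDerivWithinAt φ (φ' z) s z)
    (hφ' : HasDerivWithinAt φ' c s z) (hst : MapsTo φ s t) :
    ∃ M : ℂ →L[ℝ] ℂ, HasFDerivWithinAt (fun w => g (φ w) * (starRingEnd ℂ) (φ' w)) M s z ∧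
      dzPart M = dzPart L * φ' z * (starRingEnd ℂ) (φ' z) := by
  have h1 : HasFDerivWithinAt φ (mulL (φ' z)) s z := hφ.hasFDerivWithinAt.restrictScalars ℝ
  have h2 : HasFDerivWithinAt φ' (mulL c) s z := hφ'.hasFDerivWithinAt.restrictScalars ℝ
  have h3 := hg.comp z h1 hst
  have h4 : HasFDerivWithinAt (fun w => (starRingEnd ℂ) (φ' w))
      ((Complex.conjCLE : ℂ →L[ℝ] ℂ).comp (mulL c)) s z :=
    (Complex.conjCLE : ℂ →L[ℝ] ℂ).hasFDerivAt.comp_hasFDerivWithinAt z h2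
  refine ⟨_, h3.mul h4, ?_⟩
  -- The derivative of the conjugate of `φ'` is conjugate-linear and has no `dz` part, so only the
  -- term containing `L` contributes. Precomposing `L` with multiplication by `φ' z` multiplies its
  -- `dz` part by `φ' z`.
  have key := apply_eq_dzPart_add L (φ' z)
  have key2 := apply_eq_dzPart_add L (Complex.I * φ' z)
  simp [dzPart] at *
  rw [key, key2]
  ring_nf
  simp only [Complex.I_sq, Complex.I_pow_three]
  ring

/-! ### Stokes' theorem on rectangles and on the half-plane -/

theorem setIntegral_reProdIm (F : ℂ → ℂ) {s t : Set ℝ} 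
    (hF : IntegrableOn F (s ×ℂ t)) :
    ∫ z in s ×ℂ t, F z = ∫ x in s, ∫ y in t, F (x + y * Complex.I) := by
  have hpre : Complex.measurableEquivRealProd.symm ⁻¹' (s ×ℂ t) = s ×ˢ t := by
    ext p; simp [Complex.mem_reProdIm]
  have h1 := (Complex.volume_preserving_equiv_real_prod.symm).setIntegral_preimage_emb
    Complex.measurableEquivRealProd.symm.measurableEmbedding F (s ×ℂ t)
  have h2 := (Complex.volume_preserving_equiv_real_prod.symm).integrableOn_comp_preimage
    (Complex.measurableEquivRealProd.symm.measurableEmbedding) (f := F) (s := s ×ℂ t)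
  rw [hpre] at h1 h2
  rw [← h1, Measure.volume_eq_prod]
  refine (setIntegral_prod _ (h2.2 hF)).trans ?_
  refine integral_congr_ae (Eventually.of_forall fun x => ?_)
  refine integral_congr_ae (Eventually.of_forall fun y => ?_)
  simp [Complex.mk_eq_add_mul_I]

/-- Stokes' theorem for `g dz̄` on a rectangle. -/
theorem integral_dzPart_rect {g : ℂ → ℂ} {g' : ℂ → ℂ →L[ℝ] ℂ} {a b c d : ℝ} (hab : a ≤ b)
    (hcd : c ≤ d) (hc : ContinuousOn g (Icc a b ×ℂ Icc c d))
    (hd : ∀ z ∈ Ioo a b ×ℂ Ioo c d, HasFDerivAt g (g' z) z)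
    (hi : IntegrableOn (fun z => -2 * Complex.I * dzPart (g' z)) (Icc a b ×ℂ Icc c d)) :
    ∫ z in Icc a b ×ℂ Icc c d, -2 * Complex.I * dzPart (g' z) =
      (∫ x in a..b, g (x + c * Complex.I)) - (∫ x in a..b, g (x + d * Complex.I))
      - Complex.I * (∫ y in c..d, g (b + y * Complex.I))
      + Complex.I * ∫ y in c..d, g (a + y * Complex.I) := by
  -- The rectangle formula used below is the one for `f dz` and `∂f/∂z̄`. It is applied to the
  -- conjugate of `g`, and the result is conjugated back.
  have key : ∀ z, Complex.I • ((Complex.conjCLE : ℂ →L[ℝ] ℂ).comp (g' z)) 1 -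
      ((Complex.conjCLE : ℂ →L[ℝ] ℂ).comp (g' z)) Complex.I =
      (starRingEnd ℂ) (-2 * Complex.I * dzPart (g' z)) := by
    intro z
    simp [dzPart]
    ring_nf
    simp only [map_ofNat, Complex.I_sq]
    ring
  have h := Complex.integral_boundary_rect_of_continuousOn_of_hasFDerivAt_real
    (fun z => (starRingEnd ℂ) (g z)) (fun z => (Complex.conjCLE : ℂ →L[ℝ] ℂ).comp (g' z))
    ⟨a, c⟩ ⟨b, d⟩ ?_ ?_ ?_
  · simp only [key, intervalIntegral.intervalIntegral_conj] at h
    have h2 := congrArg (starRingEnd ℂ) h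
    rw [setIntegral_reProdIm _ hi, integral_Icc_eq_integral_Ioc,
      ← intervalIntegral.integral_of_le hab]
    simp only [integral_Icc_eq_integral_Ioc, ← intervalIntegral.integral_of_le hcd]
    simp only [map_sub, map_add, smul_eq_mul, map_mul, Complex.conj_I,
      Complex.conj_conj] at h2
    rw [← h2]
    ring
  · simp only [uIcc_of_le hab, uIcc_of_le hcd]
    exact Complex.continuous_conj.comp_continuousOn hc
  · simp only [min_eq_left hab, max_eq_right hab, min_eq_left hcd, max_eq_right hcd]
    intro z hz
    exact (Complex.conjCLE : ℂ →L[ℝ] ℂ).hasFDerivAt.comp z (hd z hz)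
  · simp only [key, uIcc_of_le hab, uIcc_of_le hcd]
    exact (Complex.conjCLE : ℂ →L[ℝ] ℂ).integrable_comp hi

theorem uniqueDiffOn_range_halfPlaneModel : UniqueDiffOn ℝ (range halfPlaneModel) := by
  rw [range_halfPlaneModel]
  refine uniqueDiffOn_convex (convex_halfSpace_im_ge 0) ⟨Complex.I, mem_interior.2
    ⟨{z : ℂ | 0 < z.im}, fun z (hz : 0 < z.im) => hz.le,
      isOpen_lt continuous_const Complex.continuous_im, by simp⟩⟩

theorem range_halfPlaneModel_mem_nhds {z : ℂ} (hz : 0 < z.im) : range halfPlaneModel ∈ 𝓝 z := by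
  rw [range_halfPlaneModel]
  filter_upwards [(isOpen_lt continuous_const Complex.continuous_im).mem_nhds hz] with w hw
  exact le_of_lt hw

/-- Stokes' theorem for a form `g dz̄` with bounded support on the closed half-plane. -/
theorem integral_wirtinger_halfPlane {g : ℂ → ℂ} (hg : ContDiffOn ℝ ∞ g (range halfPlaneModel))
    {R : ℝ} (hR : ∀ z ∈ range halfPlaneModel, R ≤ ‖z‖ → g z = 0) :
    ∫ z in range halfPlaneModel, -2 * Complex.I * wirtinger g z = ∫ t : ℝ, g t := by
  wlog hR0 : 0 < R generalizing R
  · exact this (R := 1) (fun z hz h => hR z hz (by linarith)) one_pos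
  have hdc : ContinuousOn (fun z => -2 * Complex.I * wirtinger g z) (range halfPlaneModel) :=
    continuousOn_const.mul (continuous_dzPart.comp_continuousOn
      (hg.continuousOn_fderivWithin uniqueDiffOn_range_halfPlaneModel (by simp)))
  -- The rectangle stands on the real axis and its other three sides lie in `R ≤ ‖z‖`, where `g`
  -- vanishes; only the bottom side survives.
  set Q : Set ℂ := Icc (-R) R ×ℂ Icc 0 R with hQ
  have hQH : Q ⊆ range halfPlaneModel := by
    rw [range_halfPlaneModel]
    exact fun z hz => hz.2.1
  have hQc : IsCompact Q := isCompact_Icc.reProdIm isCompact_Icc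
  have hout : ∀ z ∈ range halfPlaneModel \ Q, -2 * Complex.I * wirtinger g z = 0 := by
    intro z hz
    have hzR : R < ‖z‖ := by
      by_contra! hle
      refine hz.2 ⟨?_, ?_⟩
      · exact abs_le.1 ((Complex.abs_re_le_norm z).trans hle)
      · have := hz.1
        rw [range_halfPlaneModel] at this
        exact ⟨this, (abs_le.1 ((Complex.abs_im_le_norm z).trans hle)).2⟩
    have hev : g =ᶠ[𝓝[range halfPlaneModel] z] fun _ => 0 := by
      have : {w : ℂ | R < ‖w‖} ∈ 𝓝 z := (isOpen_lt continuous_const continuous_norm).mem_nhds hzR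
      filter_upwards [mem_nhdsWithin_of_mem_nhds this, self_mem_nhdsWithin] with w hw hw'
      exact hR w hw' (le_of_lt hw)
    rw [wirtinger_eq, hev.fderivWithin_eq_of_mem hz.1]
    simp
  rw [setIntegral_eq_of_subset_of_forall_sdiff_eq_zero (s := Q)
    (by rw [range_halfPlaneModel]; exact (isClosed_le continuous_const Complex.continuous_im).measurableSet) hQH hout]
  have hz1 : ∀ x : ℝ, ∀ y : ℝ, 0 ≤ y → R ≤ |x| ∨ R ≤ y → g (x + y * Complex.I) = 0 := by
    intro x y hy h
    refine hR _ (by rw [range_halfPlaneModel]; simpa using hy) ?_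
    rcases h with h | h
    · exact h.trans (by simpa using Complex.abs_re_le_norm (x + y * Complex.I))
    · exact h.trans ((le_abs_self y).trans (by simpa using Complex.abs_im_le_norm (x + y * Complex.I)))
  have := integral_dzPart_rect (g := g) (g' := fun z => fderivWithin ℝ g (range halfPlaneModel) z)
    (a := -R) (b := R) (c := 0) (d := R) (by linarith) hR0.le (hg.continuousOn.mono hQH) ?_
    ((hdc.mono hQH).integrableOn_compact hQc)
  · refine this.trans ?_
    have e1 : ∫ x in (-R)..R, g (x + (R : ℝ) * Complex.I) = 0 := by
      rw [intervalIntegral.integral_congr (g := fun _ => 0)]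
      · simp
      · intro x _
        exact hz1 x R hR0.le (Or.inr le_rfl)
    have e2 : ∀ b : ℝ, R ≤ |b| → ∫ y in (0 : ℝ)..R, g (b + y * Complex.I) = 0 := by
      intro b hb
      rw [intervalIntegral.integral_congr (g := fun _ => 0)]
      · simp
      · intro y hy
        rw [uIcc_of_le hR0.le] at hy
        exact hz1 b y hy.1 (Or.inl hb)
    rw [e1, e2 R (le_abs_self R), e2 (-R) (by rw [abs_neg]; exact le_abs_self R)]
    simp only [Complex.ofReal_zero, zero_mul, add_zero, mul_zero, sub_zero]
    rw [intervalIntegral.integral_of_le (by linarith)]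
    refine setIntegral_eq_integral_of_forall_compl_eq_zero fun x hx => ?_
    have := hz1 x 0 le_rfl ?_
    · simpa using this
    · left
      by_contra! h
      exact hx ⟨(abs_lt.1 h).1, (abs_lt.1 h).2.le⟩
  · intro z hz
    have hz' : 0 < z.im := hz.2.1
    have := range_halfPlaneModel_mem_nhds hz'
    exact ((hg z (mem_of_mem_nhds this)).differentiableWithinAt (by simp)).hasFDerivWithinAt.hasFDerivAt this

/-! ### Decay of Fourier coefficients on small circles -/

/-- The `k`-th Fourier coefficient (times `2π`) of `G` on the circle of radius `t`. -/
noncomputable def circleCoeff (G : ℂ → ℂ) (k : ℕ) (t : ℝ) : ℂ :=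
  ∫ θ in (-Real.pi)..Real.pi,
    G (t * Complex.exp (θ * Complex.I)) * Complex.exp (-(θ * Complex.I)) ^ k

theorem hasDerivAt_exp_mul_I (θ : ℝ) : HasDerivAt (fun θ : ℝ => Complex.exp (θ * Complex.I))
    (Complex.I * Complex.exp (θ * Complex.I)) θ := by
  have h : HasDerivAt (fun θ : ℝ => (θ : ℂ) * Complex.I) Complex.I θ := by
    simpa using (Complex.ofRealCLM.hasDerivAt (x := θ)).mul_const Complex.I
  simpa [mul_comm] using h.cexp

theorem hasDerivAt_exp_neg_mul_I (θ : ℝ) :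
    HasDerivAt (fun θ : ℝ => Complex.exp (-(θ * Complex.I)))
    (-Complex.I * Complex.exp (-(θ * Complex.I))) θ := by
  have h : HasDerivAt (fun θ : ℝ => -((θ : ℂ) * Complex.I)) (-Complex.I) θ := by
    simpa using ((Complex.ofRealCLM.hasDerivAt (x := θ)).mul_const Complex.I).fun_neg
  simpa [mul_comm] using h.cexp

theorem contDiff_dzPart {G : ℂ → ℂ} (hG : ContDiff ℝ ∞ G) :
    ContDiff ℝ ∞ fun z => dzPart (fderiv ℝ G z) := by
  have h := hG.fderiv_right (m := ∞) (by simp)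
  unfold dzPart
  fun_prop

theorem contDiff_dzbarPart {G : ℂ → ℂ} (hG : ContDiff ℝ ∞ G) :
    ContDiff ℝ ∞ fun z => dzbarPart (fderiv ℝ G z) := by
  have h := hG.fderiv_right (m := ∞) (by simp)
  unfold dzbarPart
  fun_prop

theorem conj_exp_mul_I (θ : ℝ) :
    (starRingEnd ℂ) (Complex.exp (θ * Complex.I)) = Complex.exp (-(θ * Complex.I)) := by
  rw [← Complex.exp_conj]
  simp

theorem exp_pi_mul_I_eq : Complex.exp (((-Real.pi : ℝ) : ℂ) * Complex.I) =
    Complex.exp ((Real.pi : ℂ) * Complex.I) := by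
  push_cast
  rw [Complex.exp_pi_mul_I, neg_mul, Complex.exp_neg_pi_mul_I]

/-- Integration by parts on the circle: the `θ`-derivative of `G(t e^{iθ}) e^{-i(k+1)θ}` integrates
to zero over a period, and `G(t e^{iθ})` has `θ`-derivative `i t (e^{iθ} ∂G - e^{-iθ} ∂̄G)`. The
gain is the factor `t`. -/
theorem circleCoeff_succ {G : ℂ → ℂ} (hG : ContDiff ℝ ∞ G) (k : ℕ) (t : ℝ) :
    ((k : ℂ) + 1) * circleCoeff G (k + 1) t =
      t * (circleCoeff (fun z => dzPart (fderiv ℝ G z)) k t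
        - circleCoeff (fun z => dzbarPart (fderiv ℝ G z)) (k + 2) t) := by
  obtain ⟨A, hA'⟩ : ∃ A : ℂ → ℂ, A = fun z => dzPart (fderiv ℝ G z) := ⟨_, rfl⟩
  obtain ⟨B, hB'⟩ : ∃ B : ℂ → ℂ, B = fun z => dzbarPart (fderiv ℝ G z) := ⟨_, rfl⟩
  have hA : Continuous A := hA' ▸ (contDiff_dzPart hG).continuous
  have hB : Continuous B := hB' ▸ (contDiff_dzbarPart hG).continuous
  have hAB : ∀ z v, fderiv ℝ G z v = A z * v + B z * (starRingEnd ℂ) v := by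
    intro z v
    rw [hA', hB', apply_eq_dzPart_add]
  rw [← hA', ← hB']
  have hC := hG.continuous
  have hd : ∀ θ ∈ uIcc (-Real.pi) Real.pi, HasDerivAt
      (fun θ : ℝ => G (t * Complex.exp (θ * Complex.I)) * Complex.exp (-(θ * Complex.I)) ^ (k + 1))
      (Complex.I * (t * (A (t * Complex.exp (θ * Complex.I)) *
          Complex.exp (-(θ * Complex.I)) ^ k -
        B (t * Complex.exp (θ * Complex.I)) *
          Complex.exp (-(θ * Complex.I)) ^ (k + 2)) -
        ((k : ℂ) + 1) * (G (t * Complex.exp (θ * Complex.I)) *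
          Complex.exp (-(θ * Complex.I)) ^ (k + 1)))) θ := by
    intro θ _
    have h1 : HasDerivAt (fun θ : ℝ => G (t * Complex.exp (θ * Complex.I)))
        (fderiv ℝ G (t * Complex.exp (θ * Complex.I)) (t * (Complex.I * Complex.exp (θ * Complex.I)))) θ :=
      ((hG.differentiable (by simp)) _).hasFDerivAt.comp_hasDerivAt θ
        ((hasDerivAt_exp_mul_I θ).const_mul (t : ℂ))
    have h2 := (hasDerivAt_exp_neg_mul_I θ).fun_pow (k + 1)
    refine (h1.fun_mul h2).congr_deriv ?_
    rw [hAB]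
    have he : Complex.exp (θ * Complex.I) * Complex.exp (-(θ * Complex.I)) = 1 := by
      rw [← Complex.exp_add]; simp
    simp only [map_mul, Complex.conj_ofReal, Complex.conj_I, conj_exp_mul_I]
    rw [pow_succ (Complex.exp (-(θ * Complex.I))) k, Nat.add_sub_cancel]
    push_cast
    linear_combination (A (t * Complex.exp (θ * Complex.I)) * t * Complex.I * Complex.exp (-(θ * Complex.I)) ^ k) * he
  have hint := intervalIntegral.integral_eq_sub_of_hasDerivAt hd
    (Continuous.intervalIntegrable (by fun_prop) _ _)
  have hper : Complex.exp (-(((-Real.pi : ℝ) : ℂ) * Complex.I)) =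
      Complex.exp (-((Real.pi : ℂ) * Complex.I)) := by
    rw [Complex.exp_neg, exp_pi_mul_I_eq, ← Complex.exp_neg]
  rw [exp_pi_mul_I_eq, hper, sub_self, intervalIntegral.integral_const_mul,
    intervalIntegral.integral_sub (Continuous.intervalIntegrable (by fun_prop) _ _)
    (Continuous.intervalIntegrable (by fun_prop) _ _), intervalIntegral.integral_const_mul,
    intervalIntegral.integral_const_mul, intervalIntegral.integral_sub
      (Continuous.intervalIntegrable (by fun_prop) _ _)
    (Continuous.intervalIntegrable (by fun_prop) _ _)] at hint
  have := (mul_eq_zero.1 hint).resolve_left Complex.I_ne_zero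
  unfold circleCoeff
  linear_combination -this

/-- A Taylor monomial `z^a z̄^b` with `a + b < k` is orthogonal to `e^{ikθ}`. Instead of expanding
`G`, each use of `circleCoeff_succ` gains a factor `t`. It lowers the index by one in one term and
raises it by one in the other, so `j` uses are possible when `j ≤ k`. -/
theorem exists_norm_circleCoeff_le (j : ℕ) : ∀ (G : ℂ → ℂ), ContDiff ℝ ∞ G → ∀ k, j ≤ k →
    ∃ C : ℝ, ∀ t ∈ Icc (0 : ℝ) 1, ‖circleCoeff G k t‖ ≤ C * t ^ j := by
  induction j with
  | zero =>
    intro G hG k _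
    obtain ⟨C, hC⟩ := (isCompact_closedBall (0 : ℂ) 1).exists_bound_of_continuousOn
      hG.continuous.continuousOn
    refine ⟨C * |Real.pi - -Real.pi|, fun t ht => ?_⟩
    rw [pow_zero, mul_one]
    refine intervalIntegral.norm_integral_le_of_norm_le_const fun θ _ => ?_
    have h1 : ‖Complex.exp (-(θ * Complex.I))‖ = 1 := by
      rw [← conj_exp_mul_I, RCLike.norm_conj, Complex.norm_exp_ofReal_mul_I]
    rw [norm_mul, norm_pow, h1, one_pow, mul_one]
    refine hC _ ?_
    rw [mem_closedBall_zero_iff, norm_mul, Complex.norm_exp_ofReal_mul_I, mul_one,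
      Complex.norm_real, Real.norm_of_nonneg ht.1]
    exact ht.2
  | succ j ih =>
    intro G hG k hk
    obtain ⟨k, rfl⟩ : ∃ l, k = l + 1 := ⟨k - 1, by omega⟩
    obtain ⟨C₁, h₁⟩ := ih _ (contDiff_dzPart hG) k (by omega)
    obtain ⟨C₂, h₂⟩ := ih _ (contDiff_dzbarPart hG) (k + 2) (by omega)
    refine ⟨C₁ + C₂, fun t ht => ?_⟩
    have h := congrArg norm (circleCoeff_succ hG k t)
    rw [norm_mul, norm_mul, Complex.norm_real, Real.norm_of_nonneg ht.1] at h
    have hk1 : (1 : ℝ) ≤ ‖(k : ℂ) + 1‖ := by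
      have : ((k : ℂ) + 1) = ((k + 1 : ℕ) : ℂ) := by push_cast; rfl
      rw [this, Complex.norm_natCast]
      push_cast
      linarith [(Nat.cast_nonneg k : (0 : ℝ) ≤ k)]
    calc ‖circleCoeff G (k + 1) t‖ ≤ ‖(k : ℂ) + 1‖ * ‖circleCoeff G (k + 1) t‖ :=
          le_mul_of_one_le_left (norm_nonneg _) hk1
      _ ≤ t * (C₁ * t ^ j + C₂ * t ^ j) := by
          rw [h]
          exact mul_le_mul_of_nonneg_left ((norm_sub_le _ _).trans
            (add_le_add (h₁ t ht) (h₂ t ht))) ht.1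
      _ = (C₁ + C₂) * t ^ (j + 1) := by ring

/-! ### Stokes' theorem outside a disc, and the principal value at a pole -/

/-- The image under `exp` of a half-open rectangle of height `2π` is an annulus. -/
theorem image_exp_rect (a b : ℝ) :
    Complex.exp '' (Ioc a b ×ℂ Ioc (-Real.pi) Real.pi) =
      {z : ℂ | Real.exp a < ‖z‖ ∧ ‖z‖ ≤ Real.exp b} := by
  ext z
  constructor
  · rintro ⟨w, hw, rfl⟩
    rw [mem_ofPred_eq, Complex.norm_exp, Real.exp_lt_exp, Real.exp_le_exp]
    exact hw.1
  · rintro ⟨h1, h2⟩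
    have hz : 0 < ‖z‖ := (Real.exp_pos a).trans h1
    refine ⟨Complex.log z, ⟨⟨?_, ?_⟩, ?_⟩, Complex.exp_log (norm_pos_iff.1 hz)⟩
    · change a < (Complex.log z).re
      rw [Complex.log_re]
      exact (Real.lt_log_iff_exp_lt hz).2 h1
    · rw [Complex.log_re]
      exact (Real.log_le_iff_le_exp hz).2 h2
    · change (Complex.log z).im ∈ Ioc _ _
      rw [Complex.log_im]
      exact ⟨Complex.neg_pi_lt_arg z, Complex.arg_le_pi z⟩

theorem injOn_exp_rect (a b : ℝ) :
    InjOn Complex.exp (Ioc a b ×ℂ Ioc (-Real.pi) Real.pi) := by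
  intro x hx y hy h
  have h2 := congrArg Complex.log h
  rwa [Complex.log_exp hx.2.1 hx.2.2, Complex.log_exp hy.2.1 hy.2.2] at h2

/-- Injectivity of `exp` needs the half-open rectangle, Stokes' theorem the closed one. -/
theorem reProdIm_ae_eq (a b c d : ℝ) :
    (Ioc a b ×ℂ Ioc c d : Set ℂ) =ᵐ[volume] (Icc a b ×ℂ Icc c d : Set ℂ) := by
  have hpre : ∀ s t : Set ℝ, Complex.measurableEquivRealProd ⁻¹' (s ×ˢ t) = s ×ℂ t := by
    intro s t; ext p; simp [Complex.mem_reProdIm]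
  rw [← hpre, ← hpre]
  refine Complex.volume_preserving_equiv_real_prod.quasiMeasurePreserving.preimage_ae_eq ?_
  exact Measure.set_prod_ae_eq Ioc_ae_eq_Icc Ioc_ae_eq_Icc

/-- Change of variables along a holomorphic map. -/
theorem integral_image_holomorphic {φ φ' : ℂ → ℂ} {s : Set ℂ} (hs : MeasurableSet s)
    (hφ : ∀ z ∈ s, HasDerivWithinAt φ (φ' z) s z) (hi : InjOn φ s) (F : ℂ → ℂ) :
    ∫ z in φ '' s, F z = ∫ z in s, F (φ z) * φ' z * (starRingEnd ℂ) (φ' z) := by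
  rw [integral_image_eq_integral_abs_det_fderiv_smul volume hs
    (fun z hz => (hφ z hz).hasFDerivWithinAt.restrictScalars ℝ) hi F]
  refine setIntegral_congr_fun hs fun z _ => ?_
  change |(mulL (φ' z)).det| • F (φ z) = _
  rw [det_mulL, abs_of_nonneg (by positivity), Complex.real_smul, mul_assoc, Complex.mul_conj,
    Complex.normSq_eq_norm_sq]
  ring

/-- Stokes' theorem for `g dz̄` outside a disc, where `g` has bounded support. -/
theorem integral_dzPart_annulus {g : ℂ → ℂ} (hg : ContDiffOn ℝ ∞ g {0}ᶜ) {R : ℝ}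
    (hR : ∀ z, R ≤ ‖z‖ → g z = 0) {t : ℝ} (ht : 0 < t) :
    ∫ z in {z : ℂ | t < ‖z‖}, -2 * Complex.I * dzPart (fderiv ℝ g z) =
      Complex.I * ∫ θ in (-Real.pi)..Real.pi,
        g (t * Complex.exp (θ * Complex.I)) * (t * Complex.exp (-(θ * Complex.I))) := by
  wlog hRt : t < R generalizing R
  · exact this (R := t + 1) (fun z hz => hR z (by linarith)) (by linarith)
  have hR0 : 0 < R := ht.trans hRt
  set a := Real.log t with ha
  set b := Real.log R with hb
  have hea : Real.exp a = t := Real.exp_log ht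
  have heb : Real.exp b = R := Real.exp_log hR0
  have hab : a ≤ b := Real.log_le_log ht hRt.le
  have hpi : -Real.pi ≤ Real.pi := by linarith [Real.pi_pos]
  -- Polar coordinates in holomorphic form: `G dζ̄` is the pull-back of `g dz̄` under `z = exp ζ`,
  -- and the annulus between `t` and `R` becomes a rectangle.
  set G : ℂ → ℂ := fun ζ => g (Complex.exp ζ) * (starRingEnd ℂ) (Complex.exp ζ) with hGdef
  have hgd : ∀ z, z ≠ 0 → DifferentiableAt ℝ g z := fun z hz =>
    (hg.contDiffAt (isOpen_compl_singleton.mem_nhds hz)).differentiableAt (by simp)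
  have hG : ContDiff ℝ ∞ G := by
    have he : ContDiff ℝ ∞ Complex.exp := Complex.contDiff_exp
    refine ContDiff.mul ?_ ((Complex.conjCLE : ℂ →L[ℝ] ℂ).contDiff.comp he)
    rw [← contDiffOn_univ] at he ⊢
    exact hg.comp he fun z _ => Complex.exp_ne_zero z
  have hGd : ∀ ζ, dzPart (fderiv ℝ G ζ) =
      dzPart (fderiv ℝ g (Complex.exp ζ)) * Complex.exp ζ * (starRingEnd ℂ) (Complex.exp ζ) := by
    intro ζ
    obtain ⟨M, hM, hM'⟩ := exists_hasFDerivWithinAt_pullback (s := univ) (t := univ)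
      (hgd _ (Complex.exp_ne_zero ζ)).hasFDerivAt.hasFDerivWithinAt
      (Complex.hasDerivAt_exp ζ).hasDerivWithinAt (Complex.hasDerivAt_exp ζ).hasDerivWithinAt
      (mapsTo_univ _ _)
    rw [hasFDerivWithinAt_univ] at hM
    rw [hM.fderiv, hM']
  have hz0 : ∀ z : ℂ, R < ‖z‖ → dzPart (fderiv ℝ g z) = 0 := by
    intro z hz
    have : g =ᶠ[𝓝 z] fun _ => 0 := by
      filter_upwards [(isOpen_lt continuous_const continuous_norm).mem_nhds hz] with w hw
      exact hR w (le_of_lt hw)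
    rw [this.fderiv_eq]
    simp
  rw [setIntegral_eq_of_subset_of_forall_sdiff_eq_zero
    (s := {z : ℂ | Real.exp a < ‖z‖ ∧ ‖z‖ ≤ Real.exp b})
    (isOpen_lt continuous_const continuous_norm).measurableSet
    (fun z hz => by rw [hea] at hz; exact hz.1), ← image_exp_rect,
    integral_image_holomorphic (φ' := Complex.exp) _
      (fun z _ => (Complex.hasDerivAt_exp z).hasDerivWithinAt) (injOn_exp_rect a b)]
  · have hcont : Continuous fun ζ => -2 * Complex.I * dzPart (fderiv ℝ G ζ) :=
      continuous_const.mul (contDiff_dzPart hG).continuous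
    have h1 := integral_dzPart_rect (g := G) (g' := fderiv ℝ G) hab hpi hG.continuous.continuousOn
      (fun z _ => ((hG.differentiable (by simp)) z).hasFDerivAt)
      (hcont.continuousOn.integrableOn_compact (isCompact_Icc.reProdIm isCompact_Icc))
    rw [← setIntegral_congr_set (reProdIm_ae_eq a b (-Real.pi) Real.pi)] at h1
    simp only [hGd] at h1
    -- The two horizontal sides cancel by periodicity, the right-hand side lies over `‖z‖ = R` where
    -- `g` vanishes, and the left-hand side is the circle of radius `t`.
    have h2 : ∀ x : ℝ, G (x + ((-Real.pi : ℝ) : ℂ) * Complex.I) =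
        G (x + (Real.pi : ℂ) * Complex.I) := by
      intro x
      simp only [hGdef, Complex.exp_add, exp_pi_mul_I_eq]
    have h3 : ∀ y : ℝ, G (b + y * Complex.I) = 0 := by
      intro y
      simp only [hGdef]
      rw [hR, zero_mul]
      rw [Complex.norm_exp]
      simp [heb]
    have h4 : ∀ y : ℝ, G (a + y * Complex.I) =
        g (t * Complex.exp (y * Complex.I)) * (t * Complex.exp (-(y * Complex.I))) := by
      intro y
      simp only [hGdef]
      rw [Complex.exp_add, ← Complex.ofReal_exp, hea, map_mul, Complex.conj_ofReal, conj_exp_mul_I]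
    simp only [h2, h3, h4, sub_self, intervalIntegral.integral_zero, mul_zero, zero_add] at h1
    rw [← h1]
    refine integral_congr_ae (Eventually.of_forall fun z => ?_)
    ring
  · exact (Complex.measurable_re measurableSet_Ioc).inter (Complex.measurable_im measurableSet_Ioc)
  · intro z hz
    rw [hz0 z, mul_zero]
    by_contra! hle
    refine hz.2 ⟨by rw [hea]; exact hz.1, by rwa [heb]⟩

/-- The principal value of `∂ (G dz̄ / z^m)` is zero. -/
theorem tendsto_integral_dzPart_pole {G : ℂ → ℂ} (hG : ContDiff ℝ ∞ G) {R : ℝ}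
    (hR : ∀ z, R ≤ ‖z‖ → G z = 0) (m : ℕ) :
    Tendsto (fun t : ℝ => ∫ z in {z : ℂ | t < ‖z‖},
      -2 * Complex.I * dzPart (fderiv ℝ (fun w => G w / w ^ m) z)) (𝓝[>] 0) (𝓝 0) := by
  have hq : ContDiffOn ℝ ∞ (fun w => G w / w ^ m) {0}ᶜ := by
    simp only [div_eq_mul_inv]
    exact hG.contDiffOn.mul ((contDiff_id.pow m).contDiffOn.inv fun z hz => pow_ne_zero _ hz)
  -- The index is `m + 1`: the pole supplies `e^{-imθ}` and `dz̄` one more `e^{-iθ}`. The prefactor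
  -- `t / t^m` against the bound `C t^(m+1)` leaves `C t^2`.
  obtain ⟨C, hC⟩ := exists_norm_circleCoeff_le (m + 1) G hG (m + 1) le_rfl
  have hlim : Tendsto (fun t : ℝ => C * t ^ 2) (𝓝[>] 0) (𝓝 0) := by
    have : Tendsto (fun t : ℝ => C * t ^ 2) (𝓝 0) (𝓝 (C * 0 ^ 2)) :=
      Continuous.tendsto (by fun_prop) 0
    simpa using this.mono_left nhdsWithin_le_nhds
  refine squeeze_zero_norm' ?_ hlim
  filter_upwards [Ioc_mem_nhdsGT (show (0 : ℝ) < 1 by norm_num)] with t ht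
  rw [integral_dzPart_annulus hq (R := R) (fun z hz => by rw [hR z hz, zero_div]) ht.1]
  have ht0 : (t : ℂ) ≠ 0 := Complex.ofReal_ne_zero.2 ht.1.ne'
  have heq : ∀ θ : ℝ, G (t * Complex.exp (θ * Complex.I)) / (t * Complex.exp (θ * Complex.I)) ^ m *
      (t * Complex.exp (-(θ * Complex.I))) = (t / t ^ m) *
        (G (t * Complex.exp (θ * Complex.I)) * Complex.exp (-(θ * Complex.I)) ^ (m + 1)) := by
    intro θ
    have := Complex.exp_ne_zero (θ * Complex.I)
    rw [Complex.exp_neg, mul_pow, inv_pow, pow_succ (Complex.exp (θ * Complex.I)) m]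
    field_simp
  simp only [heq]
  rw [intervalIntegral.integral_const_mul, norm_mul, norm_mul, Complex.norm_I, one_mul, norm_div,
    norm_pow, Complex.norm_real, Real.norm_of_nonneg ht.1.le]
  have h1 := hC t ⟨ht.1.le, ht.2⟩
  have htp := ht.1
  calc t / t ^ m * ‖circleCoeff G (m + 1) t‖ ≤ t / t ^ m * (C * t ^ (m + 1)) := by gcongr
    _ = C * t ^ 2 := by field_simp; ring

/-! ### Calculus of poles in one variable -/

/-- Near `c`, the function `f` is of the form `h / (z - c)^n` with `h` smooth. -/
def PoleAt (f : ℂ → ℂ) (c : ℂ) (n : ℕ) : Prop :=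
  ∃ U ∈ 𝓝 c, ∃ h : ℂ → ℂ, ContDiffOn ℝ ∞ h U ∧ ∀ z ∈ U, z ≠ c → f z = h z / (z - c) ^ n

/-- A bump function extends the germ of `h`. Through `poleAt_iff` this lets numerators of poles be
smooth on all of `ℂ`. -/
theorem exists_contDiff_eventuallyEq {h : ℂ → ℂ} {U : Set ℂ} {c : ℂ} (hU : U ∈ 𝓝 c)
    (hh : ContDiffOn ℝ ∞ h U) : ∃ k : ℂ → ℂ, ContDiff ℝ ∞ k ∧ k =ᶠ[𝓝 c] h := by
  obtain ⟨r, hr, hrU⟩ := Metric.mem_nhds_iff.1 hU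
  let χ : ContDiffBump c := ⟨r / 4, r / 2, by linarith, by linarith⟩
  refine ⟨fun z => (χ z : ℂ) * h z, contDiff_iff_contDiffAt.2 fun z => ?_, ?_⟩
  · by_cases hz : z ∈ Metric.ball c r
    · refine ContDiffAt.mul (Complex.ofRealCLM.contDiff.contDiffAt.comp z χ.contDiffAt) ?_
      exact hh.contDiffAt (mem_of_superset (Metric.isOpen_ball.mem_nhds hz) hrU)
    · have hz' : z ∉ tsupport χ := by
        rw [χ.tsupport_eq]
        intro hz2
        exact hz (Metric.closedBall_subset_ball (show r / 2 < r by linarith) hz2)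
      have : (fun z => (χ z : ℂ) * h z) =ᶠ[𝓝 z] fun _ => 0 := by
        filter_upwards [notMem_tsupport_iff_eventuallyEq.1 hz'] with w hw
        rw [hw]
        simp
      exact contDiffAt_const.congr_of_eventuallyEq this
  · filter_upwards [χ.eventuallyEq_one] with z hz
    rw [hz]
    simp

theorem poleAt_iff {f : ℂ → ℂ} {c : ℂ} {n : ℕ} : PoleAt f c n ↔
    ∃ h : ℂ → ℂ, ContDiff ℝ ∞ h ∧ ∀ᶠ z in 𝓝[≠] c, f z = h z / (z - c) ^ n := by
  constructor
  · rintro ⟨U, hU, h, hh, hf⟩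
    obtain ⟨k, hk, hkh⟩ := exists_contDiff_eventuallyEq hU hh
    refine ⟨k, hk, ?_⟩
    filter_upwards [mem_nhdsWithin_of_mem_nhds hU, mem_nhdsWithin_of_mem_nhds hkh,
      self_mem_nhdsWithin] with z h1 h2 h3
    rw [hf z h1 h3]
    congr 1
    exact h2.symm
  · rintro ⟨h, hh, hf⟩
    rw [eventually_nhdsWithin_iff] at hf
    exact ⟨_, hf, h, hh.contDiffOn, fun z hz hzc => hz hzc⟩

theorem PoleAt.congr {f g : ℂ → ℂ} {c : ℂ} {n : ℕ} (hf : PoleAt f c n)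
    (h : ∀ᶠ z in 𝓝[≠] c, g z = f z) : PoleAt g c n := by
  rw [poleAt_iff] at *
  obtain ⟨k, hk, hf⟩ := hf
  refine ⟨k, hk, ?_⟩
  filter_upwards [h, hf] with z h1 h2
  rw [h1, h2]

theorem PoleAt.mono {f : ℂ → ℂ} {c : ℂ} {n m : ℕ} (hf : PoleAt f c n) (hnm : n ≤ m) :
    PoleAt f c m := by
  rw [poleAt_iff] at *
  obtain ⟨h, hh, hf⟩ := hf
  refine ⟨fun z => h z * (z - c) ^ (m - n), by fun_prop, ?_⟩
  filter_upwards [hf, self_mem_nhdsWithin] with z hz hzc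
  have hzc' : z - c ≠ 0 := sub_ne_zero.2 hzc
  rw [hz, div_eq_div_iff (pow_ne_zero _ hzc') (pow_ne_zero _ hzc'), mul_assoc, ← pow_add,
    Nat.sub_add_cancel hnm]

theorem PoleAt.zero (c : ℂ) (n : ℕ) : PoleAt (fun _ => 0) c n :=
  poleAt_iff.2 ⟨fun _ => 0, contDiff_const, by simp⟩

theorem PoleAt.add {f g : ℂ → ℂ} {c : ℂ} {n : ℕ} (hf : PoleAt f c n) (hg : PoleAt g c n) :
    PoleAt (fun z => f z + g z) c n := by
  rw [poleAt_iff] at *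
  obtain ⟨h, hh, hf⟩ := hf
  obtain ⟨k, hk, hg⟩ := hg
  refine ⟨fun z => h z + k z, hh.add hk, ?_⟩
  filter_upwards [hf, hg] with z h1 h2
  rw [h1, h2, add_div]

theorem PoleAt.smooth_mul {f g : ℂ → ℂ} {c : ℂ} {n : ℕ} {U : Set ℂ} (hU : U ∈ 𝓝 c)
    (hg : ContDiffOn ℝ ∞ g U) (hf : PoleAt f c n) : PoleAt (fun z => g z * f z) c n := by
  rw [poleAt_iff] at *
  obtain ⟨h, hh, hf⟩ := hf
  obtain ⟨k, hk, hkg⟩ := exists_contDiff_eventuallyEq hU hg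
  refine ⟨fun z => k z * h z, hk.mul hh, ?_⟩
  filter_upwards [hf, mem_nhdsWithin_of_mem_nhds hkg] with z h1 h2
  change k z = g z at h2
  rw [h1, ← h2, mul_div_assoc]

theorem PoleAt.neg {f : ℂ → ℂ} {c : ℂ} {n : ℕ} (hf : PoleAt f c n) :
    PoleAt (fun z => -f z) c n := by
  refine (hf.smooth_mul univ_mem (contDiffOn_const (c := (-1 : ℂ)))).congr ?_
  simp

theorem PoleAt.sub {f g : ℂ → ℂ} {c : ℂ} {n : ℕ} (hf : PoleAt f c n) (hg : PoleAt g c n) :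
    PoleAt (fun z => f z - g z) c n := by
  simpa only [sub_eq_add_neg] using hf.add hg.neg

/-- The denominator is holomorphic, so the ordinary quotient rule applies to `∂`. The pole order
rises by at most one and the numerator becomes `-n h(c)` at `c`; this is what makes the reduction of
poles possible. -/
theorem dzPart_fderiv_div_pow {h : ℂ → ℂ} {z c : ℂ} (hh : DifferentiableAt ℝ h z) (hz : z ≠ c)
    (n : ℕ) : dzPart (fderiv ℝ (fun w => h w / (w - c) ^ n) z) =
      (dzPart (fderiv ℝ h z) * (z - c) - n * h z) / (z - c) ^ (n + 1) := by
  have hz' : z - c ≠ 0 := sub_ne_zero.2 hz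
  have h1 : HasDerivAt (fun w => ((w - c) ^ n)⁻¹) (-(n / (z - c) ^ (n + 1))) z := by
    refine ((((hasDerivAt_id z).sub_const c).fun_pow n).fun_inv (pow_ne_zero n hz')).congr_deriv ?_
    rcases n with _ | n
    · simp
    · simp only [id, Nat.add_sub_cancel, mul_one]
      field_simp
      ring
  have h2 : HasFDerivAt (fun w => ((w - c) ^ n)⁻¹) (mulL (-(n / (z - c) ^ (n + 1)))) z :=
    h1.hasFDerivAt.restrictScalars ℝ
  have h3 := (hh.hasFDerivAt.fun_mul h2).fderiv
  simp only [div_eq_mul_inv] at *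
  rw [h3, dzPart_add, dzPart_smul, dzPart_smul, dzPart_mulL]
  field_simp
  ring

theorem eventually_dzPart_div_pow {f h : ℂ → ℂ} {c : ℂ} {n : ℕ} (hh : ContDiff ℝ ∞ h)
    (hf : ∀ᶠ z in 𝓝[≠] c, f z = h z / (z - c) ^ n) :
    ∀ᶠ z in 𝓝[≠] c, dzPart (fderiv ℝ f z) =
      (dzPart (fderiv ℝ h z) * (z - c) - n * h z) / (z - c) ^ (n + 1) := by
  rw [← eventually_eventually_nhdsWithin] at hf
  filter_upwards [hf, self_mem_nhdsWithin] with z hz hzc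
  have hz2 : f =ᶠ[𝓝 z] fun w => h w / (w - c) ^ n := by
    rwa [(isOpen_compl_singleton (x := c)).nhdsWithin_eq hzc] at hz
  rw [hz2.fderiv_eq, dzPart_fderiv_div_pow (hh.differentiable (by simp) z) hzc]

theorem PoleAt.dzPart_fderiv {f : ℂ → ℂ} {c : ℂ} {n : ℕ} (hf : PoleAt f c n) :
    PoleAt (fun z => dzPart (fderiv ℝ f z)) c (n + 1) := by
  obtain ⟨h, hh, hf⟩ := poleAt_iff.1 hf
  have := contDiff_dzPart hh
  exact poleAt_iff.2 ⟨fun z => dzPart (fderiv ℝ h z) * (z - c) - n * h z, by fun_prop,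
    eventually_dzPart_div_pow hh hf⟩

/-- Modulo `∂`, every pole can be reduced to a pole of order one. -/
theorem exists_sub_dzPart_poleAt_one (n : ℕ) : ∀ {f : ℂ → ℂ} {c : ℂ}, PoleAt f c n →
    ∃ (h : ℂ → ℂ) (m : ℕ), ContDiff ℝ ∞ h ∧
      PoleAt (fun z => f z - dzPart (fderiv ℝ (fun w => h w / (w - c) ^ m) z)) c 1 := by
  induction n with
  | zero =>
    intro f c hf
    exact ⟨fun _ => 0, 0, contDiff_const, by simpa using hf.mono zero_le_one⟩
  | succ n ih =>
    intro f c hf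
    rcases n with _ | n
    · exact ⟨fun _ => 0, 0, contDiff_const, by simpa using hf⟩
    obtain ⟨h, hh, hfh⟩ := poleAt_iff.1 hf
    -- The pole has order `n + 2`, and `k` is chosen so that `∂(k / (z - c)^(n+1))` has the leading
    -- term `h / (z - c)^(n+2)`. The remainder is `-∂k / (z - c)^(n+1)`. For a pole of order one the
    -- same recipe would divide by zero, hence the separate case above.
    set k : ℂ → ℂ := fun z => -h z / (n + 1) with hk
    have hk1 : ContDiff ℝ ∞ k := by fun_prop
    have hn : (n : ℂ) + 1 ≠ 0 := Nat.cast_add_one_ne_zero n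
    have hreduced : PoleAt (fun z => f z - dzPart (fderiv ℝ (fun w => k w / (w - c) ^ (n + 1)) z)) c
        (n + 1) := by
      have h1 := contDiff_dzPart hk1
      refine poleAt_iff.2 ⟨fun z => -dzPart (fderiv ℝ k z), by fun_prop, ?_⟩
      filter_upwards [hfh, self_mem_nhdsWithin] with z hz hzc
      have hz' : z - c ≠ 0 := sub_ne_zero.2 hzc
      rw [hz, dzPart_fderiv_div_pow (hk1.differentiable (by simp) z) hzc, hk]
      push_cast
      field_simp
      ring
    obtain ⟨h', m, hh', hm⟩ := ih hreduced
    -- The new primitive and the one from the induction are put over a common denominator.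
    refine ⟨fun z => k z * (z - c) ^ m + h' z * (z - c) ^ (n + 1), n + 1 + m, by fun_prop, ?_⟩
    refine hm.congr ?_
    filter_upwards [self_mem_nhdsWithin] with z hzc
    have e1 : (fun w => (k w * (w - c) ^ m + h' w * (w - c) ^ (n + 1)) / (w - c) ^ (n + 1 + m))
        =ᶠ[𝓝 z] fun w => k w / (w - c) ^ (n + 1) + h' w / (w - c) ^ m := by
      filter_upwards [(isOpen_compl_singleton (x := c)).mem_nhds hzc] with w hw
      have hw' : w - c ≠ 0 := sub_ne_zero.2 hw
      rw [pow_add]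
      field_simp
      ring
    have hd : ∀ (j : ℕ) {k : ℂ → ℂ}, ContDiff ℝ ∞ k →
        DifferentiableAt ℝ (fun w => k w / (w - c) ^ j) z := by
      intro j k hk
      have : DifferentiableAt ℝ k z := hk.differentiable (by simp) z
      simp only [div_eq_mul_inv]
      exact this.fun_mul (DifferentiableAt.fun_inv (by fun_prop)
        (pow_ne_zero _ (sub_ne_zero.2 hzc)))
    rw [e1.fderiv_eq, fderiv_fun_add (hd _ hk1) (hd _ hh'), dzPart_add]
    ring

/-- Poles are preserved by the pull-back along a biholomorphic map. -/
theorem PoleAt.pullback {f ψ : ℂ → ℂ} {c : ℂ} {n : ℕ} (a b : ℕ) (hf : PoleAt f (ψ c) n)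
    {U : Set ℂ} (hU : U ∈ 𝓝 c) (hψ : DifferentiableOn ℂ ψ U) (hc : deriv ψ c ≠ 0) :
    PoleAt (fun z => f (ψ z) * deriv ψ z ^ a * (starRingEnd ℂ) (deriv ψ z) ^ b) c n := by
  obtain ⟨h, hh, hf⟩ := poleAt_iff.1 hf
  rw [eventually_nhdsWithin_iff] at hf
  obtain ⟨V, hVU, hVo, hcV⟩ := mem_nhds_iff.1 hU
  replace hψ := hψ.mono hVU
  have hVc : V ∈ 𝓝 c := hVo.mem_nhds hcV
  -- The difference quotient satisfies `ψ z - ψ c = (z - c) q z`, with `q` holomorphic and nonzero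
  -- near `c`. Hence `(ψ z - ψ c)^n` is `(z - c)^n` times a nonvanishing smooth factor.
  set q := dslope ψ c with hq
  have hqd : DifferentiableOn ℂ q V := (Complex.differentiableOn_dslope hVc).2 hψ
  have hq0 : q c ≠ 0 := by rwa [hq, dslope_same]
  have hqn : ∀ᶠ z in 𝓝 c, q z ≠ 0 :=
    ((hqd.differentiableAt hVc).continuousAt).eventually_ne hq0
  have hψc : ContinuousAt ψ c := (hψ.differentiableAt hVc).continuousAt
  set W : Set ℂ := {z | z ∈ V ∧ q z ≠ 0 ∧ (ψ z ∈ ({ψ c}ᶜ : Set ℂ) →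
    f (ψ z) = h (ψ z) / (ψ z - ψ c) ^ n)} with hW
  have hWc : W ∈ 𝓝 c := by
    filter_upwards [hVc, hqn, hψc.eventually hf] with z h1 h2 h3 using ⟨h1, h2, h3⟩
  have hWV : W ⊆ V := fun z hz => hz.1
  have s1 : ContDiffOn ℝ ∞ ψ V := (hψ.contDiffOn hVo (n := ∞)).restrict_scalars ℝ
  have s2 : ContDiffOn ℝ ∞ (deriv ψ) V :=
    ((hψ.deriv hVo).contDiffOn hVo (n := ∞)).restrict_scalars ℝ
  have s3 : ContDiffOn ℝ ∞ q V := (hqd.contDiffOn hVo (n := ∞)).restrict_scalars ℝ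
  have s4 : ContDiffOn ℝ ∞ (fun z => (starRingEnd ℂ) (deriv ψ z)) V :=
    (Complex.conjCLE : ℂ →L[ℝ] ℂ).contDiff.comp_contDiffOn s2
  refine ⟨W, hWc, fun z => h (ψ z) * ((q z) ^ n)⁻¹ * deriv ψ z ^ a *
    (starRingEnd ℂ) (deriv ψ z) ^ b, ?_, ?_⟩
  · refine ((ContDiffOn.mul ?_ ?_).mul ((s2.mono hWV).pow a)).mul ((s4.mono hWV).pow b)
    · exact hh.comp_contDiffOn (s1.mono hWV)
    · exact ((s3.mono hWV).pow n).inv fun z hz => pow_ne_zero _ hz.2.1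
  · intro z hz hzc
    have hzc' : z - c ≠ 0 := sub_ne_zero.2 hzc
    have hd : (z - c) * q z = ψ z - ψ c := by
      have := sub_smul_dslope ψ c z
      simpa using this
    have hne : ψ z ≠ ψ c := by
      rw [← sub_ne_zero, ← hd]
      exact mul_ne_zero hzc' hz.2.1
    beta_reduce
    rw [hz.2.2 hne, ← hd]
    have := hz.2.1
    rw [mul_pow]
    field_simp

/-- In real dimension two `‖z‖⁻¹` is locally integrable, and the smooth numerator is locally
bounded. -/
theorem PoleAt.integrableAtFilter {f : ℂ → ℂ} {c : ℂ} (hf : PoleAt f c 1) :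
    IntegrableAtFilter f (𝓝 c) := by
  obtain ⟨h, hh, hf⟩ := poleAt_iff.1 hf
  have h1 : LocallyIntegrable (fun z : ℂ => z⁻¹) := by
    refine locallyIntegrable_of_norm_le_rpow (C := 1) (α := 1) (by simp) (by simp) ?_
      (measurable_inv.aestronglyMeasurable)
    refine Eventually.of_forall fun z => ?_
    rw [norm_inv, Real.rpow_neg_one, one_mul]
  have h2 : IntegrableOn (fun z : ℂ => (z - c)⁻¹) (Metric.closedBall c 1) := by
    have := (measurePreserving_sub_right (volume : Measure ℂ) c).integrableOn_comp_preimage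
      (MeasurableEquiv.subRight c).measurableEmbedding (f := fun z : ℂ => z⁻¹)
      (s := Metric.closedBall 0 1)
    have hs : (fun x => x - c) ⁻¹' Metric.closedBall (0 : ℂ) 1 = Metric.closedBall c 1 := by
      ext z; simp [dist_eq_norm]
    rw [hs] at this
    exact this.2 (h1.integrableOn_isCompact (isCompact_closedBall 0 1))
  have h3 : IntegrableOn (fun z : ℂ => h z * (z - c)⁻¹) (Metric.closedBall c 1) :=
    h2.continuousOn_mul hh.continuous.continuousOn (isCompact_closedBall c 1)
  rw [eventually_nhdsWithin_iff] at hf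
  obtain ⟨r, hr, hrf⟩ := Metric.eventually_nhds_iff_ball.1 hf
  refine ⟨Metric.ball c (min r 1), Metric.ball_mem_nhds c (by positivity), ?_⟩
  have h4 : IntegrableOn (fun z : ℂ => h z * (z - c)⁻¹) (Metric.ball c (min r 1)) :=
    h3.mono_set ((Metric.ball_subset_ball (min_le_right _ _)).trans Metric.ball_subset_closedBall)
  refine h4.congr_fun_ae ?_
  have hae : ∀ᵐ z : ℂ, z ≠ c := by simp [ae_iff, measure_singleton]
  filter_upwards [ae_restrict_mem Metric.isOpen_ball.measurableSet, ae_restrict_of_ae hae] with z hz hzc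
  rw [hrf z (Metric.ball_subset_ball (min_le_left _ _) hz) hzc, pow_one, div_eq_mul_inv]

/-! ### Subsets of the surface seen in charts -/

variable {X : Type*} [TopologicalSpace X] [ChartedSpace ClosedHalfPlane X]
variable {D : Set X}

/-- The part of the coordinate domain of `e` which corresponds to points of `A`. -/
abbrev chartSet (e : atlas ClosedHalfPlane X) (A : Set X) : Set ℂ :=
  {z ∈ (coord e).target | (coord e).symm z ∈ A}

theorem coord_target_subset (e : atlas ClosedHalfPlane X) :
    (coord e).target ⊆ range halfPlaneModel :=
  OpenPartialHomeomorph.extend_target_subset_range _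

theorem coord_source (e : atlas ClosedHalfPlane X) : (coord e).source = e.1.source :=
  OpenPartialHomeomorph.extend_source _

theorem isOpen_coord_source (e : atlas ClosedHalfPlane X) : IsOpen (coord e).source := by
  rw [coord_source]; exact e.1.open_source

theorem mem_chartSet {e : atlas ClosedHalfPlane X} {A : Set X} {z : ℂ} :
    z ∈ chartSet e A ↔ z ∈ (coord e).target ∧ (coord e).symm z ∈ A := Iff.rfl

theorem chartSet_univ (e : atlas ClosedHalfPlane X) : chartSet e univ = (coord e).target := by
  ext z
  simp only [mem_chartSet, mem_univ, and_true]

theorem coord_mem_chartSet {e : atlas ClosedHalfPlane X} {A : Set X} {x : X}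
    (hx : x ∈ (coord e).source) : coord e x ∈ chartSet e A ↔ x ∈ A := by
  rw [mem_chartSet, (coord e).left_inv hx]
  exact and_iff_right ((coord e).map_source hx)

theorem chartSet_eq_image (e : atlas ClosedHalfPlane X) {A : Set X} (hA : A ⊆ (coord e).source) :
    chartSet e A = coord e '' A := by
  ext z
  constructor
  · rintro ⟨hz, hzA⟩
    exact ⟨_, hzA, (coord e).right_inv hz⟩
  · rintro ⟨x, hx, rfl⟩
    exact (coord_mem_chartSet (hA hx)).2 hx

theorem exists_isOpen_chartSet (e : atlas ClosedHalfPlane X) {O : Set X} (hO : IsOpen O) :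
    ∃ V : Set ℂ, IsOpen V ∧ chartSet e O = V ∩ range halfPlaneModel := by
  refine ⟨halfPlaneModel.symm ⁻¹' (e.1.target ∩ e.1.symm ⁻¹' O),
    (e.1.isOpen_inter_preimage_symm hO).preimage halfPlaneModel.continuous_symm, ?_⟩
  ext z
  rw [mem_chartSet, OpenPartialHomeomorph.extend_target]
  exact ⟨fun h => ⟨⟨h.1.1, h.2⟩, h.1.2⟩, fun h => ⟨⟨h.1.1, h.2⟩, h.1.2⟩⟩

theorem chartSet_mem_nhdsWithin {e : atlas ClosedHalfPlane X} {O : Set X} (hO : IsOpen O) {z : ℂ}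
    (hz : z ∈ chartSet e O) : chartSet e O ∈ 𝓝[range halfPlaneModel] z := by
  obtain ⟨V, hV, h⟩ := exists_isOpen_chartSet e hO
  rw [h] at hz ⊢
  rw [inter_comm]
  exact inter_mem_nhdsWithin _ (hV.mem_nhds hz.1)

theorem coord_target_mem_nhdsWithin {e : atlas ClosedHalfPlane X} {z : ℂ}
    (hz : z ∈ (coord e).target) : (coord e).target ∈ 𝓝[range halfPlaneModel] z := by
  rw [← chartSet_univ] at *
  exact chartSet_mem_nhdsWithin isOpen_univ hz

theorem uniqueDiffOn_chartSet {𝕜 : Type*} [NontriviallyNormedField 𝕜] [NormedSpace 𝕜 ℂ]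
    (e : atlas ClosedHalfPlane X) {O : Set X} (hO : IsOpen O)
    (h : UniqueDiffOn 𝕜 (range halfPlaneModel)) : UniqueDiffOn 𝕜 (chartSet e O) := by
  obtain ⟨V, hV, h'⟩ := exists_isOpen_chartSet e hO
  rw [h', inter_comm]
  exact h.inter hV

theorem measurableSet_range_halfPlaneModel : MeasurableSet (range halfPlaneModel) := by
  rw [range_halfPlaneModel]
  exact (isClosed_le continuous_const Complex.continuous_im).measurableSet

/-- Measurability of a subset of `X` in all charts. -/
def ChartMeasurable (A : Set X) : Prop :=
  ∀ e : atlas ClosedHalfPlane X, MeasurableSet (chartSet e A)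

theorem _root_.IsOpen.chartMeasurable {O : Set X} (hO : IsOpen O) : ChartMeasurable O := by
  intro e
  obtain ⟨V, hV, h⟩ := exists_isOpen_chartSet e hO
  rw [h]
  exact hV.measurableSet.inter measurableSet_range_halfPlaneModel

theorem measurableSet_coord_target (e : atlas ClosedHalfPlane X) :
    MeasurableSet (coord e).target := by
  rw [← chartSet_univ]
  exact isOpen_univ.chartMeasurable e

theorem ChartMeasurable.compl {A : Set X} (hA : ChartMeasurable A) : ChartMeasurable Aᶜ := by
  intro e
  have : chartSet e Aᶜ = (coord e).target \ chartSet e A := by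
    ext z
    rw [Set.mem_sdiff, mem_chartSet, mem_chartSet, mem_compl_iff]
    tauto
  rw [this]
  exact (measurableSet_coord_target e).diff (hA e)

theorem ChartMeasurable.inter {A B : Set X} (hA : ChartMeasurable A) (hB : ChartMeasurable B) :
    ChartMeasurable (A ∩ B) := by
  intro e
  have : chartSet e (A ∩ B) = chartSet e A ∩ chartSet e B := by
    ext z
    rw [mem_inter_iff, mem_chartSet, mem_chartSet, mem_chartSet, mem_inter_iff]
    tauto
  rw [this]
  exact (hA e).inter (hB e)

theorem ChartMeasurable.iUnion {ι : Type*} [Countable ι] {A : ι → Set X}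
    (hA : ∀ i, ChartMeasurable (A i)) : ChartMeasurable (⋃ i, A i) := by
  intro e
  have : chartSet e (⋃ i, A i) = ⋃ i, chartSet e (A i) := by
    ext z
    simp only [mem_chartSet, mem_iUnion]
    exact exists_and_left.symm
  rw [this]
  exact MeasurableSet.iUnion fun i => hA i e

theorem isCompact_chartSet [CompactSpace X] (e : atlas ClosedHalfPlane X) {K : Set X}
    (hK : IsClosed K) (hKe : K ⊆ (coord e).source) : IsCompact (chartSet e K) := by
  rw [chartSet_eq_image e hKe]
  exact hK.isCompact.image_of_continuousOn
    ((OpenPartialHomeomorph.continuousOn_extend _).mono hKe)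

/-- If `x` belongs to an open set `O`, so do the points of `X` with coordinate near that of `x`. -/
theorem eventually_chartSet {e : atlas ClosedHalfPlane X} {O : Set X} (hO : IsOpen O) {x : X}
    (hx : x ∈ (coord e).source) (hxO : x ∈ O) :
    ∀ᶠ z in 𝓝[range halfPlaneModel] (coord e x), z ∈ chartSet e O :=
  chartSet_mem_nhdsWithin hO ((coord_mem_chartSet hx).2 hxO)

/-- Chart targets are relatively open in the half-plane, so they contain a full neighbourhood of
each of their points off the real axis. -/
theorem mem_interior_target_iff {e : atlas ClosedHalfPlane X} {z : ℂ} (hz : z ∈ (coord e).target) :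
    z ∈ interior (coord e).target ↔ 0 < z.im := by
  constructor
  · intro h
    have h2 := interior_mono (coord_target_subset e) h
    rw [range_halfPlaneModel] at h2
    have h3 := Complex.interior_setOfPred_le_im 0 ▸ h2
    exact h3
  · intro h
    rw [mem_interior_iff_mem_nhds]
    have := coord_target_mem_nhdsWithin hz
    rwa [nhdsWithin_eq_nhds.2 (range_halfPlaneModel_mem_nhds h)] at this

/-! ### Coordinate changes and their derivatives -/

section Manifold

variable [IsManifold halfPlaneModel ∞ X]

theorem mem_maximalAtlas (e : atlas ClosedHalfPlane X) :
    e.1 ∈ IsManifold.maximalAtlas halfPlaneModel ∞ X := IsManifold.subset_maximalAtlas e.2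

/-- Being an interior point does not depend on the chart. Consequently coordinate changes preserve
the real axis. -/
theorem im_coord_pos_iff {e e' : atlas ClosedHalfPlane X} {x : X} (hx : x ∈ (coord e).source)
    (hx' : x ∈ (coord e').source) : 0 < (coord e x).im ↔ 0 < (coord e' x).im := by
  rw [← mem_interior_target_iff ((coord e).map_source hx),
    ← mem_interior_target_iff ((coord e').map_source hx')]
  rw [coord_source] at hx hx'
  exact ModelWithCorners.mem_interior_range_iff_of_mem_atlas (n := ∞) (by simp) e.2 e'.2 hx hx'

theorem im_coord_pos_of_notMem_boundary {e : atlas ClosedHalfPlane X} {x : X}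
    (hx : x ∈ (coord e).source) (hb : x ∉ halfPlaneModel.boundary X) : 0 < (coord e x).im := by
  rw [← mem_interior_target_iff ((coord e).map_source hx)]
  rw [coord_source] at hx
  rw [← ModelWithCorners.isInteriorPoint_iff_of_mem_atlas (n := ∞) (by simp) e.2 hx]
  by_contra h
  exact hb ((ModelWithCorners.isBoundaryPoint_iff_not_isInteriorPoint x).2 h)

/-- The coordinate change from `e` to `e'`. -/
noncomputable abbrev trans (e e' : atlas ClosedHalfPlane X) : ℂ → ℂ :=
  coord e' ∘ (coord e).symm

theorem contDiffOn_trans (e e' : atlas ClosedHalfPlane X) :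
    ContDiffOn ℂ ∞ (trans e e') (chartSet e (coord e').source) :=
  ModelWithCorners.contDiffOn_extendCoordChange (mem_maximalAtlas e) (mem_maximalAtlas e')

theorem hasDerivWithinAt_trans {e e' : atlas ClosedHalfPlane X} {z : ℂ}
    (hz : z ∈ chartSet e (coord e').source) :
    HasDerivWithinAt (trans e e') (transDeriv e e' ((coord e).symm z)) (range halfPlaneModel) z := by
  have h1 := chartSet_mem_nhdsWithin (isOpen_coord_source e') hz
  have h2 : DifferentiableWithinAt ℂ (trans e e') (range halfPlaneModel) z :=
    ((contDiffOn_trans e e' z hz).differentiableWithinAt (by simp)).mono_of_mem_nhdsWithin h1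
  have := h2.hasDerivWithinAt
  rwa [transDeriv, (coord e).right_inv hz.1]

theorem uniqueDiffOn_complex_range : UniqueDiffOn ℂ (range halfPlaneModel) :=
  halfPlaneModel.uniqueDiffOn

theorem contDiffOn_transDeriv (e e' : atlas ClosedHalfPlane X) :
    ContDiffOn ℂ ∞ (fun z => transDeriv e e' ((coord e).symm z))
      (chartSet e (coord e').source) := by
  have hu := uniqueDiffOn_chartSet e (isOpen_coord_source e') uniqueDiffOn_complex_range
  refine ((contDiffOn_trans e e').derivWithin (m := ∞) hu (by simp)).congr fun z hz => ?_
  have h1 := chartSet_mem_nhdsWithin (isOpen_coord_source e') hz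
  rw [((hasDerivWithinAt_trans hz).mono_of_mem_nhdsWithin
    (nhdsWithin_mono z ((fun w hw => coord_target_subset e hw.1) :
      chartSet e (coord e').source ⊆ _) self_mem_nhdsWithin)).derivWithin (hu z hz)]

omit [IsManifold halfPlaneModel ∞ X] in
theorem trans_coord {e e' : atlas ClosedHalfPlane X} {x : X} (hx : x ∈ (coord e).source) :
    trans e e' (coord e x) = coord e' x := by
  change coord e' ((coord e).symm (coord e x)) = _
  rw [(coord e).left_inv hx]

omit [IsManifold halfPlaneModel ∞ X] in
theorem mapsTo_trans (e e' : atlas ClosedHalfPlane X) :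
    MapsTo (trans e e') (chartSet e (coord e').source) (range halfPlaneModel) :=
  fun _ hz => coord_target_subset e' ((coord e').map_source hz.2)

/-- The chain rule, valid at boundary points too because derivatives within the half-plane are
unique. With `e'' = e` it shows that `transDeriv` does not vanish. -/
theorem transDeriv_comp {e e' e'' : atlas ClosedHalfPlane X} {x : X} (hx : x ∈ (coord e).source)
    (hx' : x ∈ (coord e').source) (hx'' : x ∈ (coord e'').source) :
    transDeriv e e'' x = transDeriv e' e'' x * transDeriv e e' x := by
  have h1 := hasDerivWithinAt_trans (e := e) (e' := e') ((coord_mem_chartSet hx).2 hx')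
  have h2 := hasDerivWithinAt_trans (e := e') (e' := e'') ((coord_mem_chartSet hx').2 hx'')
  have h3 := hasDerivWithinAt_trans (e := e) (e' := e'') ((coord_mem_chartSet hx).2 hx'')
  rw [(coord e).left_inv hx] at h1 h3
  rw [(coord e').left_inv hx', ← trans_coord (e' := e') hx] at h2
  have hs := eventually_chartSet (isOpen_coord_source e') hx hx'
  have h1' := h1.mono (inter_subset_left (t := chartSet e (coord e').source))
  have h4 := (h2.comp _ h1' fun w hw => mapsTo_trans e e' hw.2).mono_of_mem_nhdsWithin
    (inter_mem self_mem_nhdsWithin hs)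
  have h5 : trans e e'' =ᶠ[𝓝[range halfPlaneModel] (coord e x)] trans e' e'' ∘ trans e e' := by
    filter_upwards [hs] with w hw
    simp only [Function.comp_apply]
    rw [(coord e').left_inv hw.2]
  have hmem := coord_target_subset e ((coord e).map_source hx)
  have h6 := h4.congr_of_eventuallyEq h5 (h5.self_of_nhdsWithin hmem)
  exact (uniqueDiffOn_complex_range _ hmem).eq_deriv _ h3 h6

theorem transDeriv_self {e : atlas ClosedHalfPlane X} {x : X} (hx : x ∈ (coord e).source) :
    transDeriv e e x = 1 := by
  have h1 := hasDerivWithinAt_trans (e := e) (e' := e) ((coord_mem_chartSet hx).2 hx)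
  rw [(coord e).left_inv hx] at h1
  have hmem := coord_target_subset e ((coord e).map_source hx)
  have h5 : id =ᶠ[𝓝[range halfPlaneModel] (coord e x)] trans e e := by
    filter_upwards [eventually_chartSet (isOpen_coord_source e) hx hx] with w hw
    simp only [Function.comp_apply, id]
    rw [(coord e).right_inv hw.1]
  exact (uniqueDiffOn_complex_range _ hmem).eq_deriv _ h1
    ((hasDerivWithinAt_id _ _).congr_of_eventuallyEq h5.symm (h5.symm.self_of_nhdsWithin hmem))

theorem transDeriv_ne_zero {e e' : atlas ClosedHalfPlane X} {x : X} (hx : x ∈ (coord e).source)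
    (hx' : x ∈ (coord e').source) : transDeriv e e' x ≠ 0 := by
  intro h
  have := transDeriv_comp hx hx' hx
  rw [transDeriv_self hx, h, mul_zero] at this
  exact one_ne_zero this

theorem im_coord_eq_zero_iff {e e' : atlas ClosedHalfPlane X} {x : X} (hx : x ∈ (coord e).source)
    (hx' : x ∈ (coord e').source) : (coord e x).im = 0 ↔ (coord e' x).im = 0 := by
  have h1 := coord_target_subset e ((coord e).map_source hx)
  have h2 := coord_target_subset e' ((coord e').map_source hx')
  rw [range_halfPlaneModel] at h1 h2
  have h3 := im_coord_pos_iff hx hx'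
  have h1' : 0 ≤ (coord e x).im := h1
  have h2' : 0 ≤ (coord e' x).im := h2
  constructor <;> intro h <;> by_contra hne
  · exact absurd (h3.2 (lt_of_le_of_ne h2' (Ne.symm hne))) (by rw [h]; exact lt_irrefl _)
  · exact absurd (h3.1 (lt_of_le_of_ne h1' (Ne.symm hne))) (by rw [h]; exact lt_irrefl _)

/-- Along the boundary the derivative of a coordinate change is real and positive. -/
theorem transDeriv_boundary {e e' : atlas ClosedHalfPlane X} {t : ℝ}
    (ht : (t : ℂ) ∈ chartSet e (coord e').source) :
    0 < (transDeriv e e' ((coord e).symm t)).re ∧ (transDeriv e e' ((coord e).symm t)).im = 0 ∧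
    HasDerivAt (fun s : ℝ => (trans e e' s).re) (transDeriv e e' ((coord e).symm t)).re t := by
  set c := transDeriv e e' ((coord e).symm t) with hc
  have h1 := hasDerivWithinAt_trans ht
  rw [← hc] at h1
  have hreal : ∀ s : ℝ, (s : ℂ) ∈ range halfPlaneModel := by
    intro s; rw [range_halfPlaneModel]; simp
  have h2 : HasDerivAt (fun s : ℝ => trans e e' s) c t := by
    have := h1.scomp_of_eq (h := fun s : ℝ => (s : ℂ)) (h' := 1) (s := univ) t
      (Complex.ofRealCLM.hasDerivAt.hasDerivWithinAt) (fun s _ => hreal s) rfl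
    rwa [one_smul, hasDerivWithinAt_univ] at this
  have hev : ∀ᶠ s : ℝ in 𝓝 t, (s : ℂ) ∈ chartSet e (coord e').source := by
    have : Tendsto (fun s : ℝ => (s : ℂ)) (𝓝 t) (𝓝[range halfPlaneModel] (t : ℂ)) :=
      tendsto_nhdsWithin_iff.2 ⟨Complex.continuous_ofReal.tendsto t, Eventually.of_forall hreal⟩
    exact this.eventually (chartSet_mem_nhdsWithin (isOpen_coord_source e') ht)
  -- The coordinate change is real on the real axis, so its derivative there is real.
  have him : ∀ s : ℝ, (s : ℂ) ∈ chartSet e (coord e').source → (trans e e' s).im = 0 := by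
    intro s hs
    refine (im_coord_eq_zero_iff ((coord e).map_target hs.1) hs.2).1 ?_
    rw [(coord e).right_inv hs.1]
    simp
  have h3 : HasDerivAt (fun s : ℝ => (trans e e' s).im) c.im t :=
    (Complex.imCLM.hasFDerivAt.comp_hasDerivAt t h2)
  have h4 : c.im = 0 := by
    refine h3.unique ((hasDerivAt_const t (0 : ℝ)).congr_of_eventuallyEq ?_)
    filter_upwards [hev] with s hs using him s hs
  have hc0 : c ≠ 0 := by
    have := transDeriv_ne_zero ((coord e).map_target ht.1) ht.2
    exact this
  refine ⟨?_, h4, Complex.reCLM.hasFDerivAt.comp_hasDerivAt t h2⟩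
  -- For the sign, move from `t` into the half-plane in the direction `i`. The imaginary part of the
  -- image starts at zero and stays nonnegative, and its one-sided derivative is `Im (i c) = Re c`.
  have h5 : HasDerivWithinAt (fun s : ℝ => (trans e e' (t + s * Complex.I)).im) c.re (Ici 0) 0 := by
    have hl : HasDerivWithinAt (fun s : ℝ => (t : ℂ) + s * Complex.I) Complex.I (Ici 0) 0 := by
      have := ((Complex.ofRealCLM.hasDerivAt (x := 0)).mul_const Complex.I).const_add (t : ℂ)
      simpa using this.hasDerivWithinAt
    have := h1.scomp_of_eq (h := fun s : ℝ => (t : ℂ) + s * Complex.I) (s := Ici 0) 0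
      hl (fun s hs => by rw [range_halfPlaneModel]; simpa using hs) (by simp)
    have := Complex.imCLM.hasFDerivAt.comp_hasDerivWithinAt 0 this
    have he : Complex.imCLM (Complex.I • c) = c.re := by simp
    rwa [he] at this
  have h6 : 0 ≤ c.re := by
    rw [hasDerivWithinAt_iff_tendsto_slope] at h5
    have hne : (𝓝[Ici (0:ℝ) \ {0}] 0).NeBot := by
      rw [Ici_sdiff_left]; infer_instance
    refine ge_of_tendsto h5 ?_
    have hmem : ∀ᶠ s : ℝ in 𝓝[Ici (0:ℝ) \ {0}] 0, (t : ℂ) + s * Complex.I ∈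
        chartSet e (coord e').source := by
      have : Tendsto (fun s : ℝ => (t : ℂ) + s * Complex.I) (𝓝[Ici (0:ℝ) \ {0}] 0)
          (𝓝[range halfPlaneModel] (t : ℂ)) := by
        refine tendsto_nhdsWithin_iff.2 ⟨?_, ?_⟩
        · have : Tendsto (fun s : ℝ => (t : ℂ) + s * Complex.I) (𝓝 0) (𝓝 (t + (0 : ℝ) * Complex.I)) :=
            Continuous.tendsto (by fun_prop) 0
          simp only [Complex.ofReal_zero, zero_mul, add_zero] at this
          exact this.mono_left nhdsWithin_le_nhds
        · filter_upwards [self_mem_nhdsWithin] with s hs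
          rw [range_halfPlaneModel]
          simpa using hs.1
      exact this.eventually (chartSet_mem_nhdsWithin (isOpen_coord_source e') ht)
    filter_upwards [hmem, self_mem_nhdsWithin] with s hs hs0
    have h7 := mapsTo_trans e e' hs
    rw [range_halfPlaneModel] at h7
    have h7' : 0 ≤ (trans e e' (t + s * Complex.I)).im := h7
    rw [slope_def_field]
    have h8 := him t ht
    simp only [Complex.ofReal_zero, zero_mul, add_zero, sub_zero, h8]
    exact div_nonneg h7' hs0.1
  refine lt_of_le_of_ne h6 fun h => hc0 (Complex.ext h.symm h4)

/-- The closed half-plane as a model with corners over `ℝ`. -/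
noncomputable def halfPlaneModelReal : ModelWithCorners ℝ ℂ ClosedHalfPlane where
  toPartialEquiv := halfPlaneModel.toPartialEquiv
  source_eq := rfl
  convex_range' := by
    simp only [instIsRCLikeNormedField, ↓reduceDIte]
    apply Convex.convex_isRCLikeNormedField
    have h : range halfPlaneModel.toPartialEquiv = {z : ℂ | 0 ≤ z.im} := range_halfPlaneModel
    rw [h]
    exact convex_halfSpace_im_ge 0
  nonempty_interior' := halfPlaneModel.nonempty_interior'
  continuous_toFun := halfPlaneModel.continuous
  continuous_invFun := halfPlaneModel.continuous_symm

-- Cut-off functions and partitions of unity are smooth but not holomorphic, so they are taken with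
-- respect to the real structure underlying `X`.
variable (X) in
theorem isManifold_real : IsManifold halfPlaneModelReal ∞ X := by
  refine isManifold_of_contDiffOn _ _ _ fun e e' he he' => ?_
  have := (contDiffOn_trans ⟨e, he⟩ ⟨e', he'⟩).restrict_scalars ℝ
  refine this.mono fun z hz => ?_
  refine ⟨?_, ?_⟩
  · rw [OpenPartialHomeomorph.extend_target]
    exact ⟨hz.1.1, hz.2⟩
  · rw [coord_source]
    exact hz.1.2

/-- Smooth functions on `X`, in charts. -/
def SmoothOnCharts (f : X → ℝ) : Prop :=
  ∀ e : atlas ClosedHalfPlane X, ContDiffOn ℝ ∞ (f ∘ (coord e).symm) (coord e).target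

theorem smoothOnCharts_of_contMDiff {f : X → ℝ}
    (hf : ContMDiff halfPlaneModelReal 𝓘(ℝ, ℝ) ∞ f) : SmoothOnCharts f := by
  intro e
  have := isManifold_real X
  have he : e.1 ∈ IsManifold.maximalAtlas halfPlaneModelReal ∞ X :=
    IsManifold.subset_maximalAtlas e.2
  have := hf.comp_contMDiffOn (contMDiffOn_extend_symm he)
  rw [contMDiffOn_iff_contDiffOn] at this
  rw [OpenPartialHomeomorph.extend_target']
  exact this

end Manifold

/-! ### The operator `∂` and operations on forms with poles -/

theorem hasPoleOfOrderLE_iff {f : ℂ → ℂ} {e : atlas ClosedHalfPlane X} {p : X} {n : ℕ} :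
    HasPoleOfOrderLE f e p n ↔ PoleAt f (coord e p) n := Iff.rfl

theorem wirtinger_eq_of_im_pos {g : ℂ → ℂ} {z : ℂ} (hz : 0 < z.im) :
    wirtinger g z = dzPart (fderiv ℝ g z) := by
  rw [wirtinger_eq, fderivWithin_of_mem_nhds (range_halfPlaneModel_mem_nhds hz)]

theorem wirtinger_congr {f g : ℂ → ℂ} {z : ℂ} (hz : z ∈ range halfPlaneModel)
    (h : f =ᶠ[𝓝[range halfPlaneModel] z] g) : wirtinger f z = wirtinger g z := by
  rw [wirtinger_eq, wirtinger_eq, h.fderivWithin_eq_of_mem hz]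

theorem wirtinger_eq_zero {f : ℂ → ℂ} {z : ℂ} (hz : z ∈ range halfPlaneModel)
    (h : ∀ᶠ w in 𝓝[range halfPlaneModel] z, f w = 0) : wirtinger f z = 0 := by
  rw [wirtinger_congr hz (g := fun _ => 0) h, wirtinger_eq]
  simp

theorem wirtinger_add {f g : ℂ → ℂ} {z : ℂ} (hz : z ∈ range halfPlaneModel)
    (hf : DifferentiableWithinAt ℝ f (range halfPlaneModel) z)
    (hg : DifferentiableWithinAt ℝ g (range halfPlaneModel) z) :
    wirtinger (fun w => f w + g w) z = wirtinger f z + wirtinger g z := by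
  rw [wirtinger_eq, wirtinger_eq, wirtinger_eq,
    fderivWithin_fun_add (uniqueDiffOn_range_halfPlaneModel z hz) hf hg, dzPart_add]

theorem eventually_nhds_of_im_pos {z : ℂ} (hz : 0 < z.im) {P : ℂ → Prop}
    (h : ∀ᶠ w in 𝓝[range halfPlaneModel] z, P w) : ∀ᶠ w in 𝓝 z, P w := by
  rwa [nhdsWithin_eq_nhds.2 (range_halfPlaneModel_mem_nhds hz)] at h

theorem contDiffOn_wirtinger {g : ℂ → ℂ} {e : atlas ClosedHalfPlane X} {O : Set X} (hO : IsOpen O)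
    (hg : ContDiffOn ℝ ∞ g (chartSet e O)) : ContDiffOn ℝ ∞ (wirtinger g) (chartSet e O) := by
  have hu : UniqueDiffOn ℝ (chartSet e O) :=
    uniqueDiffOn_chartSet e hO uniqueDiffOn_range_halfPlaneModel
  have h1 := hg.fderivWithin (m := ∞) hu (by simp)
  have h2 : ContDiffOn ℝ ∞ (fun z => dzPart (fderivWithin ℝ g (chartSet e O) z)) (chartSet e O) := by
    unfold dzPart
    exact ((h1.clm_apply contDiffOn_const).sub
      (contDiffOn_const.mul (h1.clm_apply contDiffOn_const))).div_const 2
  refine h2.congr fun z hz => ?_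
  have h3 := chartSet_mem_nhdsWithin hO hz
  have h4 : DifferentiableWithinAt ℝ g (range halfPlaneModel) z :=
    ((hg z hz).differentiableWithinAt (by simp)).mono_of_mem_nhdsWithin h3
  rw [wirtinger_eq, h4.hasFDerivWithinAt.mono (fun w hw => coord_target_subset e hw.1) |>.fderivWithin
    (hu z hz)]

theorem PolarForm.differentiableWithinAt [T1Space X] {a b : ℕ} (hD : D.Finite) (θ : PolarForm X a b D)
    {e : atlas ClosedHalfPlane X} {z : ℂ} (hz : z ∈ chartSet e Dᶜ) :
    DifferentiableWithinAt ℝ (θ.coeff e) (range halfPlaneModel) z :=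
  ((θ.smooth e z hz).differentiableWithinAt (by simp)).mono_of_mem_nhdsWithin
    (chartSet_mem_nhdsWithin hD.isClosed.isOpen_compl hz)

section Manifold

variable [IsManifold halfPlaneModel ∞ X]

theorem PoleAt.pullback_trans {F : ℂ → ℂ} {e e' : atlas ClosedHalfPlane X} {p : X} {n : ℕ}
    (a b : ℕ) (hp : p ∈ (coord e).source) (hp' : p ∈ (coord e').source)
    (him : 0 < (coord e p).im) (hF : PoleAt F (coord e' p) n) :
    PoleAt (fun z => F (trans e e' z) * transDeriv e e' ((coord e).symm z) ^ a *
      (starRingEnd ℂ) (transDeriv e e' ((coord e).symm z)) ^ b) (coord e p) n := by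
  have h1 := eventually_nhds_of_im_pos him (eventually_chartSet (isOpen_coord_source e') hp hp')
  have hd : ∀ z ∈ chartSet e (coord e').source, 0 < z.im →
      deriv (trans e e') z = transDeriv e e' ((coord e).symm z) := fun z hz hz' =>
    ((hasDerivWithinAt_trans hz).hasDerivAt (range_halfPlaneModel_mem_nhds hz')).deriv
  have h2 : ∀ᶠ z in 𝓝 (coord e p), 0 < z.im :=
    (isOpen_lt continuous_const Complex.continuous_im).mem_nhds him
  rw [← trans_coord hp] at hF
  refine (hF.pullback a b h1 ((contDiffOn_trans e e').differentiableOn (by simp)) ?_).congr ?_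
  · rw [hd _ h1.self_of_nhds him, (coord e).left_inv hp]
    exact transDeriv_ne_zero hp hp'
  · filter_upwards [mem_nhdsWithin_of_mem_nhds h1, mem_nhdsWithin_of_mem_nhds h2] with z hz hz'
    rw [hd z hz hz']

variable [T2Space X]

omit [ChartedSpace ClosedHalfPlane X] [IsManifold halfPlaneModel ∞ X] in
theorem isOpen_compl_sdiff_singleton (hD : D.Finite) (p : X) : IsOpen (D \ {p})ᶜ :=
  (hD.subset sdiff_subset).isClosed.isOpen_compl

omit [IsManifold halfPlaneModel ∞ X] in
theorem eventually_notMem (hD : D.Finite) {e : atlas ClosedHalfPlane X} {p : X}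
    (hp : p ∈ (coord e).source) : ∀ᶠ z in 𝓝[range halfPlaneModel] (coord e p), z ≠ coord e p →
      (coord e).symm z ∉ D := by
  filter_upwards [eventually_chartSet (isOpen_compl_sdiff_singleton hD p) hp (by simp)] with z hz hzp hzD
  refine hz.2 ⟨hzD, fun h => hzp ?_⟩
  rw [mem_singleton_iff] at h
  rw [← h, (coord e).right_inv hz.1]

/-- The order of a pole at an interior point can be bounded in any one chart, since coordinate
changes are biholomorphic on a full neighbourhood there. -/
theorem PolarForm.poleAt_trans {a b : ℕ} (hD : D.Finite) (θ : PolarForm X a b D)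
    {e e' : atlas ClosedHalfPlane X} {p : X} {n : ℕ} (hp : p ∈ (coord e).source)
    (hp' : p ∈ (coord e').source) (him : 0 < (coord e p).im)
    (h : PoleAt (θ.coeff e') (coord e' p) n) : PoleAt (θ.coeff e) (coord e p) n := by
  refine (h.pullback_trans a b hp hp' him).congr ?_
  have h1 := eventually_nhds_of_im_pos him (eventually_notMem hD hp)
  have h2 := eventually_nhds_of_im_pos him (eventually_chartSet (isOpen_coord_source e') hp hp')
  filter_upwards [mem_nhdsWithin_of_mem_nhds h1, mem_nhdsWithin_of_mem_nhds h2,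
    self_mem_nhdsWithin] with z hz hz' hzp
  have := θ.compat e e' ((coord e).symm z) ⟨(coord e).map_target hz'.1, hz'.2⟩ (hz hzp)
  rwa [(coord e).right_inv hz'.1] at this

/-- The sum of two forms. -/
def PolarForm.add {a b : ℕ} (θ η : PolarForm X a b D) : PolarForm X a b D where
  coeff e z := θ.coeff e z + η.coeff e z
  compat e e' x hx hxD := by
    rw [θ.compat e e' x hx hxD, η.compat e e' x hx hxD]
    ring
  smooth e := (θ.smooth e).add (η.smooth e)
  pole e p hp hpe := by
    obtain ⟨n, hn⟩ := θ.pole e p hp hpe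
    obtain ⟨m, hm⟩ := η.pole e p hp hpe
    rw [hasPoleOfOrderLE_iff] at *
    exact ⟨max n m, (hn.mono (le_max_left _ _)).add (hm.mono (le_max_right _ _))⟩

/-- The difference of two forms. -/
def PolarForm.sub {a b : ℕ} (θ η : PolarForm X a b D) : PolarForm X a b D where
  coeff e z := θ.coeff e z - η.coeff e z
  compat e e' x hx hxD := by
    rw [θ.compat e e' x hx hxD, η.compat e e' x hx hxD]
    ring
  smooth e := (θ.smooth e).sub (η.smooth e)
  pole e p hp hpe := by
    obtain ⟨n, hn⟩ := θ.pole e p hp hpe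
    obtain ⟨m, hm⟩ := η.pole e p hp hpe
    rw [hasPoleOfOrderLE_iff] at *
    exact ⟨max n m, (hn.mono (le_max_left _ _)).sub (hm.mono (le_max_right _ _))⟩

omit [T2Space X] in
theorem im_coord_pos_of_mem (hDb : Disjoint D (halfPlaneModel.boundary X))
    {e : atlas ClosedHalfPlane X} {p : X} (hp : p ∈ D) (hpe : p ∈ (coord e).source) :
    0 < (coord e p).im :=
  im_coord_pos_of_notMem_boundary hpe (disjoint_left.1 hDb hp)

omit [IsManifold halfPlaneModel ∞ X] [T2Space X] in
theorem SmoothOnCharts.contDiffOn_complex {f : X → ℝ} (hf : SmoothOnCharts f)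
    (e : atlas ClosedHalfPlane X) :
    ContDiffOn ℝ ∞ (fun z => (f ((coord e).symm z) : ℂ)) (coord e).target :=
  Complex.ofRealCLM.contDiff.comp_contDiffOn (hf e)

omit [IsManifold halfPlaneModel ∞ X] [T2Space X] in
theorem coord_target_mem_nhds {e : atlas ClosedHalfPlane X} {p : X} (hpe : p ∈ (coord e).source)
    (him : 0 < (coord e p).im) : (coord e).target ∈ 𝓝 (coord e p) :=
  mem_interior_iff_mem_nhds.1 ((mem_interior_target_iff ((coord e).map_source hpe)).2 him)

/-- The product of a form with a smooth function. -/
noncomputable def PolarForm.smul {a b : ℕ} (hDb : Disjoint D (halfPlaneModel.boundary X)) (f : X → ℝ)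
    (hf : SmoothOnCharts f) (θ : PolarForm X a b D) : PolarForm X a b D where
  coeff e z := f ((coord e).symm z) * θ.coeff e z
  compat e e' x hx hxD := by
    rw [θ.compat e e' x hx hxD, (coord e).left_inv hx.1, (coord e').left_inv hx.2]
    ring
  smooth e := ((hf.contDiffOn_complex e).mono fun z hz => hz.1).mul (θ.smooth e)
  pole e p hp hpe := by
    obtain ⟨n, hn⟩ := θ.pole e p hp hpe
    rw [hasPoleOfOrderLE_iff] at hn
    exact ⟨n, hn.smooth_mul (coord_target_mem_nhds hpe (im_coord_pos_of_mem hDb hp hpe))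
      (hf.contDiffOn_complex e)⟩

/-- The form `∂β`. -/
noncomputable def PolarForm.del (hD : D.Finite) (hDb : Disjoint D (halfPlaneModel.boundary X))
    (β : PolarForm X 0 1 D) : PolarForm X 1 1 D where
  coeff e := wirtinger (β.coeff e)
  compat e e' x hx hxD := by
    set z := coord e x with hz
    have hzx : (coord e).symm z = x := (coord e).left_inv hx.1
    have hzs : z ∈ chartSet e (coord e').source := (coord_mem_chartSet hx.1).2 hx.2
    have hzH : z ∈ range halfPlaneModel := coord_target_subset e hzs.1
    have hg := (β.differentiableWithinAt hD ((coord_mem_chartSet (e := e') hx.2).2 hxD)).hasFDerivWithinAt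
    rw [← trans_coord (e := e) hx.1] at hg
    have hmem := chartSet_mem_nhdsWithin (isOpen_coord_source e') hzs
    have hsub : chartSet e (coord e').source ⊆ range halfPlaneModel :=
      fun w hw => coord_target_subset e hw.1
    have hφ' : DifferentiableWithinAt ℂ (fun z => transDeriv e e' ((coord e).symm z))
        (chartSet e (coord e').source) z :=
      (contDiffOn_transDeriv e e' z hzs).differentiableWithinAt (by simp)
    obtain ⟨M, hM, hM'⟩ := exists_hasFDerivWithinAt_pullback hg
      (φ' := fun z => transDeriv e e' ((coord e).symm z))
      ((hasDerivWithinAt_trans hzs).mono hsub) hφ'.hasDerivWithinAt (mapsTo_trans e e')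
    have h1 := hM.mono_of_mem_nhdsWithin hmem
    -- The transformation rule of `β` holds on a whole relative neighbourhood of `z`, because `D` is
    -- closed, and may therefore be differentiated.
    have hev : β.coeff e =ᶠ[𝓝[range halfPlaneModel] z] fun w => β.coeff e' (trans e e' w) *
        (starRingEnd ℂ) (transDeriv e e' ((coord e).symm w)) := by
      filter_upwards [hmem, chartSet_mem_nhdsWithin hD.isClosed.isOpen_compl
        ((coord_mem_chartSet hx.1).2 hxD)] with w hw hwD
      have := β.compat e e' ((coord e).symm w) ⟨(coord e).map_target hw.1, hw.2⟩ hwD.2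
      rw [(coord e).right_inv hw.1] at this
      simpa using this
    rw [wirtinger_congr hzH hev, wirtinger_eq, h1.fderivWithin
      (uniqueDiffOn_range_halfPlaneModel z hzH), hM', hzx, trans_coord hx.1, ← wirtinger_eq,
      pow_one, pow_one]
  smooth e := contDiffOn_wirtinger hD.isClosed.isOpen_compl (β.smooth e)
  pole e p hp hpe := by
    obtain ⟨n, hn⟩ := β.pole e p hp hpe
    rw [hasPoleOfOrderLE_iff] at hn
    have him := im_coord_pos_of_mem hDb hp hpe
    refine ⟨n + 1, PoleAt.congr hn.dzPart_fderiv (mem_nhdsWithin_of_mem_nhds ?_)⟩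
    filter_upwards [(isOpen_lt continuous_const Complex.continuous_im).mem_nhds him] with z hz
    exact wirtinger_eq_of_im_pos hz

theorem PolarForm.del_add {hD : D.Finite} {hDb : Disjoint D (halfPlaneModel.boundary X)}
    (β γ : PolarForm X 0 1 D) {e : atlas ClosedHalfPlane X} {z : ℂ} (hz : z ∈ chartSet e Dᶜ) :
    ((β.add γ).del hD hDb).coeff e z = (β.del hD hDb).coeff e z + (γ.del hD hDb).coeff e z :=
  wirtinger_add (coord_target_subset e hz.1) (β.differentiableWithinAt hD hz)
    (γ.differentiableWithinAt hD hz)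

omit [IsManifold halfPlaneModel ∞ X] [T2Space X] in
theorem eventually_eq_zero_of_notMem_tsupport {f : X → ℝ} {e : atlas ClosedHalfPlane X} {z : ℂ}
    (hz : z ∈ (coord e).target) (hf : (coord e).symm z ∉ tsupport f) :
    ∀ᶠ w in 𝓝[range halfPlaneModel] z, f ((coord e).symm w) = 0 := by
  filter_upwards [chartSet_mem_nhdsWithin (isClosed_tsupport f).isOpen_compl ⟨hz, hf⟩] with w hw
  exact image_eq_zero_of_notMem_tsupport hw.2

theorem PolarForm.del_smul_eq_zero {hD : D.Finite} {hDb : Disjoint D (halfPlaneModel.boundary X)}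
    {f : X → ℝ} (hf : SmoothOnCharts f) (β : PolarForm X 0 1 D) {e : atlas ClosedHalfPlane X}
    {z : ℂ} (hz : z ∈ (coord e).target) (hzf : (coord e).symm z ∉ tsupport f) :
    ((β.smul hDb f hf).del hD hDb).coeff e z = 0 := by
  refine wirtinger_eq_zero (coord_target_subset e hz) ?_
  filter_upwards [eventually_eq_zero_of_notMem_tsupport hz hzf] with w hw
  change (f ((coord e).symm w) : ℂ) * _ = 0
  rw [hw, Complex.ofReal_zero, zero_mul]

/-- The form which is `g dz̄` in the coordinate of `e`, cut off by a function supported in the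
domain of `e`, where `g = h / (z - z(p))^m`. -/
noncomputable def PolarForm.ofChart (hDb : Disjoint D (halfPlaneModel.boundary X))
    (χ : X → ℝ) (hχ : SmoothOnCharts χ) (e : atlas ClosedHalfPlane X) (p : X) (hpD : p ∈ D)
    (hpe : p ∈ (coord e).source) (hχe : tsupport χ ⊆ (coord e).source)
    (hχD : ∀ q ∈ D, q ≠ p → q ∉ tsupport χ) (h : ℂ → ℂ) (hh : ContDiff ℝ ∞ h) (m : ℕ) :
    PolarForm X 0 1 D where
  coeff e' w := χ ((coord e').symm w) * (h (trans e' e w) / (trans e' e w - coord e p) ^ m *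
    (starRingEnd ℂ) (transDeriv e' e ((coord e').symm w)))
  compat e₁ e₂ x hx hxD := by
    rw [(coord e₁).left_inv hx.1, (coord e₂).left_inv hx.2, trans_coord hx.1, trans_coord hx.2]
    by_cases hxe : x ∈ (coord e).source
    · rw [transDeriv_comp hx.1 hx.2 hxe, map_mul]
      ring
    -- Outside the domain of `e` the other factors have no meaning, but the cut-off `χ` vanishes.
    · rw [image_eq_zero_of_notMem_tsupport fun h => hxe (hχe h)]
      simp
  smooth e' := by
    intro w hw
    by_cases hwe : (coord e').symm w ∈ (coord e).source
    · have hws : w ∈ chartSet e' (coord e).source := ⟨hw.1, hwe⟩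
      have h1 : ContDiffWithinAt ℝ ∞ (trans e' e) (range halfPlaneModel) w :=
        ((contDiffOn_trans e' e).restrict_scalars ℝ w hws).mono_of_mem_nhdsWithin
          (chartSet_mem_nhdsWithin (isOpen_coord_source e) hws)
      have h2 : ContDiffWithinAt ℝ ∞ (fun z => transDeriv e' e ((coord e').symm z))
          (range halfPlaneModel) w :=
        ((contDiffOn_transDeriv e' e).restrict_scalars ℝ w hws).mono_of_mem_nhdsWithin
          (chartSet_mem_nhdsWithin (isOpen_coord_source e) hws)
      have h3 : ContDiffWithinAt ℝ ∞ (fun z => (χ ((coord e').symm z) : ℂ))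
          (range halfPlaneModel) w :=
        (hχ.contDiffOn_complex e' w hw.1).mono_of_mem_nhdsWithin
          (coord_target_mem_nhdsWithin hw.1)
      have h4 : trans e' e w - coord e p ≠ 0 := by
        rw [sub_ne_zero]
        intro heq
        have := (coord e).injOn hwe hpe heq
        exact hw.2 (this ▸ hpD)
      simp only [div_eq_mul_inv]
      refine ContDiffWithinAt.mono ?_ (fun z hz => coord_target_subset e' hz.1)
      refine h3.mul (((hh.contDiffAt.comp_contDiffWithinAt w h1).mul
        (((h1.sub contDiffWithinAt_const).pow m).inv (pow_ne_zero m h4))).mul ?_)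
      exact (Complex.conjCLE : ℂ →L[ℝ] ℂ).contDiff.contDiffAt.comp_contDiffWithinAt w h2
    · have h1 := eventually_eq_zero_of_notMem_tsupport hw.1 fun h => hwe (hχe h)
      have h2 : ∀ᶠ z in 𝓝[range halfPlaneModel] w, (χ ((coord e').symm z) : ℂ) *
          (h (trans e' e z) / (trans e' e z - coord e p) ^ m *
          (starRingEnd ℂ) (transDeriv e' e ((coord e').symm z))) = 0 := by
        filter_upwards [h1] with z hz
        rw [hz, Complex.ofReal_zero, zero_mul]
      have h3 : ContDiffWithinAt ℝ ∞ (fun _ : ℂ => (0 : ℂ)) (range halfPlaneModel) w :=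
        contDiffWithinAt_const
      exact (h3.congr_of_eventuallyEq h2 (h2.self_of_nhdsWithin (coord_target_subset e' hw.1))).mono
        (fun z hz => coord_target_subset e' hz.1)
  pole e' q hq hqe' := by
    have him := im_coord_pos_of_mem hDb hq hqe'
    by_cases hqp : q = p
    · subst hqp
      refine ⟨m, PoleAt.smooth_mul (coord_target_mem_nhds hqe' him) (hχ.contDiffOn_complex e') ?_⟩
      have h1 : PoleAt (fun z => h z / (z - coord e q) ^ m) (coord e q) m :=
        poleAt_iff.2 ⟨h, hh, by simp⟩
      simpa using h1.pullback_trans 0 1 hqe' hpe him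
    · refine ⟨0, (PoleAt.zero _ 0).congr (mem_nhdsWithin_of_mem_nhds ?_)⟩
      have h1 := eventually_nhds_of_im_pos him (eventually_eq_zero_of_notMem_tsupport
        ((coord e').map_source hqe') (by rw [(coord e').left_inv hqe']; exact hχD q hq hqp))
      filter_upwards [h1] with z hz
      rw [hz, Complex.ofReal_zero, zero_mul]

end Manifold

/-! ### Integrals through the partition of unity, and their computation in one chart -/

section Partition

variable [CompactSpace X] [T2Space X]

theorem tsupport_partition_subset (e : atlas ClosedHalfPlane X) :
    tsupport (partition X e) ⊆ (coord e).source := by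
  rw [coord_source]
  exact (exists_partition X).choose_spec e

variable (X) in
theorem finite_partition_ne_zero :
    {e : atlas ClosedHalfPlane X | (Function.support (partition X e)).Nonempty}.Finite :=
  (partition X).locallyFinite.finite_nonempty_of_compact

variable (X) in
/-- The finitely many charts which contribute to the partition of unity. -/
noncomputable def activeCharts : Finset (atlas ClosedHalfPlane X) :=
  (finite_partition_ne_zero X).toFinset

theorem partition_eq_zero {e : atlas ClosedHalfPlane X} (he : e ∉ activeCharts X) (x : X) :
    partition X e x = 0 := by
  by_contra h
  exact he ((finite_partition_ne_zero X).mem_toFinset.2 ⟨x, h⟩)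

theorem sum_partition (x : X) : ∑ e ∈ activeCharts X, partition X e x = 1 := by
  rw [← (partition X).sum_eq_one (mem_univ x), finsum_eq_sum_of_support_subset]
  intro e he
  by_contra h
  exact he (partition_eq_zero h x)

theorem PolarForm.integralOn_eq_sum (θ : PolarForm X 1 1 D) (A : Set X) :
    θ.integralOn A = ∑ e ∈ activeCharts X, ∫ z in chartSet e A, θ.integrand e z := by
  refine finsum_eq_sum_of_support_subset _ fun e he => ?_
  by_contra h
  refine he ?_
  simp [PolarForm.integrand, partition_eq_zero h]

theorem PolarForm.boundaryIntegral_eq_sum (β : PolarForm X 0 1 D) :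
    β.boundaryIntegral = ∑ e ∈ activeCharts X, ∫ t in {t : ℝ | (t : ℂ) ∈ (coord e).target},
      (partition X e ((coord e).symm (t : ℂ)) : ℂ) * β.coeff e (t : ℂ) := by
  refine finsum_eq_sum_of_support_subset _ fun e he => ?_
  by_contra h
  refine he ?_
  simp [partition_eq_zero h]

theorem continuousOn_partition (e e' : atlas ClosedHalfPlane X) :
    ContinuousOn (fun z => (partition X e' ((coord e).symm z) : ℂ)) (coord e).target :=
  (Complex.continuous_ofReal.comp (partition X e').continuous).comp_continuousOn
    (OpenPartialHomeomorph.continuousOn_extend_symm _)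

theorem norm_partition_le (e : atlas ClosedHalfPlane X) (x : X) :
    ‖(partition X e x : ℂ)‖ ≤ 1 := by
  rw [Complex.norm_real, Real.norm_of_nonneg ((partition X).nonneg e x)]
  exact (partition X).le_one e x

theorem partition_eq_zero_of_notMem {e : atlas ClosedHalfPlane X} {x : X}
    (hx : x ∉ (coord e).source) : partition X e x = 0 :=
  image_eq_zero_of_notMem_tsupport fun h => hx (tsupport_partition_subset e h)

theorem integrableOn_partition_mul {F : ℂ → ℂ} {e : atlas ClosedHalfPlane X}
    (e' : atlas ClosedHalfPlane X) {S : Set ℂ} (hS : MeasurableSet S) (hSe : S ⊆ (coord e).target)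
    (hF : IntegrableOn F S) :
    IntegrableOn (fun z => (partition X e' ((coord e).symm z) : ℂ) * F z) S :=
  Integrable.bdd_mul (c := 1) hF (((continuousOn_partition e e').mono hSe).aestronglyMeasurable hS)
    (Eventually.of_forall fun _ => norm_partition_le e' _)

theorem PolarForm.integrand_eq (θ : PolarForm X 1 1 D) (e : atlas ClosedHalfPlane X) (z : ℂ) :
    θ.integrand e z =
      (partition X e ((coord e).symm z) : ℂ) * (-2 * Complex.I * θ.coeff e z) := by
  rw [PolarForm.integrand]; ring

omit [T2Space X] in
/-- A function which is continuous away from `D` and vanishes outside a compact set is integrable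
on sets which stay away from `D`. -/
theorem integrableOn_chartSet {F : ℂ → ℂ} {e : atlas ClosedHalfPlane X}
    (hF : ContinuousOn F (chartSet e Dᶜ)) {K V A : Set X} (hK : IsClosed K)
    (hKe : K ⊆ (coord e).source) (hV : IsOpen V) (hDV : D ⊆ V) (hA : ChartMeasurable A)
    (hAV : Disjoint A V) (h0 : ∀ z ∈ chartSet e A, (coord e).symm z ∉ K → F z = 0) :
    IntegrableOn F (chartSet e A) := by
  have h1 : IsCompact (chartSet e (K \ V)) :=
    isCompact_chartSet e (hK.sdiff hV) (sdiff_subset.trans hKe)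
  have h2 : IntegrableOn F (chartSet e (K \ V)) :=
    (hF.mono fun z hz => ⟨hz.1, fun h => hz.2.2 (hDV h)⟩).integrableOn_compact h1
  refine h2.of_forall_sdiff_eq_zero (hA e) fun z hz => h0 z hz.1 fun hzK => hz.2 ⟨hz.1.1, hzK, ?_⟩
  exact disjoint_left.1 hAV hz.1.2

omit [CompactSpace X] [T2Space X] in
theorem PolarForm.continuousOn_coeff {a b : ℕ} (θ : PolarForm X a b D)
    (e : atlas ClosedHalfPlane X) : ContinuousOn (θ.coeff e) (chartSet e Dᶜ) :=
  (θ.smooth e).continuousOn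

/-- The partition function has compact support inside its chart, and on the part of this support
outside `V` the coefficient is continuous. -/
theorem PolarForm.absConvergentOn (θ : PolarForm X 1 1 D) {V A : Set X} (hV : IsOpen V)
    (hDV : D ⊆ V) (hA : ChartMeasurable A) (hAV : Disjoint A V) : θ.AbsConvergentOn A := by
  intro e
  refine integrableOn_chartSet (D := D) (K := tsupport (partition X e)) ?_ (isClosed_tsupport _)
    (tsupport_partition_subset e) hV hDV hA hAV fun z hz hzK => ?_
  · exact (continuousOn_const.mul ((continuousOn_partition e e).mono fun z hz => hz.1)).mul
      (θ.continuousOn_coeff e)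
  · rw [PolarForm.integrand_eq, image_eq_zero_of_notMem_tsupport hzK, Complex.ofReal_zero, zero_mul]

section Manifold

variable [IsManifold halfPlaneModel ∞ X]

omit [CompactSpace X] [T2Space X] [IsManifold halfPlaneModel ∞ X] in
theorem injOn_trans (e e' : atlas ClosedHalfPlane X) :
    InjOn (trans e e') (chartSet e (coord e').source) := by
  intro z hz w hw h
  exact (coord e).symm.injOn hz.1 hw.1 ((coord e').injOn hz.2 hw.2 h)

omit [CompactSpace X] [T2Space X] [IsManifold halfPlaneModel ∞ X] in
theorem image_trans (e e' : atlas ClosedHalfPlane X) (A : Set X) :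
    trans e e' '' chartSet e (A ∩ (coord e').source) = chartSet e' (A ∩ (coord e).source) := by
  ext w
  constructor
  · rintro ⟨z, hz, rfl⟩
    refine ⟨(coord e').map_source hz.2.2, ?_⟩
    change (coord e').symm (coord e' ((coord e).symm z)) ∈ _
    rw [(coord e').left_inv hz.2.2]
    exact ⟨hz.2.1, (coord e).map_target hz.1⟩
  · intro hw
    refine ⟨coord e ((coord e').symm w), (coord_mem_chartSet hw.2.2).2
      ⟨hw.2.1, (coord e').map_target hw.1⟩, ?_⟩
    rw [trans_coord hw.2.2, (coord e').right_inv hw.1]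

/-- The integral of a form which vanishes outside the domain of a chart can be computed in this
chart. -/
theorem PolarForm.integralOn_eq_setIntegral (θ : PolarForm X 1 1 D) (e : atlas ClosedHalfPlane X)
    {A : Set X} (hA : ChartMeasurable A) (hAD : Disjoint A D)
    (h0 : ∀ e', ∀ z ∈ chartSet e' A, (coord e').symm z ∉ (coord e).source → θ.coeff e' z = 0)
    (hint : IntegrableOn (θ.coeff e) (chartSet e A)) :
    θ.integralOn A = ∫ z in chartSet e A, -2 * Complex.I * θ.coeff e z := by
  have hm : ∀ e₁ e₂ : atlas ClosedHalfPlane X,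
      MeasurableSet (chartSet e₁ (A ∩ (coord e₂).source)) := fun e₁ e₂ =>
    hA.inter (isOpen_coord_source e₂).chartMeasurable e₁
  -- The contribution of each chart is transported to `e`: the factor `|dz'/dz|²` from the change of
  -- variables is the one in the transformation rule of a `(1,1)`-form. Afterwards the partition
  -- functions add up to one.
  have key : ∀ e', ∫ z in chartSet e' A, θ.integrand e' z = ∫ z in chartSet e A,
      (partition X e' ((coord e).symm z) : ℂ) * (-2 * Complex.I * θ.coeff e z) := by
    intro e'
    rw [setIntegral_eq_of_subset_of_forall_sdiff_eq_zero (hA e')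
      (s := chartSet e' (A ∩ (coord e).source)) (fun z hz => ⟨hz.1, hz.2.1⟩),
      ← image_trans, integral_image_holomorphic (φ' := fun z => transDeriv e e' ((coord e).symm z))
        (hm e e'), setIntegral_eq_of_subset_of_forall_sdiff_eq_zero (hA e)
      (s := chartSet e (A ∩ (coord e').source)) (fun z hz => ⟨hz.1, hz.2.1⟩)]
    · refine setIntegral_congr_fun (hm e e') fun z hz => ?_
      have hc := θ.compat e e' ((coord e).symm z) ⟨(coord e).map_target hz.1, hz.2.2⟩
        (disjoint_left.1 hAD hz.2.1)
      rw [(coord e).right_inv hz.1, pow_one, pow_one] at hc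
      have hs : (coord e').symm (trans e e' z) = (coord e).symm z := (coord e').left_inv hz.2.2
      rw [PolarForm.integrand_eq, hs, hc]
      simp only [trans, Function.comp_def]
      ring
    · intro z hz
      have hx : (coord e).symm z ∉ (coord e').source := fun h => hz.2 ⟨hz.1.1, hz.1.2, h⟩
      rw [partition_eq_zero_of_notMem hx, Complex.ofReal_zero, zero_mul]
    · intro z hz
      exact (hasDerivWithinAt_trans (e := e) (e' := e') (z := z) ⟨hz.1, hz.2.2⟩).mono fun w hw => coord_target_subset e hw.1
    · exact (injOn_trans e e').mono fun z (hz : z ∈ chartSet e (A ∩ (coord e').source)) =>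
        (⟨hz.1, hz.2.2⟩ : z ∈ chartSet e (coord e').source)
    · intro z hz
      rw [PolarForm.integrand, h0 e' z hz.1 fun h => hz.2 ⟨hz.1.1, hz.1.2, h⟩, mul_zero]
  rw [PolarForm.integralOn_eq_sum, Finset.sum_congr rfl fun e' _ => key e',
    ← integral_finsetSum]
  · refine integral_congr_ae (Eventually.of_forall fun z => ?_)
    beta_reduce
    rw [← Finset.sum_mul, ← Complex.ofReal_sum, sum_partition, Complex.ofReal_one, one_mul]
  · intro e' _
    exact integrableOn_partition_mul e' (hA e) (fun z hz => hz.1) (hint.const_mul _)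

omit [CompactSpace X] [T2Space X] in
theorem ofReal_notMem (hDb : Disjoint D (halfPlaneModel.boundary X)) {e : atlas ClosedHalfPlane X}
    {t : ℝ} (ht : (t : ℂ) ∈ (coord e).target) : (coord e).symm (t : ℂ) ∉ D := by
  intro h
  have := im_coord_pos_of_mem hDb h ((coord e).map_target ht)
  rw [(coord e).right_inv ht, Complex.ofReal_im] at this
  exact lt_irrefl _ this

omit [CompactSpace X] [T2Space X] in
theorem ofReal_re_trans {e e' : atlas ClosedHalfPlane X} {t : ℝ}
    (ht : (t : ℂ) ∈ chartSet e (coord e').source) :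
    (((trans e e' t).re : ℝ) : ℂ) = trans e e' t := by
  have h := (im_coord_eq_zero_iff ((coord e).map_target ht.1) ht.2).1
    (by rw [(coord e).right_inv ht.1]; simp)
  exact Complex.ext rfl h.symm

omit [CompactSpace X] [T2Space X] in
theorem image_trans_real (e e' : atlas ClosedHalfPlane X) :
    (fun t : ℝ => (trans e e' t).re) '' {t : ℝ | (t : ℂ) ∈ chartSet e (coord e').source} =
      {t : ℝ | (t : ℂ) ∈ chartSet e' (coord e).source} := by
  have hmap : ∀ (e e' : atlas ClosedHalfPlane X) (t : ℝ), (t : ℂ) ∈ chartSet e (coord e').source →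
      (((trans e e' t).re : ℝ) : ℂ) ∈ chartSet e' (coord e).source := by
    intro e e' t ht
    rw [ofReal_re_trans ht]
    exact (coord_mem_chartSet ht.2).2 ((coord e).map_target ht.1)
  ext w
  constructor
  · rintro ⟨t, ht, rfl⟩
    exact hmap e e' t ht
  · intro hw
    refine ⟨_, hmap e' e w hw, ?_⟩
    beta_reduce
    rw [ofReal_re_trans hw]
    change (trans e e' (coord e ((coord e').symm w))).re = w
    rw [trans_coord hw.2, (coord e').right_inv hw.1, Complex.ofReal_re]

/-- The boundary integral of a form which vanishes outside the domain of a chart can be computed in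
this chart. -/
theorem PolarForm.boundaryIntegral_eq_setIntegral (hDb : Disjoint D (halfPlaneModel.boundary X))
    (β : PolarForm X 0 1 D) (e : atlas ClosedHalfPlane X)
    (h0 : ∀ e', ∀ t : ℝ, (t : ℂ) ∈ (coord e').target →
      (coord e').symm t ∉ (coord e).source → β.coeff e' t = 0)
    (hint : IntegrableOn (fun t : ℝ => β.coeff e t) {t : ℝ | (t : ℂ) ∈ (coord e).target}) :
    β.boundaryIntegral = ∫ t in {t : ℝ | (t : ℂ) ∈ (coord e).target}, β.coeff e t := by
  have hm : ∀ e₁ e₂ : atlas ClosedHalfPlane X,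
      MeasurableSet {t : ℝ | (t : ℂ) ∈ chartSet e₁ (coord e₂).source} := fun e₁ e₂ =>
    Complex.measurable_ofReal ((isOpen_coord_source e₂).chartMeasurable e₁)
  have hmt : ∀ e : atlas ClosedHalfPlane X, MeasurableSet {t : ℝ | (t : ℂ) ∈ (coord e).target} :=
    fun e => Complex.measurable_ofReal (measurableSet_coord_target e)
  have key : ∀ e', ∫ t in {t : ℝ | (t : ℂ) ∈ (coord e').target},
      (partition X e' ((coord e').symm (t : ℂ)) : ℂ) * β.coeff e' (t : ℂ) =
      ∫ t in {t : ℝ | (t : ℂ) ∈ (coord e).target},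
      (partition X e' ((coord e).symm (t : ℂ)) : ℂ) * β.coeff e (t : ℂ) := by
    intro e'
    rw [setIntegral_eq_of_subset_of_forall_sdiff_eq_zero (hmt e')
      (s := {t : ℝ | (t : ℂ) ∈ chartSet e' (coord e).source}) (fun z hz => hz.1),
      ← image_trans_real, integral_image_eq_integral_abs_deriv_smul (hm e e')
        (f' := fun t => (transDeriv e e' ((coord e).symm t)).re),
      setIntegral_eq_of_subset_of_forall_sdiff_eq_zero (hmt e)
      (s := {t : ℝ | (t : ℂ) ∈ chartSet e (coord e').source}) (fun z hz => hz.1)]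
    · refine setIntegral_congr_fun (hm e e') fun t ht => ?_
      have hc := β.compat e e' ((coord e).symm t) ⟨(coord e).map_target ht.1, ht.2⟩
        (ofReal_notMem hDb ht.1)
      obtain ⟨hpos, him, -⟩ := transDeriv_boundary ht
      -- On the boundary the conjugated derivative is real and positive, so it equals the absolute
      -- value occurring in the real change of variables. Coordinate changes thus preserve the
      -- boundary orientation.
      have hT : (starRingEnd ℂ) (transDeriv e e' ((coord e).symm t)) =
          ((transDeriv e e' ((coord e).symm t)).re : ℂ) := by
        apply Complex.ext <;> simp only [Complex.conj_re, Complex.conj_im, Complex.ofReal_re,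
          Complex.ofReal_im, him, neg_zero]
      rw [(coord e).right_inv ht.1, pow_zero, mul_one, pow_one, hT] at hc
      have hs : (coord e').symm (trans e e' t) = (coord e).symm t := (coord e').left_inv ht.2
      rw [ofReal_re_trans ht, hs, hc, abs_of_pos hpos, Complex.real_smul]
      simp only [trans, Function.comp_def]
      ring
    · intro t ht
      rw [partition_eq_zero_of_notMem fun h => ht.2 ⟨ht.1, h⟩, Complex.ofReal_zero, zero_mul]
    · intro t ht
      exact (transDeriv_boundary ht).2.2.hasDerivWithinAt
    · intro t ht s hs hts
      have h1 := congrArg (fun r : ℝ => (r : ℂ)) hts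
      beta_reduce at h1
      rw [ofReal_re_trans ht, ofReal_re_trans hs] at h1
      exact Complex.ofReal_injective (injOn_trans e e' ht hs h1)
    · intro t ht
      rw [h0 e' t ht.1 fun h => ht.2 ⟨ht.1, h⟩, mul_zero]
  rw [PolarForm.boundaryIntegral_eq_sum, Finset.sum_congr rfl fun e' _ => key e',
    ← integral_finsetSum]
  · refine integral_congr_ae (Eventually.of_forall fun t => ?_)
    beta_reduce
    rw [← Finset.sum_mul, ← Complex.ofReal_sum, sum_partition, Complex.ofReal_one, one_mul]
  · intro e' _
    refine Integrable.bdd_mul (c := 1) hint (ContinuousOn.aestronglyMeasurable ?_ (hmt e))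
      (Eventually.of_forall fun _ => norm_partition_le e' _)
    exact (continuousOn_partition e e').comp Complex.continuous_ofReal.continuousOn fun t ht => ht

omit [T2Space X] in
/-- A function which is continuous away from `D` and vanishes outside a compact set is integrable
on the boundary. -/
theorem integrableOn_boundary (hDb : Disjoint D (halfPlaneModel.boundary X))
    {e : atlas ClosedHalfPlane X} {F : ℂ → ℂ} (hF : ContinuousOn F (chartSet e Dᶜ)) {K : Set X}
    (hK : IsClosed K) (hKe : K ⊆ (coord e).source)
    (h0 : ∀ t : ℝ, (t : ℂ) ∈ (coord e).target → (coord e).symm t ∉ K → F t = 0) :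
    IntegrableOn (fun t : ℝ => F t) {t : ℝ | (t : ℂ) ∈ (coord e).target} := by
  have h1 : IsCompact ((fun t : ℝ => (t : ℂ)) ⁻¹' chartSet e K) :=
    Complex.isometry_ofReal.isClosedEmbedding.isCompact_preimage (isCompact_chartSet e hK hKe)
  have h2 : IntegrableOn (fun t : ℝ => F t) ((fun t : ℝ => (t : ℂ)) ⁻¹' chartSet e K) := by
    refine ContinuousOn.integrableOn_compact h1 ?_
    exact hF.comp Complex.continuous_ofReal.continuousOn
      fun t ht => ⟨ht.1, ofReal_notMem hDb ht.1⟩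
  refine h2.of_forall_sdiff_eq_zero (Complex.measurable_ofReal (measurableSet_coord_target e))
    fun t ht => h0 t ht.1 fun h => ht.2 ⟨ht.1, h⟩

end Manifold

end Partition

/-! ### Coordinate balls shrinking to `D` -/

theorem chartMeasurable_coordBall (z : OpenPartialHomeomorph X ℂ) (ε : ℝ) :
    ChartMeasurable (coordBall z ε) := by
  have h1 : IsOpen (z.source ∩ z ⁻¹' {w | ε < ‖w‖}) :=
    z.isOpen_inter_preimage (isOpen_lt continuous_const continuous_norm)
  -- For large `ε` the ball need not be closed in `X`, but it is always a difference of two open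
  -- sets.
  have h2 : coordBall z ε = z.source ∩ (z.source ∩ z ⁻¹' {w | ε < ‖w‖})ᶜ := by
    ext x
    constructor
    · exact fun hx => ⟨hx.1, fun h => not_lt.2 hx.2 h.2⟩
    · exact fun hx => ⟨hx.1, not_lt.1 fun h => hx.2 ⟨hx.1, h⟩⟩
  rw [h2]
  exact z.open_source.chartMeasurable.inter h1.chartMeasurable.compl

omit [ChartedSpace ClosedHalfPlane X] in
theorem exists_isOpen_subset_coordBall {z : OpenPartialHomeomorph X ℂ} {p : X} (hp : p ∈ z.source)
    (hz : z p = 0) {ε : ℝ} (hε : 0 < ε) : ∃ V, IsOpen V ∧ p ∈ V ∧ V ⊆ coordBall z ε :=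
  ⟨z.source ∩ z ⁻¹' Metric.ball 0 ε, z.isOpen_inter_preimage Metric.isOpen_ball,
    ⟨hp, by rw [mem_preimage, hz]; exact Metric.mem_ball_self hε⟩,
    fun _ hx => ⟨hx.1, (mem_ball_zero_iff.1 hx.2).le⟩⟩

omit [ChartedSpace ClosedHalfPlane X] in
theorem exists_ball_subset_preimage {z : OpenPartialHomeomorph X ℂ} {p : X} (hp : p ∈ z.source)
    (hz : z p = 0) {O : Set X} (hO : IsOpen O) (hpO : p ∈ O) :
    ∃ r > 0, Metric.ball 0 r ⊆ z.target ∩ z.symm ⁻¹' O := by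
  refine Metric.isOpen_iff.1 (z.isOpen_inter_preimage_symm hO) 0 ?_
  rw [← hz]
  exact ⟨z.map_source hp, by rwa [mem_preimage, z.left_inv hp]⟩

omit [ChartedSpace ClosedHalfPlane X] in
theorem eventually_coordBall_subset {z : OpenPartialHomeomorph X ℂ} {p : X} (hp : p ∈ z.source)
    (hz : z p = 0) {O : Set X} (hO : IsOpen O) (hpO : p ∈ O) :
    ∀ᶠ ε in 𝓝[>] (0 : ℝ), coordBall z ε ⊆ O := by
  obtain ⟨r, hr, h⟩ := exists_ball_subset_preimage hp hz hO hpO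
  filter_upwards [Ioo_mem_nhdsGT hr] with ε hε x hx
  have := (h (mem_ball_zero_iff.2 (hx.2.trans_lt hε.2))).2
  rwa [mem_preimage, z.left_inv hx.1] at this

/-- A family of neighbourhoods of `D` shrinking to `D`. -/
structure ShrinksTo (B : ℝ → Set X) (D : Set X) : Prop where
  chartMeasurable : ∀ ε, ChartMeasurable (B ε)
  exists_isOpen : ∀ ε, 0 < ε → ∃ V, IsOpen V ∧ D ⊆ V ∧ V ⊆ B ε
  eventually_subset : ∀ O, IsOpen O → D ⊆ O → ∀ᶠ ε in 𝓝[>] (0 : ℝ), B ε ⊆ O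

theorem shrinksTo_iUnion_coordBall (hD : D.Finite) {z : D → OpenPartialHomeomorph X ℂ}
    (hz : ∀ p : D, IsLocalCoordinateAt (z p) p) :
    ShrinksTo (fun ε => ⋃ p : D, coordBall (z p) ε) D := by
  have := hD.to_subtype
  refine ⟨fun ε => ChartMeasurable.iUnion fun p => chartMeasurable_coordBall _ _, ?_, ?_⟩
  · intro ε hε
    choose V hV hpV hVB using fun p : D => exists_isOpen_subset_coordBall (hz p).1 (hz p).2.1 hε
    exact ⟨⋃ p, V p, isOpen_iUnion hV, fun p hp => mem_iUnion.2 ⟨⟨p, hp⟩, hpV ⟨p, hp⟩⟩,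
      iUnion_mono hVB⟩
  · intro O hO hDO
    have : ∀ᶠ ε in 𝓝[>] (0 : ℝ), ∀ p : D, coordBall (z p) ε ⊆ O := eventually_all.2 fun p =>
      eventually_coordBall_subset (hz p).1 (hz p).2.1 hO (hDO p.2)
    filter_upwards [this] with ε hε
    exact iUnion_subset hε

theorem ShrinksTo.disjoint_compl {B : ℝ → Set X} (hB : ShrinksTo B D) {ε : ℝ} (hε : 0 < ε) :
    Disjoint (B ε)ᶜ D := by
  obtain ⟨V, -, hDV, hVB⟩ := hB.exists_isOpen ε hε
  exact disjoint_left.2 fun x hx hxD => hx (hVB (hDV hxD))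

/-! ### Additivity of the integrals and convergence for logarithmic poles -/

section Compact

variable [CompactSpace X] [T2Space X]

theorem ShrinksTo.absConvergentOn {B : ℝ → Set X} (hB : ShrinksTo B D) {ε : ℝ} (hε : 0 < ε)
    (θ : PolarForm X 1 1 D) : θ.AbsConvergentOn (B ε)ᶜ := by
  obtain ⟨V, hV, hDV, hVB⟩ := hB.exists_isOpen ε hε
  exact θ.absConvergentOn hV hDV (hB.chartMeasurable ε).compl
    (disjoint_left.2 fun x hx hxV => hx (hVB hxV))

theorem PolarForm.integralOn_add {θ α γ : PolarForm X 1 1 D} {A : Set X} (hA : ChartMeasurable A)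
    (h : ∀ e, ∀ z ∈ chartSet e A, θ.coeff e z = α.coeff e z + γ.coeff e z)
    (hα : α.AbsConvergentOn A) (hγ : γ.AbsConvergentOn A) :
    θ.integralOn A = α.integralOn A + γ.integralOn A := by
  rw [PolarForm.integralOn_eq_sum, PolarForm.integralOn_eq_sum, PolarForm.integralOn_eq_sum,
    ← Finset.sum_add_distrib]
  refine Finset.sum_congr rfl fun e _ => ?_
  rw [← integral_add (hα e) (hγ e)]
  refine setIntegral_congr_fun (hA e) fun z hz => ?_
  simp only [PolarForm.integrand]
  rw [h e z hz]
  ring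

theorem PolarForm.integralOn_eq_zero {θ : PolarForm X 1 1 D} {A : Set X}
    (h : ∀ e, ∀ z ∈ chartSet e A, θ.coeff e z = 0) : θ.integralOn A = 0 := by
  rw [PolarForm.integralOn_eq_sum]
  refine Finset.sum_eq_zero fun e _ => setIntegral_eq_zero_of_forall_eq_zero fun z hz => ?_
  rw [PolarForm.integrand, h e z hz, mul_zero]

theorem PolarForm.boundaryIntegral_eq_zero {β : PolarForm X 0 1 D}
    (h : ∀ e, ∀ t : ℝ, (t : ℂ) ∈ (coord e).target → β.coeff e t = 0) :
    β.boundaryIntegral = 0 := by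
  rw [PolarForm.boundaryIntegral_eq_sum]
  refine Finset.sum_eq_zero fun e _ => setIntegral_eq_zero_of_forall_eq_zero fun t ht => ?_
  rw [h e t ht, mul_zero]

section Manifold

variable [IsManifold halfPlaneModel ∞ X]

theorem PolarForm.boundaryIntegral_add (hDb : Disjoint D (halfPlaneModel.boundary X))
    (β γ : PolarForm X 0 1 D) :
    (β.add γ).boundaryIntegral = β.boundaryIntegral + γ.boundaryIntegral := by
  have hint : ∀ (β : PolarForm X 0 1 D) (e : atlas ClosedHalfPlane X),
      IntegrableOn (fun t : ℝ => (partition X e ((coord e).symm (t : ℂ)) : ℂ) * β.coeff e (t : ℂ))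
        {t : ℝ | (t : ℂ) ∈ (coord e).target} := by
    intro β e
    refine integrableOn_boundary hDb (F := fun z => (partition X e ((coord e).symm z) : ℂ) *
      β.coeff e z) ?_ (isClosed_tsupport _) (tsupport_partition_subset e) fun t _ htK => ?_
    · exact ((continuousOn_partition e e).mono fun z hz => hz.1).mul (β.continuousOn_coeff e)
    · rw [image_eq_zero_of_notMem_tsupport htK, Complex.ofReal_zero, zero_mul]
  rw [PolarForm.boundaryIntegral_eq_sum, PolarForm.boundaryIntegral_eq_sum,
    PolarForm.boundaryIntegral_eq_sum, ← Finset.sum_add_distrib]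
  refine Finset.sum_congr rfl fun e _ => ?_
  rw [← integral_add (hint β e) (hint γ e)]
  refine integral_congr_ae (Eventually.of_forall fun t => ?_)
  exact mul_add _ _ _

omit [IsManifold halfPlaneModel ∞ X] in
/-- Forms with logarithmic poles are absolutely integrable. -/
theorem PolarForm.IsLog.absConvergentOn (hD : D.Finite) {α : PolarForm X 1 1 D} (hα : α.IsLog) :
    α.AbsConvergentOn univ := by
  intro e
  set C := chartSet e (tsupport (partition X e)) with hC
  have hCc : IsCompact C := isCompact_chartSet e (isClosed_tsupport _) (tsupport_partition_subset e)
  -- Near a point of `D` this is the integrability of a simple pole; elsewhere the coefficient is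
  -- continuous up to the boundary.
  have h1 : LocallyIntegrableOn (α.coeff e) C := by
    intro z hz
    by_cases hzD : (coord e).symm z ∈ D
    · have := PoleAt.integrableAtFilter (hα e _ hzD ((coord e).map_target hz.1))
      rw [(coord e).right_inv hz.1] at this
      exact this.filter_mono nhdsWithin_le_nhds
    · obtain ⟨V, hV, hVe⟩ := exists_isOpen_chartSet e hD.isClosed.isOpen_compl
      have hzV : z ∈ V ∩ range halfPlaneModel := by rw [← hVe]; exact ⟨hz.1, hzD⟩
      obtain ⟨r, hr, hrV⟩ := Metric.nhds_basis_closedBall.mem_iff.1 (hV.mem_nhds hzV.1)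
      refine ⟨C ∩ Metric.closedBall z r,
        inter_mem self_mem_nhdsWithin (mem_nhdsWithin_of_mem_nhds (Metric.closedBall_mem_nhds z hr)),
        ?_⟩
      refine ContinuousOn.integrableOn_compact (hCc.inter_right Metric.isClosed_closedBall) ?_
      refine (α.continuousOn_coeff e).mono fun w hw => ?_
      rw [hVe]
      exact ⟨hrV hw.2, coord_target_subset e hw.1.1⟩
  have h2 : IntegrableOn (fun z => (partition X e ((coord e).symm z) : ℂ) *
      (-2 * Complex.I * α.coeff e z)) C :=
    integrableOn_partition_mul e hCc.measurableSet (fun z hz => hz.1)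
      ((h1.integrableOn_isCompact hCc).const_mul _)
  have h3 : IntegrableOn (α.integrand e) C := by
    rwa [show α.integrand e = _ from funext (α.integrand_eq e)]
  refine h3.of_forall_sdiff_eq_zero (isOpen_univ.chartMeasurable e) fun z hz => ?_
  rw [PolarForm.integrand_eq, image_eq_zero_of_notMem_tsupport fun h => hz.2 ⟨hz.1.1, h⟩,
    Complex.ofReal_zero, zero_mul]

-- Dominated convergence: in each chart `D` is a finite set, hence null, and every point outside `D`
-- eventually lies outside `B ε`.
omit [IsManifold halfPlaneModel ∞ X] in
theorem PolarForm.tendsto_integralOn_compl (hD : D.Finite) {α : PolarForm X 1 1 D}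
    (hα : α.AbsConvergentOn univ) {B : ℝ → Set X} (hB : ShrinksTo B D) :
    Tendsto (fun ε => α.integralOn (B ε)ᶜ) (𝓝[>] 0) (𝓝 (α.integralOn univ)) := by
  simp only [PolarForm.integralOn_eq_sum]
  refine tendsto_finsetSum _ fun e _ => ?_
  have hm : ∀ ε, MeasurableSet (chartSet e (B ε)ᶜ) := fun ε => (hB.chartMeasurable ε).compl e
  have hmu : MeasurableSet (chartSet e (univ : Set X)) := isOpen_univ.chartMeasurable e
  simp only [← integral_indicator (hm _), ← integral_indicator hmu]
  have hi : Integrable ((chartSet e univ).indicator (α.integrand e)) :=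
    (integrable_indicator_iff hmu).2 (hα e)
  refine tendsto_integral_filter_of_dominated_convergence
    (fun z => ‖(chartSet e univ).indicator (α.integrand e) z‖) ?_ ?_ hi.norm ?_
  · refine Eventually.of_forall fun ε => ?_
    have : IntegrableOn (α.integrand e) (chartSet e (B ε)ᶜ) :=
      (hα e).mono_set fun z hz => ⟨hz.1, mem_univ _⟩
    exact ((integrable_indicator_iff (hm ε)).2 this).aestronglyMeasurable
  · refine Eventually.of_forall fun ε => Eventually.of_forall fun z => ?_
    exact norm_indicator_le_of_subset (fun w (hw : w ∈ chartSet e (B ε)ᶜ) =>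
      (⟨hw.1, mem_univ _⟩ : w ∈ chartSet e univ)) _ _
  · have hfin : (chartSet e D).Finite := by
      refine (hD.image (coord e)).subset fun z hz => ⟨_, hz.2, (coord e).right_inv hz.1⟩
    filter_upwards [hfin.countable.ae_notMem volume] with z hz
    by_cases hzT : z ∈ (coord e).target
    · have hzD : (coord e).symm z ∉ D := fun h => hz ⟨hzT, h⟩
      refine tendsto_const_nhds.congr' ?_
      filter_upwards [hB.eventually_subset {(coord e).symm z}ᶜ isOpen_compl_singleton
        fun x hx hxz => hzD (hxz ▸ hx)] with ε hε
      have h1 : z ∈ chartSet e univ := ⟨hzT, mem_univ _⟩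
      have h2 : z ∈ chartSet e (B ε)ᶜ := ⟨hzT, fun h => hε h rfl⟩
      rw [indicator_of_mem h1, indicator_of_mem h2]
    · have h1 : ∀ A : Set X, z ∉ chartSet e A := fun A h => hzT h.1
      simp only [indicator_of_notMem (h1 _)]
      exact tendsto_const_nhds

end Manifold

end Compact

/-! ### Stokes' theorem in the limit, away from `D` -/

section Manifold

variable [CompactSpace X] [T2Space X] [IsManifold halfPlaneModel ∞ X]

/-- Stokes' theorem for `β` on the complement of the shrinking neighbourhoods `B`, in the limit. -/
def StokesLimit (hD : D.Finite) (hDb : Disjoint D (halfPlaneModel.boundary X)) (B : ℝ → Set X)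
    (β : PolarForm X 0 1 D) : Prop :=
  Tendsto (fun ε => (β.del hD hDb).integralOn (B ε)ᶜ) (𝓝[>] 0) (𝓝 β.boundaryIntegral)

variable {hD : D.Finite} {hDb : Disjoint D (halfPlaneModel.boundary X)} {B : ℝ → Set X}

/-- The hypothesis on `δ` concerns coefficients only, as these are the data of a form;
decompositions by cut-off functions can then be checked pointwise. -/
theorem StokesLimit.add (hB : ShrinksTo B D) {β γ δ : PolarForm X 0 1 D}
    (hβ : StokesLimit hD hDb B β) (hγ : StokesLimit hD hDb B γ)
    (h : δ.coeff = (β.add γ).coeff) : StokesLimit hD hDb B δ := by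
  obtain ⟨d, _, _, _⟩ := δ
  simp only at h
  subst h
  unfold StokesLimit
  change Tendsto (fun ε => ((β.add γ).del hD hDb).integralOn (B ε)ᶜ) _
    (𝓝 (β.add γ).boundaryIntegral)
  rw [PolarForm.boundaryIntegral_add hDb]
  refine (Tendsto.add hβ hγ).congr' ?_
  filter_upwards [self_mem_nhdsWithin] with ε hε
  have hε' : 0 < ε := hε
  refine (PolarForm.integralOn_add (hB.chartMeasurable ε).compl (fun e z hz => ?_)
    (hB.absConvergentOn hε' _) (hB.absConvergentOn hε' _)).symm
  exact PolarForm.del_add β γ ⟨hz.1, disjoint_left.1 (hB.disjoint_compl hε') hz.2⟩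

theorem integrableOn_del_smul (hB : ShrinksTo B D) {f : X → ℝ} (hf : SmoothOnCharts f)
    {e : atlas ClosedHalfPlane X} (hfe : tsupport f ⊆ (coord e).source) (β : PolarForm X 0 1 D)
    {ε : ℝ} (hε : 0 < ε) :
    IntegrableOn (((β.smul hDb f hf).del hD hDb).coeff e) (chartSet e (B ε)ᶜ) := by
  obtain ⟨V, hV, hDV, hVB⟩ := hB.exists_isOpen ε hε
  exact integrableOn_chartSet (PolarForm.continuousOn_coeff _ e) (isClosed_tsupport f) hfe hV hDV
    (hB.chartMeasurable ε).compl (disjoint_left.2 fun x hx hxV => hx (hVB hxV))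
    fun z hz hzf => PolarForm.del_smul_eq_zero hf β hz.1 hzf

theorem integralOn_del_smul (hB : ShrinksTo B D) {f : X → ℝ} (hf : SmoothOnCharts f)
    {e : atlas ClosedHalfPlane X} (hfe : tsupport f ⊆ (coord e).source) (β : PolarForm X 0 1 D)
    {ε : ℝ} (hε : 0 < ε) :
    ((β.smul hDb f hf).del hD hDb).integralOn (B ε)ᶜ =
      ∫ z in chartSet e (B ε)ᶜ, -2 * Complex.I * wirtinger ((β.smul hDb f hf).coeff e) z :=
  PolarForm.integralOn_eq_setIntegral _ e (hB.chartMeasurable ε).compl (hB.disjoint_compl hε)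
    (fun _ _ hz hze => PolarForm.del_smul_eq_zero hf β hz.1 fun h => hze (hfe h))
    (integrableOn_del_smul hB hf hfe β hε)

omit [CompactSpace X] [T2Space X] in
theorem PolarForm.smul_coeff_eq_zero {a b : ℕ} {f : X → ℝ} (hf : SmoothOnCharts f)
    (β : PolarForm X a b D) {e : atlas ClosedHalfPlane X} {z : ℂ}
    (hz : (coord e).symm z ∉ tsupport f) : (β.smul hDb f hf).coeff e z = 0 := by
  change (f ((coord e).symm z) : ℂ) * _ = 0
  rw [image_eq_zero_of_notMem_tsupport hz, Complex.ofReal_zero, zero_mul]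

/-- Stokes' theorem for forms supported in a chart away from `D`. -/
theorem stokesLimit_of_disjoint (hB : ShrinksTo B D) {f : X → ℝ} (hf : SmoothOnCharts f)
    {e : atlas ClosedHalfPlane X} (hfe : tsupport f ⊆ (coord e).source)
    (hfD : Disjoint (tsupport f) D) (β : PolarForm X 0 1 D) :
    StokesLimit hD hDb B (β.smul hDb f hf) := by
  classical
  set γ := β.smul hDb f hf with hγ
  -- Extension by zero gives a smooth function of bounded support on the whole half-plane, because
  -- the support of `f` is compact in the chart and misses `D`.
  set g : ℂ → ℂ := (coord e).target.indicator (γ.coeff e) with hg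
  set C := chartSet e (tsupport f) with hC
  have hCc : IsCompact C := isCompact_chartSet e (isClosed_tsupport f) hfe
  have hg0 : ∀ z ∉ C, g z = 0 := by
    intro z hz
    by_cases hzT : z ∈ (coord e).target
    · rw [hg, indicator_of_mem hzT]
      exact PolarForm.smul_coeff_eq_zero hf β fun h => hz ⟨hzT, h⟩
    · rw [hg, indicator_of_notMem hzT]
  have hgev : ∀ z ∈ (coord e).target, g =ᶠ[𝓝[range halfPlaneModel] z] γ.coeff e := by
    intro z hz
    filter_upwards [coord_target_mem_nhdsWithin hz] with w hw
    rw [hg, indicator_of_mem hw]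
  have hgs : ContDiffOn ℝ ∞ g (range halfPlaneModel) := by
    intro z hz
    by_cases hzC : z ∈ C
    · have hzD : z ∈ chartSet e Dᶜ := ⟨hzC.1, disjoint_left.1 hfD hzC.2⟩
      exact ((γ.smooth e z hzD).mono_of_mem_nhdsWithin
        (chartSet_mem_nhdsWithin hD.isClosed.isOpen_compl hzD)).congr_of_eventuallyEq
        (hgev z hzC.1) ((hgev z hzC.1).self_of_nhdsWithin hz)
    · have hev : g =ᶠ[𝓝[range halfPlaneModel] z] fun _ => 0 := by
        filter_upwards [mem_nhdsWithin_of_mem_nhds (hCc.isClosed.isOpen_compl.mem_nhds hzC)]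
          with w hw using hg0 w hw
      exact contDiffWithinAt_const.congr_of_eventuallyEq hev (hg0 z hzC)
  have hwirt : ∀ z ∈ (coord e).target, wirtinger g z = wirtinger (γ.coeff e) z := fun z hz =>
    wirtinger_congr (coord_target_subset e hz) (hgev z hz)
  have hwirt0 : ∀ z ∈ range halfPlaneModel, z ∉ C → wirtinger g z = 0 := fun z hz hzC =>
    wirtinger_eq_zero hz (by
      filter_upwards [mem_nhdsWithin_of_mem_nhds (hCc.isClosed.isOpen_compl.mem_nhds hzC)]
        with w hw using hg0 w hw)
  obtain ⟨R, hR⟩ := hCc.isBounded.subset_ball 0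
  have hstokes := integral_wirtinger_halfPlane hgs (R := R) fun z _ hz => hg0 z fun hzC => by
    have := mem_ball_zero_iff.1 (hR hzC)
    linarith
  have hm : MeasurableSet {t : ℝ | (t : ℂ) ∈ (coord e).target} :=
    Complex.measurable_ofReal (measurableSet_coord_target e)
  have hbd : γ.boundaryIntegral = ∫ t : ℝ, g t := by
    rw [PolarForm.boundaryIntegral_eq_setIntegral hDb γ e
      (fun e' t _ hte => PolarForm.smul_coeff_eq_zero hf β fun h => hte (hfe h))
      (integrableOn_boundary hDb (γ.continuousOn_coeff e) (isClosed_tsupport f) hfe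
        fun t _ htf => PolarForm.smul_coeff_eq_zero hf β htf),
      ← integral_indicator hm]
    rfl
  unfold StokesLimit
  rw [hbd, ← hstokes]
  -- Once `B ε` misses the support of `f`, removing it does not change the integral.
  refine tendsto_const_nhds.congr' ?_
  filter_upwards [self_mem_nhdsWithin, hB.eventually_subset (tsupport f)ᶜ
    (isClosed_tsupport f).isOpen_compl (disjoint_left.1 hfD.symm)] with ε hε hεB
  rw [integralOn_del_smul hB hf hfe β hε]
  have h1 : ∫ z in chartSet e (B ε)ᶜ, -2 * Complex.I * wirtinger (γ.coeff e) z =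
      ∫ z in chartSet e (B ε)ᶜ, -2 * Complex.I * wirtinger g z :=
    setIntegral_congr_fun ((hB.chartMeasurable ε).compl e) fun z hz => by
      rw [hwirt z hz.1]
  rw [h1]
  refine setIntegral_eq_of_subset_of_forall_sdiff_eq_zero measurableSet_range_halfPlaneModel
    (fun z hz => coord_target_subset e hz.1) fun z hz => ?_
  rw [hwirt0 z hz.1 fun hzC => hz.2 ⟨hzC.1, fun h => hεB h hzC.2⟩, mul_zero]

end Manifold

/-! ### Stokes' theorem near a point of `D` -/

section Manifold

variable [IsManifold halfPlaneModel ∞ X]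

theorem contDiffOn_coord_comp_symm {z : OpenPartialHomeomorph X ℂ} {p : X}
    (hz : IsLocalCoordinateAt z p) (e : atlas ClosedHalfPlane X) :
    ContDiffOn ℂ ∞ (coord e ∘ z.symm) (z.target ∩ z.symm ⁻¹' (coord e).source) := by
  rw [← contMDiffOn_iff_contDiffOn]
  refine (OpenPartialHomeomorph.contMDiffOn_extend (mem_maximalAtlas e)).comp
    (hz.2.2.2.mono inter_subset_left) fun w hw => ?_
  have := hw.2
  rwa [mem_preimage, coord_source] at this

/-- The chain rule for the inverse `z ∘ (coord e).symm`, which is also holomorphic. Nonvanishing is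
what `PoleAt.pullback` needs to carry the pole to the coordinate `z`. -/
theorem deriv_coord_comp_symm_ne_zero {z : OpenPartialHomeomorph X ℂ} {p : X}
    (hz : IsLocalCoordinateAt z p) {e : atlas ClosedHalfPlane X} (hpe : p ∈ (coord e).source)
    (him : 0 < (coord e p).im) : deriv (coord e ∘ z.symm) 0 ≠ 0 := by
  have hp0 : z.symm 0 = p := by rw [← hz.2.1, z.left_inv hz.1]
  have h0 : (0 : ℂ) ∈ z.target := by rw [← hz.2.1]; exact z.map_source hz.1
  have hψ0 : (coord e ∘ z.symm) 0 = coord e p := by rw [Function.comp_apply, hp0]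
  have hopen : IsOpen (z.target ∩ z.symm ⁻¹' (coord e).source) :=
    z.isOpen_inter_preimage_symm (isOpen_coord_source e)
  have hmem : (0 : ℂ) ∈ z.target ∩ z.symm ⁻¹' (coord e).source := ⟨h0, by rwa [mem_preimage, hp0]⟩
  have hψ : DifferentiableAt ℂ (coord e ∘ z.symm) 0 :=
    ((contDiffOn_coord_comp_symm hz e).contDiffAt (hopen.mem_nhds hmem)).differentiableAt (by simp)
  have hχ : DifferentiableAt ℂ (z ∘ (coord e).symm) (coord e p) := by
    have h1 : ContMDiffOn 𝓘(ℂ, ℂ) 𝓘(ℂ, ℂ) ∞ (z ∘ (coord e).symm) (chartSet e z.source) := by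
      refine hz.2.2.1.comp ((contMDiffOn_extend_symm (mem_maximalAtlas e)).mono fun w hw => ?_)
        fun w hw => hw.2
      rw [← OpenPartialHomeomorph.extend_target']
      exact hw.1
    rw [contMDiffOn_iff_contDiffOn] at h1
    have h2 := eventually_nhds_of_im_pos him (eventually_chartSet z.open_source hpe hz.1)
    exact (h1.contDiffAt h2).differentiableAt (by simp)
  intro h
  have h1 : HasDerivAt ((z ∘ (coord e).symm) ∘ (coord e ∘ z.symm))
      (deriv (z ∘ (coord e).symm) (coord e p) * deriv (coord e ∘ z.symm) 0) 0 := by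
    have := hχ.hasDerivAt
    rw [← hψ0] at this
    have h3 := this.comp (0 : ℂ) hψ.hasDerivAt
    rwa [hψ0] at h3
  have h2 : ((z ∘ (coord e).symm) ∘ (coord e ∘ z.symm)) =ᶠ[𝓝 0] id := by
    filter_upwards [hopen.mem_nhds hmem] with w hw
    simp only [Function.comp_apply, id]
    rw [(coord e).left_inv hw.2, z.right_inv hw.1]
  have h4 := (h1.congr_of_eventuallyEq h2.symm).unique (hasDerivAt_id 0)
  rw [h, mul_zero] at h4
  exact zero_ne_one h4

variable [CompactSpace X] [T2Space X]
variable {hD : D.Finite} {hDb : Disjoint D (halfPlaneModel.boundary X)} {B : ℝ → Set X}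

/-- Stokes' theorem for forms supported in a small neighbourhood of a point of `D`. -/
theorem exists_isOpen_stokesLimit (hB : ShrinksTo B D) {z : OpenPartialHomeomorph X ℂ} {p : X}
    (hz : IsLocalCoordinateAt z p) (hpD : p ∈ D) (β : PolarForm X 0 1 D) :
    ∃ W : Set X, IsOpen W ∧ p ∈ W ∧ W ⊆ z.source ∧ (∀ q ∈ D, q ≠ p → q ∉ W) ∧
      ∀ (f : X → ℝ) (hf : SmoothOnCharts f), tsupport f ⊆ W →
        (∀ᶠ ε in 𝓝[>] (0 : ℝ), ∀ x ∈ tsupport f, (x ∈ B ε ↔ ‖z x‖ ≤ ε)) →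
        StokesLimit hD hDb B (β.smul hDb f hf) := by
  classical
  obtain ⟨e, hpe⟩ : ∃ e : atlas ClosedHalfPlane X, p ∈ (coord e).source :=
    ⟨⟨chartAt ClosedHalfPlane p, chart_mem_atlas _ p⟩, by
      rw [coord_source]; exact mem_chart_source _ p⟩
  have him := im_coord_pos_of_mem hDb hpD hpe
  have hp0 : z.symm 0 = p := by rw [← hz.2.1, z.left_inv hz.1]
  set ψ : ℂ → ℂ := coord e ∘ z.symm with hψ
  have hψ0 : ψ 0 = coord e p := by rw [hψ, Function.comp_apply, hp0]
  -- A region inside one chart, off the boundary, and containing no other point of `D`.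
  set O : Set X := ((coord e).source ∩ coord e ⁻¹' {w | 0 < w.im}) ∩ (D \ {p})ᶜ with hO
  have hOo : IsOpen O := by
    refine IsOpen.inter ?_ (isOpen_compl_sdiff_singleton hD p)
    exact (OpenPartialHomeomorph.continuousOn_extend _).isOpen_inter_preimage
      (isOpen_coord_source e) (isOpen_lt continuous_const Complex.continuous_im)
  have hpO : p ∈ O := ⟨⟨hpe, him⟩, by simp⟩
  obtain ⟨r₀, hr₀, hball₀⟩ := exists_ball_subset_preimage hz.1 hz.2.1 hOo hpO
  have hψs₀ : ContDiffOn ℂ ∞ ψ (Metric.ball 0 r₀) :=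
    (contDiffOn_coord_comp_symm hz e).mono fun w hw => ⟨(hball₀ hw).1, (hball₀ hw).2.1.1⟩
  obtain ⟨m, hm⟩ := β.pole e p hpD hpe
  rw [hasPoleOfOrderLE_iff, ← hψ0] at hm
  -- The coefficient of `β` is read in the coordinate `z`, where the removed set is a round disc;
  -- there it is `G / w^m`.
  obtain ⟨G, hG, hGev⟩ := poleAt_iff.1 (hm.pullback 0 1 (Metric.ball_mem_nhds 0 hr₀)
    (hψs₀.differentiableOn (by simp)) (deriv_coord_comp_symm_ne_zero hz hpe him))
  rw [eventually_nhdsWithin_iff] at hGev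
  obtain ⟨r₁, hr₁, hGr⟩ := Metric.eventually_nhds_iff_ball.1 hGev
  set r := min r₀ r₁ with hr
  have hrpos : 0 < r := lt_min hr₀ hr₁
  have hball : Metric.ball 0 r ⊆ z.target ∩ z.symm ⁻¹' O :=
    (Metric.ball_subset_ball (min_le_left _ _)).trans hball₀
  have hψs : ContDiffOn ℂ ∞ ψ (Metric.ball 0 r) :=
    hψs₀.mono (Metric.ball_subset_ball (min_le_left _ _))
  replace hGr : ∀ w ∈ Metric.ball (0 : ℂ) r, w ≠ 0 →
      β.coeff e (ψ w) * (starRingEnd ℂ) (deriv ψ w) = G w / w ^ m := by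
    intro w hw hw0
    have := hGr w (Metric.ball_subset_ball (min_le_right _ _) hw) hw0
    simpa using this
  set W : Set X := z.source ∩ z ⁻¹' Metric.ball 0 r with hW
  have hWO : W ⊆ O := by
    intro x hx
    have := (hball hx.2).2
    rwa [mem_preimage, z.left_inv hx.1] at this
  have hzW : ∀ w ∈ Metric.ball (0 : ℂ) r, z.symm w ∈ W := fun w hw =>
    ⟨z.map_target (hball hw).1, by rwa [mem_preimage, z.right_inv (hball hw).1]⟩
  refine ⟨W, z.isOpen_inter_preimage Metric.isOpen_ball,
    ⟨hz.1, by rw [mem_preimage, hz.2.1]; exact Metric.mem_ball_self hrpos⟩, fun x hx => hx.1,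
    fun q hq hqp hqW => (hWO hqW).2 ⟨hq, hqp⟩, fun f hf hfW hBf => ?_⟩
  have hfe : tsupport f ⊆ (coord e).source := fun x hx => (hWO (hfW hx)).1.1
  set γ := β.smul hDb f hf with hγ
  have hψT : ∀ w ∈ Metric.ball (0 : ℂ) r, ψ w ∈ (coord e).target := fun w hw =>
    (coord e).map_source (hball hw).2.1.1
  have hsψ : ∀ w ∈ Metric.ball (0 : ℂ) r, (coord e).symm (ψ w) = z.symm w := fun w hw =>
    (coord e).left_inv (hball hw).2.1.1
  -- The numerator of the cut-off form, extended by zero to a smooth function on `ℂ`, as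
  -- `tendsto_integral_dzPart_pole` requires.
  set F : ℂ → ℂ := (Metric.ball 0 r).indicator fun w => (f (z.symm w) : ℂ) * G w with hF
  set C : Set ℂ := z '' tsupport f with hC
  have hCc : IsCompact C := (isClosed_tsupport f).isCompact.image_of_continuousOn
    (z.continuousOn.mono fun x hx => (hfW hx).1)
  have hCr : C ⊆ Metric.ball 0 r := by
    rintro _ ⟨x, hx, rfl⟩
    exact (hfW hx).2
  have hF0 : ∀ w ∉ C, F w = 0 := by
    intro w hw
    by_cases hwr : w ∈ Metric.ball (0 : ℂ) r
    · rw [hF, indicator_of_mem hwr, image_eq_zero_of_notMem_tsupport (f := f),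
        Complex.ofReal_zero, zero_mul]
      exact fun h => hw ⟨_, h, z.right_inv (hball hwr).1⟩
    · rw [hF, indicator_of_notMem hwr]
  have hFs : ContDiff ℝ ∞ F := by
    refine contDiff_iff_contDiffAt.2 fun w => ?_
    by_cases hw : w ∈ C
    · have hwr := Metric.isOpen_ball.mem_nhds (hCr hw)
      have h1 : ContDiffAt ℝ ∞ (fun w => (f (z.symm w) : ℂ) * G w) w := by
        refine ContDiffAt.mul ?_ hG.contDiffAt
        have h2 : ContDiffOn ℝ ∞ (fun w => (f ((coord e).symm (ψ w)) : ℂ)) (Metric.ball 0 r) :=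
          (hf.contDiffOn_complex e).comp (hψs.restrict_scalars ℝ) hψT
        exact (h2.congr fun w hw => by rw [hsψ w hw]).contDiffAt hwr
      refine h1.congr_of_eventuallyEq ?_
      filter_upwards [hwr] with v hv
      rw [hF, indicator_of_mem hv]
    · refine contDiffAt_const (c := (0 : ℂ)) |>.congr_of_eventuallyEq ?_
      filter_upwards [hCc.isClosed.isOpen_compl.mem_nhds hw] with v hv using hF0 v hv
  have hFγ : ∀ w ∈ Metric.ball (0 : ℂ) r, w ≠ 0 →
      F w / w ^ m = γ.coeff e (ψ w) * (starRingEnd ℂ) (deriv ψ w) := by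
    intro w hw hw0
    change _ = (f ((coord e).symm (ψ w)) : ℂ) * β.coeff e (ψ w) * _
    rw [mul_assoc, hGr w hw hw0, hsψ w hw, hF, indicator_of_mem hw, mul_div_assoc]
  have hdF : ∀ w ∈ Metric.ball (0 : ℂ) r, w ≠ 0 →
      dzPart (fderiv ℝ (fun w => F w / w ^ m) w) =
        wirtinger (γ.coeff e) (ψ w) * deriv ψ w * (starRingEnd ℂ) (deriv ψ w) := by
    intro w hw hw0
    have hwr := Metric.isOpen_ball.mem_nhds hw
    have hev : (fun w => F w / w ^ m) =ᶠ[𝓝 w]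
        fun w => γ.coeff e (ψ w) * (starRingEnd ℂ) (deriv ψ w) := by
      filter_upwards [hwr, isOpen_compl_singleton.mem_nhds hw0] with v hv hv0 using hFγ v hv hv0
    have hwD : ψ w ∈ chartSet e Dᶜ := by
      refine ⟨hψT w hw, fun h => ?_⟩
      rw [hsψ w hw] at h
      have h2 : z.symm w = p := by
        by_contra hne
        exact (hball hw).2.2 ⟨h, hne⟩
      have h3 := z.right_inv (hball hw).1
      rw [h2, hz.2.1] at h3
      exact hw0 h3.symm
    have hψd : DifferentiableOn ℂ ψ (Metric.ball 0 r) := hψs.differentiableOn (by simp)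
    obtain ⟨M, hM, hM'⟩ := exists_hasFDerivWithinAt_pullback
      (γ.differentiableWithinAt hD hwD).hasFDerivWithinAt
      (hψd.differentiableAt hwr).hasDerivAt.hasDerivWithinAt
      ((hψd.deriv Metric.isOpen_ball).differentiableAt hwr).hasDerivAt.hasDerivWithinAt
      (s := Metric.ball 0 r) (fun v hv => coord_target_subset e (hψT v hv))
    rw [hev.fderiv_eq, (hM.hasFDerivAt hwr).fderiv, hM', wirtinger_eq]
  have hlim := tendsto_integral_dzPart_pole hFs (R := r) (fun w hw => hF0 w fun h => by
    have := mem_ball_zero_iff.1 (hCr h)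
    linarith) m
  have hbd : γ.boundaryIntegral = 0 := by
    refine PolarForm.boundaryIntegral_eq_zero fun e' t ht =>
      PolarForm.smul_coeff_eq_zero hf β fun h => ?_
    have h1 := (hWO (hfW h)).1
    have h2 : 0 < (coord e ((coord e').symm t)).im := h1.2
    rw [im_coord_pos_iff h1.1 ((coord e').map_target ht), (coord e').right_inv ht,
      Complex.ofReal_im] at h2
    exact lt_irrefl _ h2
  unfold StokesLimit
  rw [hbd]
  refine hlim.congr' ?_
  filter_upwards [self_mem_nhdsWithin, hBf] with ε hε hBε
  have hε' : 0 < ε := hε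
  rw [integralOn_del_smul hB hf hfe β hε']
  set S : Set ℂ := {w | w ∈ Metric.ball (0 : ℂ) r ∧ ε < ‖w‖} with hS
  have hSm : MeasurableSet S := Metric.isOpen_ball.measurableSet.inter
    (isOpen_lt continuous_const continuous_norm).measurableSet
  have hS0 : ∀ w ∈ S, w ≠ 0 := by
    rintro w hw rfl
    have := hw.2
    rw [norm_zero] at this
    exact lt_asymm this hε'
  have himg : ψ '' S = chartSet e (W ∩ (coordBall z ε)ᶜ) := by
    ext v
    constructor
    · rintro ⟨w, hw, rfl⟩
      refine ⟨hψT w hw.1, ?_⟩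
      rw [hsψ w hw.1]
      refine ⟨hzW w hw.1, fun h => ?_⟩
      have := h.2
      rw [z.right_inv (hball hw.1).1] at this
      exact not_lt.2 this hw.2
    · intro hv
      refine ⟨z ((coord e).symm v), ⟨hv.2.1.2, not_le.1 fun h => hv.2.2 ⟨hv.2.1.1, h⟩⟩, ?_⟩
      rw [hψ, Function.comp_apply, z.left_inv hv.2.1.1, (coord e).right_inv hv.1]
  have hinj : InjOn ψ S := by
    intro v hv w hw hvw
    have h1 := (coord e).injOn (hball hv.1).2.1.1 (hball hw.1).2.1.1 hvw
    exact z.symm.injOn (hball hv.1).1 (hball hw.1).1 h1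
  have hψd : DifferentiableOn ℂ ψ (Metric.ball 0 r) := hψs.differentiableOn (by simp)
  -- On the support of `f` the set `B ε` is the ball of `z`, and elsewhere the integrand vanishes,
  -- so the domain may be replaced by the image of `S`.
  have h1 : ∫ v in chartSet e (B ε)ᶜ, -2 * Complex.I * wirtinger (γ.coeff e) v =
      ∫ v in ψ '' S, -2 * Complex.I * wirtinger (γ.coeff e) v := by
    have hmW : ChartMeasurable (W ∩ (coordBall z ε)ᶜ) :=
      (z.isOpen_inter_preimage Metric.isOpen_ball).chartMeasurable.inter
        (chartMeasurable_coordBall z ε).compl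
    rw [himg, ← integral_indicator ((hB.chartMeasurable ε).compl e), ← integral_indicator (hmW e)]
    congr 1
    ext v
    by_cases hvT : v ∈ (coord e).target
    · by_cases hvf : (coord e).symm v ∈ tsupport f
      · have hiff : v ∈ chartSet e (B ε)ᶜ ↔ v ∈ chartSet e (W ∩ (coordBall z ε)ᶜ) := by
          have h2 := hBε _ hvf
          constructor
          · exact fun h => ⟨hvT, hfW hvf, fun h' => h.2 (h2.2 h'.2)⟩
          · exact fun h => ⟨hvT, fun h' => h.2.2 ⟨(hfW hvf).1, h2.1 h'⟩⟩
        by_cases hv : v ∈ chartSet e (B ε)ᶜ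
        · rw [indicator_of_mem hv, indicator_of_mem (hiff.1 hv)]
        · rw [indicator_of_notMem hv, indicator_of_notMem fun h => hv (hiff.2 h)]
      · have h0 : wirtinger (γ.coeff e) v = 0 :=
          PolarForm.del_smul_eq_zero (hD := hD) hf β hvT hvf
        simp only [indicator, h0, mul_zero, ite_self]
    · have h2 : ∀ A : Set X, v ∉ chartSet e A := fun A h => hvT h.1
      rw [indicator_of_notMem (h2 _), indicator_of_notMem (h2 _)]
  rw [h1, integral_image_holomorphic (φ' := deriv ψ) hSm (fun w hw =>
    (hψd.differentiableAt (Metric.isOpen_ball.mem_nhds hw.1)).hasDerivAt.hasDerivWithinAt) hinj,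
    setIntegral_eq_of_subset_of_forall_sdiff_eq_zero
      (isOpen_lt continuous_const continuous_norm).measurableSet (s := S) (fun w hw => hw.2)]
  · refine setIntegral_congr_fun hSm fun w hw => ?_
    rw [hdF w hw.1 (hS0 w hw)]
    ring
  · intro w hw
    have hwC : w ∉ C := fun h => hw.2 ⟨hCr h, hw.1⟩
    have hev : (fun w => F w / w ^ m) =ᶠ[𝓝 w] fun _ => 0 := by
      filter_upwards [hCc.isClosed.isOpen_compl.mem_nhds hwC] with v hv
      rw [hF0 v hv, zero_div]
    rw [hev.fderiv_eq]
    simp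

end Manifold

/-! ### Global Stokes' theorem in the limit -/

section Manifold

variable [IsManifold halfPlaneModel ∞ X]

/-- A chart around an interior point gives rise to a local coordinate. -/
theorem exists_isLocalCoordinateAt {p : X} (hp : p ∉ halfPlaneModel.boundary X) :
    ∃ z : OpenPartialHomeomorph X ℂ, IsLocalCoordinateAt z p := by
  obtain ⟨e, hpe⟩ : ∃ e : atlas ClosedHalfPlane X, p ∈ (coord e).source :=
    ⟨⟨chartAt ClosedHalfPlane p, chart_mem_atlas _ p⟩, by
      rw [coord_source]; exact mem_chart_source _ p⟩
  have him := im_coord_pos_of_notMem_boundary hpe hp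
  set c := coord e p with hc
  have hU : IsOpen {w : ℂ | 0 < w.im} := isOpen_lt continuous_const Complex.continuous_im
  have hTo : IsOpen ((coord e).target ∩ {w : ℂ | 0 < w.im}) := by
    obtain ⟨V, hV, h⟩ := exists_isOpen_chartSet e isOpen_univ
    rw [chartSet_univ] at h
    have : (coord e).target ∩ {w : ℂ | 0 < w.im} = V ∩ {w : ℂ | 0 < w.im} := by
      rw [h, inter_assoc, inter_eq_self_of_subset_right (s := range halfPlaneModel)]
      rw [range_halfPlaneModel]
      exact fun w (hw : 0 < w.im) => hw.le
    rw [this]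
    exact hV.inter hU
  -- The chart minus its value at `p`, restricted to the open upper half-plane so that its image is
  -- open in `ℂ`.
  let z : OpenPartialHomeomorph X ℂ :=
    { toFun := fun x => coord e x - c
      invFun := fun w => (coord e).symm (w + c)
      source := (coord e).source ∩ coord e ⁻¹' {w | 0 < w.im}
      target := (fun w => w + c) ⁻¹' ((coord e).target ∩ {w : ℂ | 0 < w.im})
      map_source' := fun x hx => by
        rw [mem_preimage, sub_add_cancel]
        exact ⟨(coord e).map_source hx.1, hx.2⟩
      map_target' := fun w hw => ⟨(coord e).map_target hw.1, by
        rw [mem_preimage, (coord e).right_inv hw.1]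
        exact hw.2⟩
      left_inv' := fun x hx => by rw [sub_add_cancel, (coord e).left_inv hx.1]
      right_inv' := fun w hw => by rw [(coord e).right_inv hw.1, add_sub_cancel_right]
      open_source := (OpenPartialHomeomorph.continuousOn_extend _).isOpen_inter_preimage
        (isOpen_coord_source e) hU
      open_target := hTo.preimage (by fun_prop)
      continuousOn_toFun := ((OpenPartialHomeomorph.continuousOn_extend _).mono
        inter_subset_left).sub continuousOn_const
      continuousOn_invFun := (OpenPartialHomeomorph.continuousOn_extend_symm _).comp
        (by fun_prop) fun w hw => hw.1 }
  refine ⟨z, ⟨hpe, him⟩, sub_self _, ?_, ?_⟩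
  · have h1 : ContMDiff 𝓘(ℂ, ℂ) 𝓘(ℂ, ℂ) ∞ fun w : ℂ => w - c :=
      contMDiff_iff_contDiff.2 (by fun_prop)
    have h2 := OpenPartialHomeomorph.contMDiffOn_extend (mem_maximalAtlas e)
    rw [← coord_source] at h2
    exact h1.comp_contMDiffOn (h2.mono inter_subset_left)
  · have h1 : ContMDiff 𝓘(ℂ, ℂ) 𝓘(ℂ, ℂ) ∞ fun w : ℂ => w + c :=
      contMDiff_iff_contDiff.2 (by fun_prop)
    have h2 := contMDiffOn_extend_symm (mem_maximalAtlas e)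
    rw [← OpenPartialHomeomorph.extend_target'] at h2
    exact h2.comp h1.contMDiffOn fun w hw => hw.1

variable [CompactSpace X] [T2Space X]
variable {hD : D.Finite} {hDb : Disjoint D (halfPlaneModel.boundary X)} {B : ℝ → Set X}

theorem StokesLimit.congr {β γ : PolarForm X 0 1 D} (hβ : StokesLimit hD hDb B β)
    (h : γ.coeff = β.coeff) : StokesLimit hD hDb B γ := by
  obtain ⟨d, _, _, _⟩ := γ
  simp only at h
  subst h
  exact hβ

omit [CompactSpace X] [T2Space X] [IsManifold halfPlaneModel ∞ X] in
theorem SmoothOnCharts.sum {ι : Type*} {f : ι → X → ℝ} (hf : ∀ i, SmoothOnCharts (f i))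
    (s : Finset ι) : SmoothOnCharts fun x => ∑ i ∈ s, f i x :=
  fun e => ContDiffOn.sum (f := fun i => f i ∘ (coord e).symm) fun i _ => hf i e

theorem StokesLimit.smul_sum (hB : ShrinksTo B D) {ι : Type*} {f : ι → X → ℝ}
    (hf : ∀ i, SmoothOnCharts (f i)) (β : PolarForm X 0 1 D)
    (h : ∀ i, StokesLimit hD hDb B (β.smul hDb (f i) (hf i))) (s : Finset ι) :
    StokesLimit hD hDb B (β.smul hDb (fun x => ∑ i ∈ s, f i x) (SmoothOnCharts.sum hf s)) := by
  classical
  induction s using Finset.induction_on with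
  | empty =>
    unfold StokesLimit
    rw [PolarForm.boundaryIntegral_eq_zero fun e t _ =>
      PolarForm.smul_coeff_eq_zero _ β (by simp)]
    refine tendsto_const_nhds.congr fun ε => (PolarForm.integralOn_eq_zero fun e w hw => ?_).symm
    exact PolarForm.del_smul_eq_zero _ β hw.1 (by simp)
  | insert i s hi ih =>
    refine (h i).add hB ih ?_
    funext e w
    change ((∑ j ∈ insert i s, f j _ : ℝ) : ℂ) * _ = (f i _ : ℂ) * _ + ((∑ j ∈ s, f j _ : ℝ) : ℂ) * _
    rw [Finset.sum_insert hi, Complex.ofReal_add, add_mul]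

/-- Stokes' theorem for forms with poles along `D`, in the sense of principal values. -/
theorem stokesLimit {z : D → OpenPartialHomeomorph X ℂ}
    (hz : ∀ p : D, IsLocalCoordinateAt (z p) p) (β : PolarForm X 0 1 D) :
    StokesLimit hD hDb (fun ε => ⋃ p : D, coordBall (z p) ε) β := by
  classical
  have hDt := hD.to_subtype
  have hB := shrinksTo_iUnion_coordBall hD hz
  choose W hWo hpW hWz hWD hWlim using fun p : D =>
    exists_isOpen_stokesLimit (hD := hD) (hDb := hDb) hB (hz p) p.2 β
  have hman := isManifold_real X
  let ch : X → atlas ClosedHalfPlane X := fun x =>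
    ⟨chartAt ClosedHalfPlane x, chart_mem_atlas _ x⟩
  have hch : ∀ x, x ∈ (coord (ch x)).source := fun x => by
    rw [coord_source]; exact mem_chart_source _ x
  -- Every set of this cover falls under one of the two local versions of Stokes' theorem.
  let U : X → Set X := fun x => if h : x ∈ D then W ⟨x, h⟩ else (coord (ch x)).source ∩ Dᶜ
  have hUo : ∀ x, IsOpen (U x) := by
    intro x
    by_cases h : x ∈ D
    · simp only [U, dif_pos h]; exact hWo _
    · simp only [U, dif_neg h]; exact (isOpen_coord_source _).inter hD.isClosed.isOpen_compl
  have hUx : ∀ x, x ∈ U x := by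
    intro x
    by_cases h : x ∈ D
    · simp only [U, dif_pos h]; exact hpW ⟨x, h⟩
    · simp only [U, dif_neg h]; exact ⟨hch x, h⟩
  obtain ⟨ρ, hρ⟩ := SmoothPartitionOfUnity.exists_isSubordinate halfPlaneModelReal isClosed_univ U
    hUo fun x _ => mem_iUnion.2 ⟨x, hUx x⟩
  have hs : ∀ x, SmoothOnCharts (ρ x) := fun x => smoothOnCharts_of_contMDiff (ρ x).contMDiff
  have hlim : ∀ x, StokesLimit hD hDb (fun ε => ⋃ p : D, coordBall (z p) ε)
      (β.smul hDb (ρ x) (hs x)) := by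
    intro x
    have hsub : tsupport (ρ x) ⊆ U x := hρ x
    by_cases h : x ∈ D
    · simp only [U, dif_pos h] at hsub
      refine hWlim ⟨x, h⟩ (ρ x) (hs x) hsub ?_
      -- For small `ε` the balls around the other points miss the support of `ρ x`, on which the
      -- union of balls is then the single ball at `x`.
      have hev : ∀ᶠ ε in 𝓝[>] (0 : ℝ), ∀ q : D, q ≠ ⟨x, h⟩ →
          coordBall (z q) ε ⊆ (tsupport (ρ x))ᶜ := by
        refine eventually_all.2 fun q => ?_
        by_cases hq : q = ⟨x, h⟩
        · exact Eventually.of_forall fun _ h' => absurd hq h'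
        · have := eventually_coordBall_subset (hz q).1 (hz q).2.1
            (isClosed_tsupport (ρ x)).isOpen_compl
            fun h' => hWD ⟨x, h⟩ q q.2 (fun h2 => hq (Subtype.ext h2)) (hsub h')
          filter_upwards [this] with ε hε _ using hε
      filter_upwards [hev] with ε hε y hy
      constructor
      · intro hyB
        obtain ⟨q, hq⟩ := mem_iUnion.1 hyB
        by_cases hqx : q = ⟨x, h⟩
        · subst hqx; exact hq.2
        · exact absurd hy (hε q hqx hq)
      · exact fun hyε => mem_iUnion.2 ⟨⟨x, h⟩, hWz ⟨x, h⟩ (hsub hy), hyε⟩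
    · simp only [U, dif_neg h] at hsub
      exact stokesLimit_of_disjoint hB (hs x) (hsub.trans inter_subset_left)
        (disjoint_left.2 fun y hy hyD => (hsub hy).2 hyD) β
  have hfin : {x | (Function.support (ρ x)).Nonempty}.Finite :=
    ρ.locallyFinite.finite_nonempty_of_compact
  refine (StokesLimit.smul_sum hB hs β hlim hfin.toFinset).congr ?_
  funext e w
  change _ = ((∑ x ∈ hfin.toFinset, ρ x ((coord e).symm w) : ℝ) : ℂ) * _
  have hsum : ∑ x ∈ hfin.toFinset, ρ x ((coord e).symm w) = 1 := by
    rw [← ρ.sum_eq_one (mem_univ ((coord e).symm w)), finsum_eq_sum_of_support_subset]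
    intro x hx
    exact hfin.mem_toFinset.2 ⟨_, hx⟩
  rw [hsum, Complex.ofReal_one, one_mul]

/-- Dominated convergence for `α` plus the limit form of Stokes' theorem for `β`. As the left-hand
side does not involve `α, β` and the limit does not involve `z`, this yields both independence
statements. -/
theorem IsDecomposition.tendsto_integralOn (hD : D.Finite)
    (hDb : Disjoint D (halfPlaneModel.boundary X)) {η α : PolarForm X 1 1 D} {β : PolarForm X 0 1 D}
    (h : IsDecomposition η α β) {z : D → OpenPartialHomeomorph X ℂ}
    (hz : ∀ p : D, IsLocalCoordinateAt (z p) p) :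
    Tendsto (fun ε : ℝ => η.integralOn (⋃ p : D, coordBall (z p) ε)ᶜ) (𝓝[>] 0)
      (𝓝 (α.integralOn univ + β.boundaryIntegral)) := by
  have hB := shrinksTo_iUnion_coordBall hD hz
  have h1 := PolarForm.tendsto_integralOn_compl hD (h.1.absConvergentOn hD) hB
  have h2 : Tendsto _ _ _ := stokesLimit (hD := hD) (hDb := hDb) hz β
  refine (h1.add h2).congr' ?_
  filter_upwards [self_mem_nhdsWithin] with ε hε
  have hε' : 0 < ε := hε
  refine (PolarForm.integralOn_add (hB.chartMeasurable ε).compl (fun e w hw => ?_)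
    (hB.absConvergentOn hε' α) (hB.absConvergentOn hε' _)).symm
  exact h.2 e w hw.1 (disjoint_left.1 (hB.disjoint_compl hε') hw.2)

omit [CompactSpace X] [T2Space X] [IsManifold halfPlaneModel ∞ X] in
/-- The zero form. -/
def PolarForm.zero (X : Type*) [TopologicalSpace X] [ChartedSpace ClosedHalfPlane X] (a b : ℕ)
    (D : Set X) : PolarForm X a b D where
  coeff _ _ := 0
  compat _ _ _ _ _ := by simp
  smooth _ := contDiffOn_const
  pole _ _ _ _ := ⟨0, PoleAt.zero _ 0⟩

/-! ### Existence of decompositions -/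

/-- Modulo `∂`, the pole at a given point can be reduced to a logarithmic one. -/
theorem PolarForm.exists_sub_del_poleAt_one (hD : D.Finite)
    (hDb : Disjoint D (halfPlaneModel.boundary X)) (θ : PolarForm X 1 1 D) {p : X} (hp : p ∈ D) :
    ∃ β : PolarForm X 0 1 D,
      (∀ e : atlas ClosedHalfPlane X, p ∈ (coord e).source →
        PoleAt ((θ.sub (β.del hD hDb)).coeff e) (coord e p) 1) ∧
      ∀ q ∈ D, q ≠ p → ∀ e : atlas ClosedHalfPlane X, q ∈ (coord e).source →
        ∀ᶠ w in 𝓝 (coord e q), (β.del hD hDb).coeff e w = 0 := by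
  obtain ⟨e, hpe⟩ : ∃ e : atlas ClosedHalfPlane X, p ∈ (coord e).source :=
    ⟨⟨chartAt ClosedHalfPlane p, chart_mem_atlas _ p⟩, by
      rw [coord_source]; exact mem_chart_source _ p⟩
  have him := im_coord_pos_of_mem hDb hp hpe
  have hman := isManifold_real X
  obtain ⟨n, hn⟩ := θ.pole e p hp hpe
  rw [hasPoleOfOrderLE_iff] at hn
  -- The primitive `h dz̄ / (z - z(p))^m` is found in one chart and then cut off by a function which
  -- is `1` near `p`, so that the pole at `p` is reduced as it would be without cut-off.
  obtain ⟨h, m, hh, hm⟩ := exists_sub_dzPart_poleAt_one n hn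
  obtain ⟨t, htp, htc, hts⟩ := exists_mem_nhds_isClosed_subset
    (((isOpen_coord_source e).inter (isOpen_compl_sdiff_singleton hD p)).mem_nhds
      (⟨hpe, by simp⟩ : p ∈ (coord e).source ∩ (D \ {p})ᶜ))
  obtain ⟨χ, hχ1, hχ0, -⟩ := exists_contMDiffMap_one_nhds_of_subset_interior (n := ⊤)
    halfPlaneModelReal (isClosed_singleton (x := p)) (t := t)
    (singleton_subset_iff.2 (mem_interior_iff_mem_nhds.2 htp))
  rw [nhdsSet_singleton] at hχ1
  have hχs : SmoothOnCharts χ := smoothOnCharts_of_contMDiff χ.contMDiff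
  have hχt : tsupport χ ⊆ t := closure_minimal (fun x hx => by
    by_contra hxt
    exact hx (hχ0 x hxt)) htc
  have hχD : ∀ q ∈ D, q ≠ p → q ∉ tsupport χ := fun q hq hqp hqt =>
    (hts (hχt hqt)).2 ⟨hq, hqp⟩
  set β := PolarForm.ofChart hDb χ hχs e p hp hpe (hχt.trans (hts.trans inter_subset_left)) hχD h hh m
    with hβ
  have hloc : ∀ᶠ w in 𝓝 (coord e p), β.coeff e w = h w / (w - coord e p) ^ m := by
    obtain ⟨O, hO1, hOo, hpO⟩ := mem_nhds_iff.1 hχ1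
    filter_upwards [eventually_nhds_of_im_pos him (eventually_chartSet hOo hpe hpO)] with w hw
    change (χ ((coord e).symm w) : ℂ) * (h (coord e ((coord e).symm w)) /
      (coord e ((coord e).symm w) - coord e p) ^ m * (starRingEnd ℂ) (transDeriv e e _)) = _
    have h1 : χ ((coord e).symm w) = 1 := hO1 hw.2
    rw [h1, (coord e).right_inv hw.1, transDeriv_self ((coord e).map_target hw.1), map_one,
      Complex.ofReal_one, one_mul, mul_one]
  refine ⟨β, fun e' hpe' => ?_, fun q hq hqp e' hqe' => ?_⟩
  · refine PolarForm.poleAt_trans hD _ hpe' hpe (im_coord_pos_of_mem hDb hp hpe') ?_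
    refine hm.congr (mem_nhdsWithin_of_mem_nhds ?_)
    filter_upwards [hloc.eventually_nhds,
      (isOpen_lt continuous_const Complex.continuous_im).mem_nhds him] with w hw hwi
    have h1 : β.coeff e =ᶠ[𝓝 w] fun w => h w / (w - coord e p) ^ m := hw
    change θ.coeff e w - wirtinger (β.coeff e) w = _
    rw [wirtinger_eq_of_im_pos hwi, h1.fderiv_eq]
  · have himq := im_coord_pos_of_mem hDb hq hqe'
    have h1 := eventually_nhds_of_im_pos himq (eventually_chartSet
      (isClosed_tsupport χ).isOpen_compl hqe' (hχD q hq hqp))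
    filter_upwards [h1] with w hw
    refine wirtinger_eq_zero (coord_target_subset e' hw.1) ?_
    filter_upwards [eventually_eq_zero_of_notMem_tsupport hw.1 hw.2] with v hv
    change (χ ((coord e').symm v) : ℂ) * _ = 0
    rw [hv, Complex.ofReal_zero, zero_mul]

/-- The points of `D` are treated one at a time. The correction made at `p` vanishes near the other
points of `D`, so poles already reduced stay logarithmic. -/
theorem exists_isDecomposition (hD : D.Finite) (hDb : Disjoint D (halfPlaneModel.boundary X))
    (η : PolarForm X 1 1 D) :
    ∃ (α : PolarForm X 1 1 D) (β : PolarForm X 0 1 D), IsDecomposition η α β := by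
  classical
  suffices H : ∀ s : Finset X, (s : Set X) ⊆ D → ∃ β : PolarForm X 0 1 D, ∀ p ∈ s,
      ∀ e : atlas ClosedHalfPlane X, p ∈ (coord e).source →
        PoleAt ((η.sub (β.del hD hDb)).coeff e) (coord e p) 1 by
    obtain ⟨β, hβ⟩ := H hD.toFinset (by simp)
    refine ⟨η.sub (β.del hD hDb), β, fun e p hp hpe => hβ p (hD.mem_toFinset.2 hp) e hpe, ?_⟩
    intro e w _ _
    exact (sub_add_cancel _ _).symm
  intro s
  induction s using Finset.induction_on with
  | empty => exact fun _ => ⟨PolarForm.zero X 0 1 D, by simp⟩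
  | insert p s hps ih =>
    intro hs
    rw [Finset.coe_insert, insert_subset_iff] at hs
    obtain ⟨β, hβ⟩ := ih hs.2
    obtain ⟨γ, hγ, hγ0⟩ := (η.sub (β.del hD hDb)).exists_sub_del_poleAt_one hD hDb hs.1
    have hadd : ∀ e : atlas ClosedHalfPlane X, ∀ q ∈ D, q ∈ (coord e).source →
        ∀ᶠ w in 𝓝[≠] (coord e q), (η.sub ((β.add γ).del hD hDb)).coeff e w =
          (η.sub (β.del hD hDb)).coeff e w - (γ.del hD hDb).coeff e w := by
      intro e q hq hqe
      have himq := im_coord_pos_of_mem hDb hq hqe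
      have h1 := eventually_nhds_of_im_pos himq (eventually_notMem hD hqe)
      filter_upwards [mem_nhdsWithin_of_mem_nhds h1,
        mem_nhdsWithin_of_mem_nhds (coord_target_mem_nhds hqe himq), self_mem_nhdsWithin]
        with w hw hwT hwq
      change η.coeff e w - ((β.add γ).del hD hDb).coeff e w =
        η.coeff e w - (β.del hD hDb).coeff e w - _
      rw [PolarForm.del_add β γ ⟨hwT, hw hwq⟩, sub_sub]
    refine ⟨β.add γ, fun q hq e hqe => ?_⟩
    rw [Finset.mem_insert] at hq
    by_cases hqp : q = p
    · subst hqp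
      exact (hγ e hqe).congr (hadd e q hs.1 hqe)
    · have hqs := hq.resolve_left hqp
      refine (hβ q hqs e hqe).congr ?_
      filter_upwards [hadd e q (hs.2 hqs) hqe,
        mem_nhdsWithin_of_mem_nhds (hγ0 q (hs.2 hqs) hqp e hqe)] with w h1 h2
      rw [h1, h2, sub_zero]

end Manifold

end RiemannSurface

open RiemannSurface in
theorem theorem2p7 {X : Type*} [TopologicalSpace X] [T2Space X] [CompactSpace X]
    [ChartedSpace ClosedHalfPlane X] [IsManifold halfPlaneModel ∞ X]
    (D : Set X) (hD : D.Finite) (hDb : Disjoint D (halfPlaneModel.boundary X))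
    (η : PolarForm X 1 1 D) :
    -- the regularized integral is well defined
    (∃ (α : PolarForm X 1 1 D) (β : PolarForm X 0 1 D), IsDecomposition η α β) ∧
    (∀ (α : PolarForm X 1 1 D) (β : PolarForm X 0 1 D), IsDecomposition η α β →
      α.AbsConvergentOn univ ∧
        η.regularizedIntegral = α.integralOn univ + β.boundaryIntegral) ∧
    -- it is the principal value, whatever the local coordinates
    ∀ z : D → OpenPartialHomeomorph X ℂ, (∀ p : D, IsLocalCoordinateAt (z p) p) →
      (∀ ε : ℝ, 0 < ε → η.AbsConvergentOn (⋃ p : D, coordBall (z p) ε)ᶜ) ∧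
      Tendsto (fun ε : ℝ => η.integralOn (⋃ p : D, coordBall (z p) ε)ᶜ) (𝓝[>] 0)
        (𝓝 η.regularizedIntegral) := by
  have hex := exists_isDecomposition hD hDb η
  have hpair : ∃ αβ : PolarForm X 1 1 D × PolarForm X 0 1 D, IsDecomposition η αβ.1 αβ.2 := by
    obtain ⟨α, β, h⟩ := hex
    exact ⟨(α, β), h⟩
  have hreg : η.regularizedIntegral =
      hpair.choose.1.integralOn univ + hpair.choose.2.boundaryIntegral := dif_pos hpair
  refine ⟨hex, fun α β h => ⟨h.1.absConvergentOn hD, ?_⟩, fun z hz => ⟨fun ε hε => ?_, ?_⟩⟩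
  -- Independence of the decomposition: with any auxiliary coordinates, both values are the limit of
  -- the same integrals of `η`.
  · choose z hz using fun p : D => exists_isLocalCoordinateAt (disjoint_left.1 hDb p.2)
    rw [hreg]
    exact tendsto_nhds_unique (hpair.choose_spec.tendsto_integralOn hD hDb hz)
      (h.tendsto_integralOn hD hDb hz)
  · exact (shrinksTo_iUnion_coordBall hD hz).absConvergentOn hε η
  · rw [hreg]
    exact hpair.choose_spec.tendsto_integralOn hD hDb hz
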